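/- **Graph databases.** A *property graph* $G$ consists of finite sets $N$ of nodes, $E_d$ of directed edges and $E_u$ of undirected edges, relations $\mathsf{src},\mathsf{tgt}\subseteq E\times N$ with $E=E_d\cup E_u$ that give every edge exactly one source and exactly one target (for an undirected edge: its two endpoints, in either order), and relations $\mathsf{property}\subseteq(E\cup N)\times\mathsf{Keys}\times\mathsf{Const}$ and $\mathsf{label}\subseteq(E\cup N)\times\mathsf{Labels}$; identifiers, labels, keys and constants are bit strings. A *graph database* is a tuple $\mathcal G=\langle G_1,\dots,G_m\rangle$ of property graphs. A *path* $n_0e_0n_1\cdots e_{k-1}n_k$ has length $k$. An *assignment* $\mu$ is a partial map from variables to nodes, edges, constants, lists and paths; $\mu_1\sim\mu_2$ means that they agree on their common domain, and then $\mu_1\bowtie\mu_2$ is their union. A *table* is a set of assignments. **Syntax.** Let $x,y,x_i,X$ be variables, $\ell$ a label, $a$ a key, $c$ a constant, $0\le i\le j\le\infty$ with $i<\infty$, $n\ge 0$, $k\ge1$ (square brackets around $x$, ${:}\ell$, and the parts of $\Pi$ mark optional parts). - Terms: $\chi::=x\mid x.a\mid c$. - Path patterns: $\pi::=([x][{:}\ell])\mid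 {-}[[x][{:}\ell]]{\to}\mid{\leftarrow}[[x][{:}\ell]]{-}\mid{-}[[x][{:}\ell]]{-}\mid\pi\pi\mid\pi\cup\pi\mid\pi\{i..j\}\mid\pi\ \mathsf{where}\ \theta$. - Conditions: $\theta::=\chi=\chi\mid x:\ell\mid\theta\ \mathsf{or}\ \theta\mid\theta\ \mathsf{and}\ \theta\mid\mathsf{not}\ \theta\mid\mathsf{exists}\ Q$. - Graph patterns: $\Pi::=[\mathsf{shortest}]\,[\mathsf{trail}\mid\mathsf{acyclic}]\,[X=]\,\pi\mid\Pi,\Pi$. - Clauses: $C::=\mathsf{match}\ \Pi\mid\mathsf{let}\ x=\chi\mid\mathsf{for}\ x\ \mathsf{in}\ y\mid\mathsf{filter}\ \theta$. - Linear queries: $L::=\mathsf{use}\ G_r\ L\mid C\,L\mid\mathsf{return}\ \chi_1\ \mathsf{as}\ x_1,\dots,\chi_n\ \mathsf{as}\ x_n$. - Queries: $Q::=L\mid\mathsf{use}\ G_r\,\{Q_1\ \mathsf{then}\cdots\mathsf{then}\ Q_k\}\mid Q\ \mathsf{intersect}\ Q\mid Q\ \mathsf{union}\ Q\mid Q\ \mathsf{except}\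 Q$. A condition inside a descriptor, as in $(x{:}\ell\ \mathsf{where}\ \theta)$, abbreviates $(x{:}\ell)\ \mathsf{where}\ \theta$. The schema $\mathrm{sch}(\pi)$ is the set of variables bound by $\pi$: $\emptyset$ or $\{x\}$ for atoms, $\mathrm{sch}(\pi_1)\cup\mathrm{sch}(\pi_2)$ for $\pi_1\pi_2$, $\mathrm{sch}(\pi_1)$ for $\pi_1\cup\pi_2$, unchanged by repetition and $\mathsf{where}$. **Semantics.** For a database $\mathcal G$ and a current graph $G$ of it, $[\![\pi]\!]^G$ is a set of pairs (path, assignment). A node pattern yields the one-node paths of $G$ (with label $\ell$, if given), binding $x$ to the node; the edge patterns yield the one-edge paths $n_1en_2$ with $e\in E_d$ followed from source to target, with $e\in E_d$ followed from target to source, and with $e\in E_u$ followed in either direction, respectively (with label $\ell$, if given), binding $x$ to $e$. $\pi_1\pi_2$ yields $(p_1p_2,\mu_1\bowtie\mu_2)$ for $(p_i,\mu_i)\in[\![\pi_i]\!]^G$ where $p_1$ ends at the start of $p_2$ and $\mu_1\sim\mu_2$; $\cup$ is union; $\pi\ \mathsf{where}\ \theta$ keeps the pairs whose $\mu$ satisfies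 $\theta$; $[\![\pi\{i..j\}]\!]^G=\bigcup_{i\le k\le j,\ k<\infty}[\![\pi]\!]^G_k$, where $[\![\pi]\!]^G_0$ consists of the one-node paths with the empty assignment and, for $k>0$, $[\![\pi]\!]^G_k$ of the pairs $(p_1\cdots p_k,\mu)$ with $(p_r,\mu_r)\in[\![\pi]\!]^G$, consecutive paths fitting together, and $\mu(x)=\mathsf{list}(\mu_1(x),\dots,\mu_k(x))$ for $x\in\mathrm{sch}(\pi)$ (and only those $x$). The values of a term under $\mu$ are: $\mu(x)$ for $x$; all $v$ with $(\mu(x),a,v)\in\mathsf{property}^G$ for $x.a$; $c$ for $c$. Further, $\chi_1=\chi_2$ holds if the two terms have a common value, $x:\ell$ holds if $(\mu(x),\ell)\in\mathsf{label}^G$, and $\mathsf{exists}\ Q$ holds if $[\![Q]\!]^G(\{\mu\})\ne\emptyset$; the Boolean connectives are as usual. In graph patterns, $\mathsf{trail}$ (resp. $\mathsf{acyclic}$) keeps the pairs whose path repeats no edge (resp. no node); $\mathsf{shortest}$, applied afterwards, keeps $(p,\mu)$ if no $(p',\mu)$ in the same set, with $p'$ having the same first and the same last node as $p$, has a shorter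 $p'$; $X=$ adds $X\mapsto p$; and the comma combines the assignments with $\mu_1\sim\mu_2$ into $\mu_1\bowtie\mu_2$. Clauses and queries map tables to tables: $\mathsf{match}\ \Pi$ maps $T$ to the set of all $\mu\bowtie\mu'$ with $\mu\in T$, $\mu'$ from $[\![\Pi]\!]^G$, $\mu\sim\mu'$; $\mathsf{let}\ x=\chi$ extends each $\mu\in T$ by $x\mapsto v$ for every value $v$ of $\chi$; $\mathsf{for}\ x\ \mathsf{in}\ y$ extends each $\mu\in T$ by $x\mapsto v$ for every element $v$ of the list (or path) $\mu(y)$, and drops $\mu$ if $\mu(y)$ is not composite; $\mathsf{filter}\ \theta$ keeps the $\mu$ that satisfy $\theta$; $C\,L$ applies $C$, then $L$; $\mathsf{use}\ G_r$ makes $G_r$ the current graph for what follows in its scope; $\mathsf{return}$ yields, for each $\mu\in T$, the assignments with domain $\{x_1,\dots,x_n\}$ that map each $x_r$ to a value of $\chi_r$; $\mathsf{then}$ is composition; and the set operations are applied to the output tables. The *output* of $Q$ on $\mathcal G$, with a fixed default graph $G_d$ of the database, is $[\![Q]\!]^{G_d}(\{()\})$, where $()$ is the empty assignment. Queries are assumed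 to be well formed: $\mathrm{sch}(\pi_1)=\mathrm{sch}(\pi_2)$ in $\pi_1\cup\pi_2$; the operands of a set operation have the same output variables; the variables $x$ bound by $\mathsf{let}$ and $\mathsf{for}$ and a path variable $X$ are new; $x_1,\dots,x_n$ in $\mathsf{return}$ are distinct; and terms, conditions and $\mathsf{for}\ x\ \mathsf{in}\ y$ only use variables bound at that point, where $\mathsf{exists}\ Q$ starts from the variables bound so far. **Fragments** (the conditions apply everywhere in the query, also inside $\mathsf{exists}$). A query is *basic* if it has no path binding $X=$, $\mathrm{sch}(\pi_1)\cap\mathrm{sch}(\pi_2)=\emptyset$ for every pattern $\pi_1\pi_2$, and $\mathrm{sch}(\pi)=\emptyset$ for every pattern $\pi\{i..j\}$. It is *positive* if it contains neither $\mathsf{not}$ nor $\mathsf{except}$. **Statement.** Let $Q$ be a (well-formed) basic GQL query over databases of $m$ graphs, fixed together with the index $d$ of the default graph. Consider the decision problem: given a graph database $\mathcal G=\langle G_1,\dots,G_m\rangle$, encoded as a bit string by listing its components, is the output of $Q$ on $\mathcal G$ nonempty? This problem is in the polynomial hierarchy $\mathrm{PH}$. If moreover $Q$ is positive and does not use $\mathsf{shortest}$,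 it is in $\mathrm{NP}$. -/

import Mathlib

/-! ### Polynomial time, NP and the polynomial hierarchy

Decision problems are sets of bit strings. The machine model with its step count is Mathlib's
multi-stack Turing machine `Turing.FinTM2`. -/

namespace Complexity

/-- Bit strings. -/
abbrev Word : Type := List Bool

/-- The class P: the characteristic function is computed by a Turing machine in polynomial time. -/
def P : Set (Set Word) :=
  {L | ∃ f : Word → Bool,
    Nonempty (Turing.TM2ComputableInPolyTime (fun w : Word => w) Computability.encodeBool f) ∧
    ∀ w, w ∈ L ↔ f w = true}

/-- A self-delimiting code of a bit string: every bit is preceded by `true`, the end is marked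
by `false`. -/
def delimit (w : Word) : Word := w.flatMap (fun b => [true, b]) ++ [false]

/-- The code of a pair of bit strings as one bit string. -/
def pair (x y : Word) : Word := delimit x ++ y

/-- Languages obtained from a language in `C` by a polynomially bounded existential quantifier. -/
def existsPoly (C : Set (Set Word)) : Set (Set Word) :=
  {L | ∃ R ∈ C, ∃ q : Polynomial ℕ,
    ∀ x, x ∈ L ↔ ∃ y : Word, y.length ≤ q.eval x.length ∧ pair x y ∈ R}

/-- Languages obtained from a language in `C` by a polynomially bounded universal quantifier. -/
def forallPoly (C : Set (Set Word)) : Set (Set Word) :=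
  {L | ∃ R ∈ C, ∃ q : Polynomial ℕ,
    ∀ x, x ∈ L ↔ ∀ y : Word, y.length ≤ q.eval x.length → pair x y ∈ R}

/-- The class NP, through polynomial-time verifiable certificates of polynomial length. -/
def NP : Set (Set Word) := existsPoly P

mutual
/-- The levels `Σₖᵖ` of the polynomial hierarchy. -/
def SigmaP : ℕ → Set (Set Word)
  | 0 => P
  | k + 1 => existsPoly (PiP k)
/-- The levels `Πₖᵖ` of the polynomial hierarchy. -/
def PiP : ℕ → Set (Set Word)
  | 0 => P
  | k + 1 => forallPoly (SigmaP k)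
end

/-- The polynomial hierarchy. -/
def PH : Set (Set Word) := {L | ∃ k, L ∈ SigmaP k}

end Complexity

namespace GQL

open Complexity (Word delimit)

/-! ### Property graphs -/

/-- Identifiers of nodes and edges, labels, keys, property values and constants are bit strings.
Each kind of identifier has its own place or its own constructor below, so that the kinds are
pairwise disjoint. -/
abbrev Name : Type := Word

/-- Directed and undirected edges. -/
inductive Edge : Type where
  | directed (e : Name)
  | undirected (e : Name)

/-- Graph elements: nodes and edges. -/
inductive Elem : Type where
  | node (n : Name)
  | edge (e : Edge)

/-- Property graphs. For an undirected edge `src` and `tgt` only list the two endpoints; the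
semantics below does not depend on which is which. -/
structure PropertyGraph : Type where
  nodes : Finset Name
  dirEdges : Finset Name
  undirEdges : Finset Name
  src : Finset (Edge × Name)
  tgt : Finset (Edge × Name)
  property : Finset (Elem × Name × Name)
  label : Finset (Elem × Name)

namespace PropertyGraph

/-- `e` is an edge of `G`. -/
def HasEdge (G : PropertyGraph) : Edge → Prop
  | .directed e => e ∈ G.dirEdges
  | .undirected e => e ∈ G.undirEdges

/-- `a` is a node or an edge of `G`. -/
def HasElem (G : PropertyGraph) : Elem → Prop
  | .node n => n ∈ G.nodes
  | .edge e => G.HasEdge e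

/-- The typing conditions on the components of a property graph: every edge has exactly one source
and one target, which are nodes; only nodes and edges of the graph carry properties and labels. -/
structure Valid (G : PropertyGraph) : Prop where
  src_mem : ∀ e n, (e, n) ∈ G.src → G.HasEdge e ∧ n ∈ G.nodes
  tgt_mem : ∀ e n, (e, n) ∈ G.tgt → G.HasEdge e ∧ n ∈ G.nodes
  src_unique : ∀ e, G.HasEdge e → ∃! n, (e, n) ∈ G.src
  tgt_unique : ∀ e, G.HasEdge e → ∃! n, (e, n) ∈ G.tgt
  property_mem : ∀ a k c, (a, k, c) ∈ G.property → G.HasElem a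
  label_mem : ∀ a l, (a, l) ∈ G.label → G.HasElem a

end PropertyGraph

/-- Graph databases `⟨G₁, …, Gₘ⟩`. -/
abbrev Database (m : ℕ) : Type := Fin m → PropertyGraph

/-! ### Paths, values, assignments -/

/-- A path `n₀ e₀ n₁ e₁ … nₖ`, as its first node `n₀` and the list of the pairs `(eᵢ, nᵢ₊₁)`. -/
structure GPath : Type where
  first : Name
  steps : List (Edge × Name)

namespace GPath

/-- The nodes of a path, in order, with repetitions. -/
def nodes (p : GPath) : List Name := p.first :: p.steps.map Prod.snd

/-- The edges of a path, in order, with repetitions. -/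
def edges (p : GPath) : List Edge := p.steps.map Prod.fst

/-- The last node of a path. -/
def last (p : GPath) : Name := (p.steps.map Prod.snd).getLastD p.first

/-- The number of edges of a path, counted with repetitions. -/
def len (p : GPath) : ℕ := p.steps.length

/-- The concatenation of two paths (meant for `p.last = q.first`). -/
def append (p q : GPath) : GPath := ⟨p.first, p.steps ++ q.steps⟩

/-- `Concat [p₁, …, pₖ] p`, `k ≥ 1`: consecutive paths fit together and `p` is `p₁ ⋯ pₖ`. -/
inductive Concat : List GPath → GPath → Prop where
  | single (p : GPath) : Concat [p] p
  | cons {p q : GPath} {l : List GPath} : p.last = q.first → Concat l q →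
      Concat (p :: l) (p.append q)

/-- The alternating sequence of the nodes and edges of a path. -/
def elems (p : GPath) : List Elem :=
  .node p.first :: p.steps.flatMap (fun s => [.edge s.1, .node s.2])

end GPath

/-- The values of variables: graph elements, constants (among them the property values), and the
composite values, namely lists and paths. -/
inductive Value : Type where
  | elem (a : Elem)
  | const (c : Name)
  | list (l : List Value)
  | path (p : GPath)

/-- Variables. -/
abbrev Var : Type := ℕ

/-- Assignments: partial mappings from variables to values. -/
abbrev Assignment : Type := Var → Option Value

/-- Tables are sets of assignments. -/
abbrev Table : Type := Set Assignment

namespace Assignment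

/-- The assignment with empty domain. -/
def empty : Assignment := fun _ => none

/-- The assignment `{x ↦ v}`, which is empty if there is no variable. -/
def bind (x : Option Var) (v : Value) : Assignment :=
  fun y => if x = some y then some v else none

/-- `μ₁ ∼ μ₂`: agreement on the common domain. -/
def Compatible (μ₁ μ₂ : Assignment) : Prop :=
  ∀ x v₁ v₂, μ₁ x = some v₁ → μ₂ x = some v₂ → v₁ = v₂

/-- The union `μ₁ ⋈ μ₂` of (compatible) assignments. -/
def join (μ₁ μ₂ : Assignment) : Assignment := fun x => (μ₁ x).or (μ₂ x)

end Assignment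

/-! ### The language -/

/-- Terms `x`, `x.a` and `c`. -/
inductive Trm : Type where
  | var (x : Var)
  | prop (x : Var) (a : Name)
  | const (c : Name)

/-- The restrictors `trail` and `acyclic`. -/
inductive PathMode : Type where
  | trail
  | acyclic

mutual

/-- Path patterns over databases of `m` graphs. In the atomic patterns the variable and the label
are optional; a condition in a descriptor is written with `filter`, as `(x:ℓ where θ)` is
`(x:ℓ) where θ`. -/
inductive Pat (m : ℕ) : Type where
  /-- `(x:ℓ)` -/
  | node (x : Option Var) (l : Option Name) : Pat m
  /-- `-[x:ℓ]->` -/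
  | fwd (x : Option Var) (l : Option Name) : Pat m
  /-- `<-[x:ℓ]-` -/
  | bwd (x : Option Var) (l : Option Name) : Pat m
  /-- `-[x:ℓ]-` -/
  | undir (x : Option Var) (l : Option Name) : Pat m
  | concat (π₁ π₂ : Pat m) : Pat m
  | union (π₁ π₂ : Pat m) : Pat m
  /-- `π{i..j}`, with `j = ∞` allowed -/
  | rep (π : Pat m) (i : ℕ) (j : ℕ∞) : Pat m
  /-- `π where θ` -/
  | filter (π : Pat m) (θ : Cond m) : Pat m

/-- Conditions. -/
inductive Cond (m : ℕ) : Type where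
  | eq (χ₁ χ₂ : Trm) : Cond m
  /-- `x : ℓ` -/
  | hasLabel (x : Var) (l : Name) : Cond m
  | or (θ₁ θ₂ : Cond m) : Cond m
  | and (θ₁ θ₂ : Cond m) : Cond m
  | not (θ : Cond m) : Cond m
  /-- `exists Q` -/
  | exist (Q : Query m) : Cond m

/-- Graph patterns. -/
inductive GPat (m : ℕ) : Type where
  /-- `[shortest] [trail | acyclic] [X =] π` -/
  | pat (shortest : Bool) (mode : Option PathMode) (X : Option Var) (π : Pat m) : GPat m
  /-- `ψ₁, ψ₂` -/
  | join (ψ₁ ψ₂ : GPat m) : GPat m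

/-- Clauses. -/
inductive Clause (m : ℕ) : Type where
  /-- `match ψ` -/
  | matching (ψ : GPat m) : Clause m
  /-- `let x = χ` -/
  | letEq (x : Var) (χ : Trm) : Clause m
  /-- `for x in y` -/
  | forIn (x y : Var) : Clause m
  /-- `filter θ` -/
  | filter (θ : Cond m) : Clause m

/-- Linear queries. -/
inductive LinQuery (m : ℕ) : Type where
  /-- `use G L` -/
  | use (g : Fin m) (L : LinQuery m) : LinQuery m
  /-- `C L` -/
  | clause (C : Clause m) (L : LinQuery m) : LinQuery m
  /-- `return χ₁ as x₁, …, χₙ as xₙ` -/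
  | ret (items : List (Trm × Var)) : LinQuery m

/-- Queries. -/
inductive Query (m : ℕ) : Type where
  | lin (L : LinQuery m) : Query m
  /-- `use G { Q₁ then … then Qₖ }` -/
  | use (g : Fin m) (s : QuerySeq m) : Query m
  | intersect (Q₁ Q₂ : Query m) : Query m
  | union (Q₁ Q₂ : Query m) : Query m
  | except (Q₁ Q₂ : Query m) : Query m

/-- Nonempty sequences `Q₁ then … then Qₖ` of queries. -/
inductive QuerySeq (m : ℕ) : Type where
  | single (Q : Query m) : QuerySeq m
  | cons (Q : Query m) (s : QuerySeq m) : QuerySeq m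

end

/-! ### Schemas -/

/-- The variables of a term. -/
def Trm.vars : Trm → Finset Var
  | .var x => {x}
  | .prop x _ => {x}
  | .const _ => ∅

/-- The schema of a path pattern. -/
def Pat.sch {m : ℕ} : Pat m → Finset Var
  | .node x _ => x.toFinset
  | .fwd x _ => x.toFinset
  | .bwd x _ => x.toFinset
  | .undir x _ => x.toFinset
  | .concat π₁ π₂ => π₁.sch ∪ π₂.sch
  | .union π₁ _ => π₁.sch
  | .rep π _ _ => π.sch
  | .filter π _ => π.sch

/-- The schema of a graph pattern. -/
def GPat.sch {m : ℕ} : GPat m → Finset Var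
  | .pat _ _ X π => X.toFinset ∪ π.sch
  | .join ψ₁ ψ₂ => ψ₁.sch ∪ ψ₂.sch

/-- The schema of the output table of a clause on input tables with schema `S`. -/
def Clause.out {m : ℕ} (S : Finset Var) : Clause m → Finset Var
  | .matching ψ => S ∪ ψ.sch
  | .letEq x _ => insert x S
  | .forIn x _ => insert x S
  | .filter _ => S

/-- The schema of the output table of a linear query. -/
def LinQuery.out {m : ℕ} : LinQuery m → Finset Var
  | .use _ L => L.out
  | .clause _ L => L.out
  | .ret items => (items.map Prod.snd).toFinset

mutual

/-- The schema of the output table of a query. -/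
def Query.out {m : ℕ} : Query m → Finset Var
  | .lin L => L.out
  | .use _ s => s.out
  | .intersect Q₁ _ => Q₁.out
  | .union Q₁ _ => Q₁.out
  | .except Q₁ _ => Q₁.out

/-- The schema of the output table of a sequence of queries. -/
def QuerySeq.out {m : ℕ} : QuerySeq m → Finset Var
  | .single Q => Q.out
  | .cons _ s => s.out

end

/-! ### Well-formed queries

The side conditions under which the semantics is defined. The finite set `S` is the schema of the
incoming assignments. -/

mutual

/-- Well-formed path patterns: the operands of a union have the same schema, and conditions only
mention variables that are bound. -/
def Pat.WellFormed {m : ℕ} : Pat m → Prop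
  | .node _ _ => True
  | .fwd _ _ => True
  | .bwd _ _ => True
  | .undir _ _ => True
  | .concat π₁ π₂ => π₁.WellFormed ∧ π₂.WellFormed
  | .union π₁ π₂ => π₁.sch = π₂.sch ∧ π₁.WellFormed ∧ π₂.WellFormed
  | .rep π i j => (i : ℕ∞) ≤ j ∧ π.WellFormed
  | .filter π θ => π.WellFormed ∧ θ.WellFormed π.sch

/-- Well-formed conditions on assignments with domain `S`. -/
def Cond.WellFormed {m : ℕ} : Cond m → Finset Var → Prop
  | .eq χ₁ χ₂, S => χ₁.vars ⊆ S ∧ χ₂.vars ⊆ S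
  | .hasLabel x _, S => x ∈ S
  | .or θ₁ θ₂, S => θ₁.WellFormed S ∧ θ₂.WellFormed S
  | .and θ₁ θ₂, S => θ₁.WellFormed S ∧ θ₂.WellFormed S
  | .not θ, S => θ.WellFormed S
  | .exist Q, S => Q.WellFormed S

/-- Well-formed graph patterns. -/
def GPat.WellFormed {m : ℕ} : GPat m → Prop
  | .pat _ _ X π => (∀ x ∈ X, x ∉ π.sch) ∧ π.WellFormed
  | .join ψ₁ ψ₂ => ψ₁.WellFormed ∧ ψ₂.WellFormed

/-- Well-formed clauses: `let` and `for` bind a new variable. -/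
def Clause.WellFormed {m : ℕ} : Clause m → Finset Var → Prop
  | .matching ψ, _ => ψ.WellFormed
  | .letEq x χ, S => x ∉ S ∧ χ.vars ⊆ S
  | .forIn x y, S => x ∉ S ∧ y ∈ S
  | .filter θ, S => θ.WellFormed S

/-- Well-formed linear queries. -/
def LinQuery.WellFormed {m : ℕ} : LinQuery m → Finset Var → Prop
  | .use _ L, S => L.WellFormed S
  | .clause C L, S => C.WellFormed S ∧ L.WellFormed (C.out S)
  | .ret items, S => (items.map Prod.snd).Nodup ∧ ∀ i ∈ items, i.1.vars ⊆ S

/-- Well-formed queries: the operands of a set operation have the same schema. -/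
def Query.WellFormed {m : ℕ} : Query m → Finset Var → Prop
  | .lin L, S => L.WellFormed S
  | .use _ s, S => s.WellFormed S
  | .intersect Q₁ Q₂, S => Q₁.out = Q₂.out ∧ Q₁.WellFormed S ∧ Q₂.WellFormed S
  | .union Q₁ Q₂, S => Q₁.out = Q₂.out ∧ Q₁.WellFormed S ∧ Q₂.WellFormed S
  | .except Q₁ Q₂, S => Q₁.out = Q₂.out ∧ Q₁.WellFormed S ∧ Q₂.WellFormed S

/-- Well-formed sequences of queries. -/
def QuerySeq.WellFormed {m : ℕ} : QuerySeq m → Finset Var → Prop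
  | .single Q, S => Q.WellFormed S
  | .cons Q s, S => Q.WellFormed S ∧ s.WellFormed Q.out

end

/-! ### Semantics -/

/-- The values of a term under `μ` on `G`. The term `x.a` has as values all the property values
that `G` attaches to `μ(x)` at the key `a`: none if there is no such property. -/
def Trm.sem (G : PropertyGraph) (μ : Assignment) : Trm → Set Value
  | .var x => {v | μ x = some v}
  | .prop x a => {v | ∃ e c, μ x = some (.elem e) ∧ (e, a, c) ∈ G.property ∧ v = .const c}
  | .const c => {.const c}

/-- The element `a` carries the label `l`, if there is one. -/
def PropertyGraph.Labelled (G : PropertyGraph) (a : Elem) (l : Option Name) : Prop :=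
  ∀ k ∈ l, (a, k) ∈ G.label

/-- `⟦π⟧ₖ`, from `R = ⟦π⟧` and the schema `S` of `π`. -/
def iterate (G : PropertyGraph) (S : Finset Var) (R : Set (GPath × Assignment)) :
    ℕ → Set (GPath × Assignment)
  | 0 => {r | ∃ n ∈ G.nodes, r = (⟨n, []⟩, Assignment.empty)}
  | k + 1 => {r | ∃ l : List (GPath × Assignment), l.length = k + 1 ∧ (∀ t ∈ l, t ∈ R) ∧
      GPath.Concat (l.map Prod.fst) r.1 ∧
      (∀ x ∈ S, ∃ vs : List Value, l.map (fun t => t.2 x) = vs.map some ∧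
        r.2 x = some (.list vs)) ∧
      (∀ x ∉ S, r.2 x = none)}

/-- The effect of the restrictors `trail` and `acyclic`. -/
def restrict (mode : Option PathMode) (R : Set (GPath × Assignment)) :
    Set (GPath × Assignment) :=
  match mode with
  | none => R
  | some .trail => {r ∈ R | r.1.edges.Nodup}
  | some .acyclic => {r ∈ R | r.1.nodes.Nodup}

/-- The effect of the restrictor `shortest`, if it is present. -/
def restrictShortest (shortest : Bool) (R : Set (GPath × Assignment)) :
    Set (GPath × Assignment) :=
  {r ∈ R | shortest = true → ∀ p, (p, r.2) ∈ R → p.first = r.1.first → p.last = r.1.last →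
    r.1.len ≤ p.len}

mutual

/-- `⟦π⟧` on the graph `𝒢 g`. -/
def Pat.sem {m : ℕ} (𝒢 : Database m) : Pat m → Fin m → Set (GPath × Assignment)
  | .node x l, g => {r | ∃ n ∈ (𝒢 g).nodes, (𝒢 g).Labelled (.node n) l ∧
      r = (⟨n, []⟩, Assignment.bind x (.elem (.node n)))}
  | .fwd x l, g => {r | ∃ e n₁ n₂, e ∈ (𝒢 g).dirEdges ∧
      (Edge.directed e, n₁) ∈ (𝒢 g).src ∧ (Edge.directed e, n₂) ∈ (𝒢 g).tgt ∧
      (𝒢 g).Labelled (.edge (.directed e)) l ∧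
      r = (⟨n₁, [(.directed e, n₂)]⟩, Assignment.bind x (.elem (.edge (.directed e))))}
  | .bwd x l, g => {r | ∃ e n₁ n₂, e ∈ (𝒢 g).dirEdges ∧
      (Edge.directed e, n₂) ∈ (𝒢 g).src ∧ (Edge.directed e, n₁) ∈ (𝒢 g).tgt ∧
      (𝒢 g).Labelled (.edge (.directed e)) l ∧
      r = (⟨n₁, [(.directed e, n₂)]⟩, Assignment.bind x (.elem (.edge (.directed e))))}
  | .undir x l, g => {r | ∃ e n₁ n₂, e ∈ (𝒢 g).undirEdges ∧
      (((Edge.undirected e, n₁) ∈ (𝒢 g).src ∧ (Edge.undirected e, n₂) ∈ (𝒢 g).tgt) ∨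
        ((Edge.undirected e, n₂) ∈ (𝒢 g).src ∧ (Edge.undirected e, n₁) ∈ (𝒢 g).tgt)) ∧
      (𝒢 g).Labelled (.edge (.undirected e)) l ∧
      r = (⟨n₁, [(.undirected e, n₂)]⟩, Assignment.bind x (.elem (.edge (.undirected e))))}
  | .concat π₁ π₂, g => {r | ∃ p₁ μ₁ p₂ μ₂, (p₁, μ₁) ∈ π₁.sem 𝒢 g ∧ (p₂, μ₂) ∈ π₂.sem 𝒢 g ∧
      p₁.last = p₂.first ∧ Assignment.Compatible μ₁ μ₂ ∧
      r = (p₁.append p₂, Assignment.join μ₁ μ₂)}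
  | .union π₁ π₂, g => π₁.sem 𝒢 g ∪ π₂.sem 𝒢 g
  | .rep π i j, g => {r | ∃ k : ℕ, i ≤ k ∧ (k : ℕ∞) ≤ j ∧
      r ∈ iterate (𝒢 g) π.sch (π.sem 𝒢 g) k}
  | .filter π θ, g => {r ∈ π.sem 𝒢 g | θ.sem 𝒢 g r.2}

/-- `⟦θ⟧` holds under `μ` on the graph `𝒢 g`. -/
def Cond.sem {m : ℕ} (𝒢 : Database m) : Cond m → Fin m → Assignment → Prop
  | .eq χ₁ χ₂, g, μ => ∃ v, v ∈ χ₁.sem (𝒢 g) μ ∧ v ∈ χ₂.sem (𝒢 g) μ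
  | .hasLabel x l, g, μ => ∃ a, μ x = some (.elem a) ∧ (a, l) ∈ (𝒢 g).label
  | .or θ₁ θ₂, g, μ => θ₁.sem 𝒢 g μ ∨ θ₂.sem 𝒢 g μ
  | .and θ₁ θ₂, g, μ => θ₁.sem 𝒢 g μ ∧ θ₂.sem 𝒢 g μ
  | .not θ, g, μ => ¬ θ.sem 𝒢 g μ
  | .exist Q, g, μ => (Q.sem 𝒢 g {μ}).Nonempty

/-- `⟦ψ⟧` on the graph `𝒢 g`: pairs of a tuple of paths and an assignment. -/
def GPat.sem {m : ℕ} (𝒢 : Database m) : GPat m → Fin m → Set (List GPath × Assignment)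
  | .pat shortest mode X π, g => {r | ∃ p μ,
      (p, μ) ∈ restrictShortest shortest (restrict mode (π.sem 𝒢 g)) ∧
      r = ([p], Assignment.join μ (Assignment.bind X (.path p)))}
  | .join ψ₁ ψ₂, g => {r | ∃ p₁ μ₁ p₂ μ₂, (p₁, μ₁) ∈ ψ₁.sem 𝒢 g ∧ (p₂, μ₂) ∈ ψ₂.sem 𝒢 g ∧
      Assignment.Compatible μ₁ μ₂ ∧ r = (p₁ ++ p₂, Assignment.join μ₁ μ₂)}

/-- The table transformation of a clause on the graph `𝒢 g`. -/
def Clause.sem {m : ℕ} (𝒢 : Database m) : Clause m → Fin m → Table → Table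
  | .matching ψ, g, T => {ν | ∃ μ ∈ T, ∃ p μ', (p, μ') ∈ ψ.sem 𝒢 g ∧
      Assignment.Compatible μ μ' ∧ ν = Assignment.join μ μ'}
  | .letEq x χ, g, T => {ν | ∃ μ ∈ T, ∃ v ∈ χ.sem (𝒢 g) μ, ν = Function.update μ x (some v)}
  | .forIn x y, _, T => {ν | ∃ μ ∈ T, ∃ v, ν = Function.update μ x (some v) ∧
      ((∃ l, μ y = some (.list l) ∧ v ∈ l) ∨
        (∃ p a, μ y = some (.path p) ∧ a ∈ p.elems ∧ v = .elem a))}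
  | .filter θ, g, T => {μ ∈ T | θ.sem 𝒢 g μ}

/-- The table transformation of a linear query on the graph `𝒢 g`. -/
def LinQuery.sem {m : ℕ} (𝒢 : Database m) : LinQuery m → Fin m → Table → Table
  | .use g' L, _, T => L.sem 𝒢 g' T
  | .clause C L, g, T => L.sem 𝒢 g (C.sem 𝒢 g T)
  | .ret items, g, T => {ν | ∃ μ ∈ T,
      (∀ i ∈ items, ∃ v ∈ i.1.sem (𝒢 g) μ, ν i.2 = some v) ∧
      (∀ x ∉ items.map Prod.snd, ν x = none)}

/-- The table transformation of a query on the graph `𝒢 g`. -/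
def Query.sem {m : ℕ} (𝒢 : Database m) : Query m → Fin m → Table → Table
  | .lin L, g, T => L.sem 𝒢 g T
  | .use g' s, _, T => s.sem 𝒢 g' T
  | .intersect Q₁ Q₂, g, T => Q₁.sem 𝒢 g T ∩ Q₂.sem 𝒢 g T
  | .union Q₁ Q₂, g, T => Q₁.sem 𝒢 g T ∪ Q₂.sem 𝒢 g T
  | .except Q₁ Q₂, g, T => Q₁.sem 𝒢 g T \ Q₂.sem 𝒢 g T

/-- The table transformation of a sequence of queries on the graph `𝒢 g`. -/
def QuerySeq.sem {m : ℕ} (𝒢 : Database m) : QuerySeq m → Fin m → Table → Table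
  | .single Q, g, T => Q.sem 𝒢 g T
  | .cons Q s, g, T => s.sem 𝒢 g (Q.sem 𝒢 g T)

end

/-- The output of a query on a graph database with default graph `𝒢 g`: its value on the table
that consists of the empty assignment. -/
def Query.output {m : ℕ} (Q : Query m) (𝒢 : Database m) (g : Fin m) : Table :=
  Q.sem 𝒢 g {Assignment.empty}

/-! ### Fragments -/

mutual

/-- Basic path patterns: the parts of a concatenation share no variable, and a repeated pattern
has no variable. -/
def Pat.Basic {m : ℕ} : Pat m → Prop
  | .node _ _ => True
  | .fwd _ _ => True
  | .bwd _ _ => True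
  | .undir _ _ => True
  | .concat π₁ π₂ => Disjoint π₁.sch π₂.sch ∧ π₁.Basic ∧ π₂.Basic
  | .union π₁ π₂ => π₁.Basic ∧ π₂.Basic
  | .rep π _ _ => π.sch = ∅ ∧ π.Basic
  | .filter π θ => π.Basic ∧ θ.Basic

/-- Conditions with basic patterns only. -/
def Cond.Basic {m : ℕ} : Cond m → Prop
  | .eq _ _ => True
  | .hasLabel _ _ => True
  | .or θ₁ θ₂ => θ₁.Basic ∧ θ₂.Basic
  | .and θ₁ θ₂ => θ₁.Basic ∧ θ₂.Basic
  | .not θ => θ.Basic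
  | .exist Q => Q.Basic

/-- Basic graph patterns: there is no path binding. -/
def GPat.Basic {m : ℕ} : GPat m → Prop
  | .pat _ _ X π => X = none ∧ π.Basic
  | .join ψ₁ ψ₂ => ψ₁.Basic ∧ ψ₂.Basic

/-- Clauses with basic patterns only. -/
def Clause.Basic {m : ℕ} : Clause m → Prop
  | .matching ψ => ψ.Basic
  | .letEq _ _ => True
  | .forIn _ _ => True
  | .filter θ => θ.Basic

/-- Linear queries with basic patterns only. -/
def LinQuery.Basic {m : ℕ} : LinQuery m → Prop
  | .use _ L => L.Basic
  | .clause C L => C.Basic ∧ L.Basic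
  | .ret _ => True

/-- Basic queries. -/
def Query.Basic {m : ℕ} : Query m → Prop
  | .lin L => L.Basic
  | .use _ s => s.Basic
  | .intersect Q₁ Q₂ => Q₁.Basic ∧ Q₂.Basic
  | .union Q₁ Q₂ => Q₁.Basic ∧ Q₂.Basic
  | .except Q₁ Q₂ => Q₁.Basic ∧ Q₂.Basic

/-- Sequences of basic queries. -/
def QuerySeq.Basic {m : ℕ} : QuerySeq m → Prop
  | .single Q => Q.Basic
  | .cons Q s => Q.Basic ∧ s.Basic

end

mutual

/-- Path patterns without `not` and `except`. -/
def Pat.Positive {m : ℕ} : Pat m → Prop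
  | .node _ _ => True
  | .fwd _ _ => True
  | .bwd _ _ => True
  | .undir _ _ => True
  | .concat π₁ π₂ => π₁.Positive ∧ π₂.Positive
  | .union π₁ π₂ => π₁.Positive ∧ π₂.Positive
  | .rep π _ _ => π.Positive
  | .filter π θ => π.Positive ∧ θ.Positive

/-- Conditions without `not` and `except`. -/
def Cond.Positive {m : ℕ} : Cond m → Prop
  | .eq _ _ => True
  | .hasLabel _ _ => True
  | .or θ₁ θ₂ => θ₁.Positive ∧ θ₂.Positive
  | .and θ₁ θ₂ => θ₁.Positive ∧ θ₂.Positive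
  | .not _ => False
  | .exist Q => Q.Positive

/-- Graph patterns without `not` and `except`. -/
def GPat.Positive {m : ℕ} : GPat m → Prop
  | .pat _ _ _ π => π.Positive
  | .join ψ₁ ψ₂ => ψ₁.Positive ∧ ψ₂.Positive

/-- Clauses without `not` and `except`. -/
def Clause.Positive {m : ℕ} : Clause m → Prop
  | .matching ψ => ψ.Positive
  | .letEq _ _ => True
  | .forIn _ _ => True
  | .filter θ => θ.Positive

/-- Linear queries without `not` and `except`. -/
def LinQuery.Positive {m : ℕ} : LinQuery m → Prop
  | .use _ L => L.Positive
  | .clause C L => C.Positive ∧ L.Positive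
  | .ret _ => True

/-- Positive queries: there is no `not` and no `except`. -/
def Query.Positive {m : ℕ} : Query m → Prop
  | .lin L => L.Positive
  | .use _ s => s.Positive
  | .intersect Q₁ Q₂ => Q₁.Positive ∧ Q₂.Positive
  | .union Q₁ Q₂ => Q₁.Positive ∧ Q₂.Positive
  | .except _ _ => False

/-- Sequences of positive queries. -/
def QuerySeq.Positive {m : ℕ} : QuerySeq m → Prop
  | .single Q => Q.Positive
  | .cons Q s => Q.Positive ∧ s.Positive

end

mutual

/-- Path patterns without `shortest`. -/
def Pat.ShortestFree {m : ℕ} : Pat m → Prop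
  | .node _ _ => True
  | .fwd _ _ => True
  | .bwd _ _ => True
  | .undir _ _ => True
  | .concat π₁ π₂ => π₁.ShortestFree ∧ π₂.ShortestFree
  | .union π₁ π₂ => π₁.ShortestFree ∧ π₂.ShortestFree
  | .rep π _ _ => π.ShortestFree
  | .filter π θ => π.ShortestFree ∧ θ.ShortestFree

/-- Conditions without `shortest`. -/
def Cond.ShortestFree {m : ℕ} : Cond m → Prop
  | .eq _ _ => True
  | .hasLabel _ _ => True
  | .or θ₁ θ₂ => θ₁.ShortestFree ∧ θ₂.ShortestFree
  | .and θ₁ θ₂ => θ₁.ShortestFree ∧ θ₂.ShortestFree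
  | .not θ => θ.ShortestFree
  | .exist Q => Q.ShortestFree

/-- Graph patterns without `shortest`. -/
def GPat.ShortestFree {m : ℕ} : GPat m → Prop
  | .pat shortest _ _ π => shortest = false ∧ π.ShortestFree
  | .join ψ₁ ψ₂ => ψ₁.ShortestFree ∧ ψ₂.ShortestFree

/-- Clauses without `shortest`. -/
def Clause.ShortestFree {m : ℕ} : Clause m → Prop
  | .matching ψ => ψ.ShortestFree
  | .letEq _ _ => True
  | .forIn _ _ => True
  | .filter θ => θ.ShortestFree

/-- Linear queries without `shortest`. -/
def LinQuery.ShortestFree {m : ℕ} : LinQuery m → Prop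
  | .use _ L => L.ShortestFree
  | .clause C L => C.ShortestFree ∧ L.ShortestFree
  | .ret _ => True

/-- Queries without `shortest`. -/
def Query.ShortestFree {m : ℕ} : Query m → Prop
  | .lin L => L.ShortestFree
  | .use _ s => s.ShortestFree
  | .intersect Q₁ Q₂ => Q₁.ShortestFree ∧ Q₂.ShortestFree
  | .union Q₁ Q₂ => Q₁.ShortestFree ∧ Q₂.ShortestFree
  | .except Q₁ Q₂ => Q₁.ShortestFree ∧ Q₂.ShortestFree

/-- Sequences of queries without `shortest`. -/
def QuerySeq.ShortestFree {m : ℕ} : QuerySeq m → Prop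
  | .single Q => Q.ShortestFree
  | .cons Q s => Q.ShortestFree ∧ s.ShortestFree

end

/-! ### Encoding of graph databases as bit strings -/

/-- The code of a list: every entry is preceded by `true`, the end is marked by `false`. -/
def encodeList {α : Type} (enc : α → Word) (l : List α) : Word :=
  l.flatMap (fun a => true :: enc a) ++ [false]

/-- The code of an edge. -/
def encodeEdge : Edge → Word
  | .directed e => true :: delimit e
  | .undirected e => false :: delimit e

/-- The code of a graph element. -/
def encodeElem : Elem → Word
  | .node n => true :: delimit n
  | .edge e => false :: encodeEdge e

/-- `w` encodes `G`: it is the concatenation of codes of lists (in any order, possibly with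
repetitions) of the components of `G`. -/
def PropertyGraph.IsEncoding (G : PropertyGraph) (w : Word) : Prop :=
  ∃ (ns ds us : List Name) (ss ts : List (Edge × Name)) (ps : List (Elem × Name × Name))
    (ls : List (Elem × Name)),
    (∀ a, a ∈ ns ↔ a ∈ G.nodes) ∧ (∀ a, a ∈ ds ↔ a ∈ G.dirEdges) ∧
    (∀ a, a ∈ us ↔ a ∈ G.undirEdges) ∧ (∀ a, a ∈ ss ↔ a ∈ G.src) ∧
    (∀ a, a ∈ ts ↔ a ∈ G.tgt) ∧ (∀ a, a ∈ ps ↔ a ∈ G.property) ∧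
    (∀ a, a ∈ ls ↔ a ∈ G.label) ∧
    w = encodeList delimit ns ++ encodeList delimit ds ++ encodeList delimit us ++
      encodeList (fun a => encodeEdge a.1 ++ delimit a.2) ss ++
      encodeList (fun a => encodeEdge a.1 ++ delimit a.2) ts ++
      encodeList (fun a => encodeElem a.1 ++ delimit a.2.1 ++ delimit a.2.2) ps ++
      encodeList (fun a => encodeElem a.1 ++ delimit a.2) ls

/-- `w` encodes the graph database `𝒢`: it is the concatenation of codes of its graphs. -/
def Database.IsEncoding {m : ℕ} (𝒢 : Database m) (w : Word) : Prop :=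
  ∃ ws : Fin m → Word, (∀ i, (𝒢 i).IsEncoding (ws i)) ∧ w = (List.ofFn ws).flatten

/-- The (Boolean) evaluation problem of the fixed query `Q` with default graph number `g`: given a
graph database, is the output of `Q` nonempty? -/
def Query.evaluationProblem {m : ℕ} (Q : Query m) (g : Fin m) : Set Word :=
  {w | ∃ 𝒢 : Database m, (∀ i, (𝒢 i).Valid) ∧ 𝒢.IsEncoding w ∧ (Q.output 𝒢 g).Nonempty}

end GQL

namespace StackProgram

open Turing Function

/-- Structured programs over stacks of bits that are numbered by natural numbers. -/
inductive Cmd : Type where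
  | push (k : ℕ) (b : Bool) : Cmd
  | skip : Cmd
  | seq (c₁ c₂ : Cmd) : Cmd
  /-- Pop stack `k` and branch on the result. -/
  | ite (k : ℕ) (c : Option Bool → Cmd) : Cmd
  /-- Pop stack `k` until it is empty, and run a command after each pop. -/
  | loop (k : ℕ) (c : Bool → Cmd) : Cmd

/-- The contents of the stacks. -/
abbrev Store : Type := ℕ → List Bool

namespace Cmd

/-- Big-step semantics with a step count. -/
inductive Exec : Cmd → Store → Store → ℕ → Prop where
  | push (k b S) : Exec (push k b) S (update S k (b :: S k)) 1
  | skip (S) : Exec skip S S 1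
  | seq {c₁ c₂ S S' S'' t t'} : Exec c₁ S S' t → Exec c₂ S' S'' t' →
      Exec (seq c₁ c₂) S S'' (t + t')
  | ite {k c S S' t} : Exec (c (S k).head?) (update S k (S k).tail) S' t →
      Exec (ite k c) S S' (t + 1)
  | loop_nil {k c S} : S k = [] → Exec (loop k c) S S 1
  | loop_cons {k c S S' S'' b l t t'} : S k = b :: l → Exec (c b) (update S k l) S' t →
      Exec (loop k c) S' S'' t' → Exec (loop k c) S S'' (t + t' + 1)

/-- All stacks that occur in the command have a number below `D`. -/
def Below (D : ℕ) : Cmd → Prop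
  | push k _ => k < D
  | skip => True
  | seq c₁ c₂ => c₁.Below D ∧ c₂.Below D
  | ite k c => k < D ∧ ∀ o, (c o).Below D
  | loop k c => k < D ∧ ∀ b, (c b).Below D

theorem Below.mono {D D' : ℕ} (h : D ≤ D') : ∀ {c : Cmd}, c.Below D → c.Below D'
  | push _ _, hc => lt_of_lt_of_le hc h
  | skip, _ => trivial
  | seq _ _, hc => ⟨hc.1.mono h, hc.2.mono h⟩
  | ite _ _, hc => ⟨lt_of_lt_of_le hc.1 h, fun o => (hc.2 o).mono h⟩
  | loop _ _, hc => ⟨lt_of_lt_of_le hc.1 h, fun b => (hc.2 b).mono h⟩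

theorem exists_below (c : Cmd) : ∃ D, c.Below D := by
  induction c with
  | push k b => exact ⟨k + 1, Nat.lt_succ_self k⟩
  | skip => exact ⟨0, trivial⟩
  | seq c₁ c₂ h₁ h₂ =>
    obtain ⟨D₁, h₁⟩ := h₁
    obtain ⟨D₂, h₂⟩ := h₂
    exact ⟨max D₁ D₂, h₁.mono (le_max_left _ _), h₂.mono (le_max_right _ _)⟩
  | ite k c h =>
    choose D hD using h
    refine ⟨max (k + 1) (Finset.univ.sup D), lt_of_lt_of_le (Nat.lt_succ_self k) (le_max_left _ _),
      fun o => (hD o).mono (le_trans (Finset.le_sup (Finset.mem_univ o)) (le_max_right _ _))⟩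
  | loop k c h =>
    choose D hD using h
    refine ⟨max (k + 1) (Finset.univ.sup D), lt_of_lt_of_le (Nat.lt_succ_self k) (le_max_left _ _),
      fun o => (hD o).mono (le_trans (Finset.le_sup (Finset.mem_univ o)) (le_max_right _ _))⟩

/-- The labels of the machine that executes a command. -/
def Lab : Cmd → Type
  | push _ _ => Unit
  | skip => Unit
  | seq c₁ c₂ => c₁.Lab ⊕ c₂.Lab
  | ite _ c => Option (Σ o, (c o).Lab)
  | loop _ c => Option (Σ b, (c b).Lab)

/-- The label where the execution starts. -/
def entry : (c : Cmd) → c.Lab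
  | push _ _ => ()
  | skip => ()
  | seq c₁ _ => .inl c₁.entry
  | ite _ _ => none
  | loop _ _ => none

instance fintypeLab : (c : Cmd) → Fintype c.Lab
  | push _ _ => inferInstanceAs (Fintype Unit)
  | skip => inferInstanceAs (Fintype Unit)
  | seq c₁ c₂ =>
    letI := fintypeLab c₁
    letI := fintypeLab c₂
    inferInstanceAs (Fintype (c₁.Lab ⊕ c₂.Lab))
  | ite _ c =>
    letI := fun o => fintypeLab (c o)
    inferInstanceAs (Fintype (Option (Σ o, (c o).Lab)))
  | loop _ c =>
    letI := fun b => fintypeLab (c b)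
    inferInstanceAs (Fintype (Option (Σ b, (c b).Lab)))

/-- The number of a stack as an index of the machine. -/
def slot (D : ℕ) [NeZero D] (k : ℕ) : Fin D := Fin.ofNat D k

/-- The machine code of a command: `e` embeds its labels into those of the machine, and the
execution continues at `x`. -/
def code {D : ℕ} [NeZero D] {Λ : Type} : (c : Cmd) → (c.Lab → Λ) → Λ → c.Lab →
    TM2.Stmt (fun _ : Fin D => Bool) Λ (Option Bool)
  | push k b, _, x, _ => .push (slot D k) (fun _ => b) (.goto fun _ => x)
  | skip, _, x, _ => .goto fun _ => x
  | seq c₁ c₂, e, _, .inl l => c₁.code (fun l => e (.inl l)) (e (.inr c₂.entry)) l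
  | seq _ c₂, e, x, .inr l => c₂.code (fun l => e (.inr l)) x l
  | ite k c, e, _, none =>
    .pop (slot D k) (fun _ o => o) (.goto fun o => e (some ⟨o, (c o).entry⟩))
  | ite _ c, e, x, some ⟨o, l⟩ => (c o).code (fun l => e (some ⟨o, l⟩)) x l
  | loop k c, e, x, none =>
    .pop (slot D k) (fun _ o => o)
      (.goto fun o => o.elim x fun b => e (some ⟨b, (c b).entry⟩))
  | loop _ c, e, _, some ⟨b, l⟩ => (c b).code (fun l => e (some ⟨b, l⟩)) (e none) l

/-- The first `D` stacks. -/
def restrict (D : ℕ) (S : Store) : Fin D → List Bool := fun k => S k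

theorem slot_val {D : ℕ} [NeZero D] {k : ℕ} (hk : k < D) : (slot D k).val = k :=
  Nat.mod_eq_of_lt hk

theorem restrict_update {D : ℕ} [NeZero D] {k : ℕ} (hk : k < D) (S : Store) (l : List Bool) :
    restrict D (update S k l) = update (restrict D S) (slot D k) l := by
  funext j
  by_cases h : j = slot D k
  · subst h
    simp [restrict, slot_val hk]
  · have h' : (j : ℕ) ≠ k := fun e => h (Fin.ext (e.trans (slot_val hk).symm))
    simp [restrict, h, h']

theorem restrict_slot {D : ℕ} [NeZero D] {k : ℕ} (hk : k < D) (S : Store) :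
    restrict D S (slot D k) = S k := by
  simp [restrict, slot_val hk]

/-- `n` steps lead from the configuration `a` to the configuration `b`. -/
def Steps {α : Type} (f : α → Option α) (n : ℕ) (a b : α) : Prop :=
  (flip bind f)^[n] (some a) = some b

theorem Steps.one {α : Type} {f : α → Option α} {a b : α} (h : f a = some b) : Steps f 1 a b := h

theorem Steps.trans {α : Type} {f : α → Option α} {m n : ℕ} {a b c : α} (h₁ : Steps f m a b)
    (h₂ : Steps f n b c) : Steps f (m + n) a c := by
  unfold Steps at *
  rw [add_comm, iterate_add_apply, h₁, h₂]

theorem Exec.steps {D : ℕ} [NeZero D] {Λ : Type}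
    (M : Λ → TM2.Stmt (fun _ : Fin D => Bool) Λ (Option Bool)) {c : Cmd} {S S' : Store} {t : ℕ}
    (h : Exec c S S' t) : c.Below D → ∀ (e : c.Lab → Λ) (x : Λ), (∀ l, M (e l) = c.code e x l) →
      ∀ v, ∃ v', ∃ n ≤ t, Steps (TM2.step M) n ⟨some (e c.entry), v, restrict D S⟩
        ⟨some x, v', restrict D S'⟩ := by
  induction h with
  | push k b S =>
    intro hD e x he v
    refine ⟨v, 1, le_rfl, Steps.one ?_⟩
    simp [TM2.step, he, code, restrict_update hD, restrict_slot hD]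
  | skip S =>
    intro hD e x he v
    refine ⟨v, 1, le_rfl, Steps.one ?_⟩
    simp [TM2.step, he, code]
  | @seq c₁ c₂ S S' S'' t t' _ _ ih₁ ih₂ =>
    intro hD e x he v
    obtain ⟨v₁, n₁, hn₁, h₁⟩ := ih₁ hD.1 (fun l => e (.inl l)) (e (.inr c₂.entry))
      (fun l => he (.inl l)) v
    obtain ⟨v₂, n₂, hn₂, h₂⟩ := ih₂ hD.2 (fun l => e (.inr l)) x (fun l => he (.inr l)) v₁
    exact ⟨v₂, n₁ + n₂, by omega, h₁.trans h₂⟩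
  | @ite k c S S' t _ ih =>
    intro hD e x he v
    obtain ⟨v₁, n₁, hn₁, h₁⟩ := ih (hD.2 _) (fun l => e (some ⟨_, l⟩)) x
      (fun l => he (some ⟨_, l⟩)) (S k).head?
    refine ⟨v₁, 1 + n₁, by omega, Steps.trans (Steps.one ?_) h₁⟩
    have := he none
    simp only [code] at this
    simp [TM2.step, this, entry, restrict_update hD.1, restrict_slot hD.1]
  | @loop_nil k c S h =>
    intro hD e x he v
    refine ⟨none, 1, le_rfl, Steps.one ?_⟩
    have hu := restrict_update hD.1 S []
    rw [← h, update_eq_self, h] at hu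
    have := he none
    simp only [code] at this
    simp [TM2.step, this, entry, restrict_slot hD.1, h, ← hu]
  | @loop_cons k c S S' S'' b l t t' h _ _ ih₁ ih₂ =>
    intro hD e x he v
    obtain ⟨v₁, n₁, hn₁, h₁⟩ := ih₁ (hD.2 _) (fun l => e (some ⟨_, l⟩)) (e none)
      (fun l => he (some ⟨_, l⟩)) (some b)
    obtain ⟨v₂, n₂, hn₂, h₂⟩ := ih₂ hD e x he v₁
    refine ⟨v₂, 1 + n₁ + n₂, by omega, Steps.trans (Steps.trans (Steps.one ?_) h₁) h₂⟩
    have := he none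
    simp only [code] at this
    simp [TM2.step, this, entry, restrict_update hD.1, restrict_slot hD.1, h]

end Cmd

/-- The store with `w` on stack `k` and nothing else. -/
def Store.single (k : ℕ) (w : List Bool) : Store := fun j => if j = k then w else []

/-- A command that decides a language within a polynomial number of steps gives a machine. -/
theorem mem_P_of_exec {L : Set Complexity.Word} (c : Cmd) (q : Polynomial ℕ)
    (f : Complexity.Word → Bool) (hf : ∀ w, w ∈ L ↔ f w = true)
    (h : ∀ w, ∃ t ≤ q.eval w.length, c.Exec (Store.single 0 w) (Store.single 1 [f w]) t) :
    L ∈ Complexity.P := by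
  obtain ⟨D₀, hD₀⟩ := c.exists_below
  have hD : c.Below (D₀ + 2) := hD₀.mono (by omega)
  refine ⟨f, ⟨?_⟩, hf⟩
  let tm : FinTM2 :=
    { K := Fin (D₀ + 2)
      k₀ := 0
      k₁ := 1
      Γ := fun _ => Bool
      Λ := Option c.Lab
      main := some c.entry
      σ := Option Bool
      initialState := none
      m := fun l => l.elim (.load (fun _ => none) .halt) (fun l => c.code some none l) }
  have main : ∀ w, Nonempty (TM2OutputsInTime tm w (some [f w])
      ((q + 1).eval w.length)) := by
    intro w
    obtain ⟨t, ht, hE⟩ := h w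
    obtain ⟨v', n, hn, hs⟩ := hE.steps tm.m hD some none (fun l => rfl) none
    have hs' := hs.trans (Cmd.Steps.one (b := haltList tm [f w]) (by
      simp only [TM2.step, tm, Option.elim, TM2.stepAux, haltList]
      congr 2
      funext k
      by_cases hk : k = 1
      · subst hk; simp [Cmd.restrict, Store.single]
      · have : (k : ℕ) ≠ 1 := fun e => hk (Fin.ext e)
        simp [Cmd.restrict, Store.single, hk, this]))
    have hi : initList tm w = ⟨some (some c.entry), none, Cmd.restrict (D₀ + 2)
        (Store.single 0 w)⟩ := by
      simp only [initList, tm]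
      congr 1
      funext k
      by_cases hk : k = 0
      · subst hk; simp [Cmd.restrict, Store.single]
      · have : (k : ℕ) ≠ 0 := fun e => hk (Fin.ext e)
        simp [Cmd.restrict, Store.single, hk, this]
    refine ⟨⟨⟨n + 1, ?_⟩, ?_⟩⟩
    · rw [hi]
      exact hs'
    · simp only [Polynomial.eval_add, Polynomial.eval_one]
      omega
  exact
    { tm := tm
      inputAlphabet := Equiv.refl _
      outputAlphabet := Equiv.refl _
      time := q + 1
      outputsFun := fun w => by
        have := (main w).some
        rw [show (Equiv.refl Bool).invFun = id from rfl, List.map_id, List.map_id]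
        exact this }

end StackProgram

/-! ### Definability -/

namespace Definability

/-- A binary relation on natural numbers. -/
abbrev Rel : Type := ℕ → ℕ → Bool

/-- A type of contexts: every context has a bound `N`, and it is inspected through numerical
readers with values up to `N` and through binary relations. -/
class Ctx (α : Type) where
  N : α → ℕ
  num : Set (α → ℕ)
  rel : Set (α → Rel)
  num_le : ∀ f ∈ num, ∀ a, f a ≤ N a

export Ctx (N)

/-- A context with one further number up to the bound. -/
structure Ext (α : Type) [Ctx α] where
  a : α
  i : ℕ
  le : i ≤ N a

section
variable {α : Type} [Ctx α]

instance : Ctx (Ext α) where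
  N p := N p.a
  num := insert Ext.i {g | ∃ f ∈ Ctx.num, g = fun p => f p.a}
  rel := {g | ∃ R ∈ Ctx.rel, g = fun p => R p.a}
  num_le := by
    rintro f (rfl | ⟨f, hf, rfl⟩) p
    · exact p.le
    · exact Ctx.num_le f hf p.a

instance : Ctx (α × Rel) where
  N p := N p.1
  num := {g | ∃ f ∈ Ctx.num, g = fun p => f p.1}
  rel := insert Prod.snd {g | ∃ R ∈ Ctx.rel, g = fun p => R p.1}
  num_le := by
    rintro f ⟨f, hf, rfl⟩ p
    exact Ctx.num_le f hf p.1

end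

/-- First-order definable predicates: sums and products of readers, the relations, Boolean
connectives, and quantification over the numbers up to the bound. -/
inductive FO : {α : Type} → [Ctx α] → (α → Prop) → Prop where
  | add {α : Type} [Ctx α] {f g h : α → ℕ} (hf : f ∈ Ctx.num) (hg : g ∈ Ctx.num)
      (hh : h ∈ Ctx.num) : FO fun a => f a + g a = h a
  | mul {α : Type} [Ctx α] {f g h : α → ℕ} (hf : f ∈ Ctx.num) (hg : g ∈ Ctx.num)
      (hh : h ∈ Ctx.num) : FO fun a => f a * g a = h a
  | rel {α : Type} [Ctx α] {R : α → Rel} {f g : α → ℕ} (hR : R ∈ Ctx.rel) (hf : f ∈ Ctx.num)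
      (hg : g ∈ Ctx.num) : FO fun a => R a (f a) (g a) = true
  | not {α : Type} [Ctx α] {φ : α → Prop} (h : FO φ) : FO fun a => ¬ φ a
  | and {α : Type} [Ctx α] {φ ψ : α → Prop} (h : FO φ) (h' : FO ψ) : FO fun a => φ a ∧ ψ a
  | ex {α : Type} [Ctx α] {φ : Ext α → Prop} (h : FO φ) : FO fun a => ∃ i, ∃ h : i ≤ N a, φ ⟨a, i, h⟩

/-- Second-order definable predicates: quantification over binary relations in front of first-order
definable predicates, only existential quantification if `full` is false. -/
inductive SO (full : Bool) : {α : Type} → [Ctx α] → (α → Prop) → Prop where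
  | fo {α : Type} [Ctx α] {φ : α → Prop} (h : FO φ) : SO full φ
  | ex {α : Type} [Ctx α] {φ : α × Rel → Prop} (h : SO full φ) : SO full fun a => ∃ Y, φ (a, Y)
  | all {α : Type} [Ctx α] {φ : α × Rel → Prop} (hfull : full = true) (h : SO full φ) :
      SO full fun a => ∀ Y, φ (a, Y)

/-- Maps between contexts under which every reader and every relation stays one. -/
structure Ren {α β : Type} [Ctx α] [Ctx β] (t : β → α) : Prop where
  N_eq : ∀ b, N (t b) = N b
  num : ∀ f ∈ Ctx.num (α := α), (fun b => f (t b)) ∈ Ctx.num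
  rel : ∀ R ∈ Ctx.rel (α := α), (fun b => R (t b)) ∈ Ctx.rel

section
variable {α β γ : Type} [Ctx α] [Ctx β] [Ctx γ]

/-- The extension of a map between contexts to a further number. -/
def Ren.ext {t : β → α} (ht : Ren t) (p : Ext β) : Ext α := ⟨t p.a, p.i, (ht.N_eq p.a).symm ▸ p.le⟩

theorem Ren.id : Ren (id : α → α) := ⟨fun _ => rfl, fun _ h => h, fun _ h => h⟩

theorem Ren.comp {t : β → α} {s : γ → β} (ht : Ren t) (hs : Ren s) : Ren (fun c => t (s c)) :=
  ⟨fun c => (ht.N_eq _).trans (hs.N_eq c), fun f h => hs.num _ (ht.num f h),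
    fun R h => hs.rel _ (ht.rel R h)⟩

theorem Ren.a : Ren (Ext.a : Ext α → α) :=
  ⟨fun _ => rfl, fun f h => Or.inr ⟨f, h, rfl⟩, fun R h => ⟨R, h, rfl⟩⟩

theorem Ren.fst : Ren (Prod.fst : α × Rel → α) :=
  ⟨fun _ => rfl, fun f h => ⟨f, h, rfl⟩, fun R h => Or.inr ⟨R, h, rfl⟩⟩

theorem Ren.ren_ext {t : β → α} (ht : Ren t) : Ren ht.ext :=
  ⟨fun b => ht.N_eq b.a, by
    rintro f (rfl | ⟨f, hf, rfl⟩)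
    · exact Or.inl rfl
    · exact Or.inr ⟨_, ht.num f hf, rfl⟩, by
    rintro R ⟨R, hR, rfl⟩
    exact ⟨_, ht.rel R hR, rfl⟩⟩

/-- The extension of a map between contexts to a further relation. -/
def Ren.prod (t : β → α) (p : β × Rel) : α × Rel := (t p.1, p.2)

theorem Ren.ren_prod {t : β → α} (ht : Ren t) : Ren (Ren.prod t) :=
  ⟨fun b => ht.N_eq b.1, by
    rintro f ⟨f, hf, rfl⟩
    exact ⟨_, ht.num f hf, rfl⟩, by
    rintro R (rfl | ⟨R, hR, rfl⟩)
    · exact Or.inl rfl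
    · exact Or.inr ⟨_, ht.rel R hR, rfl⟩⟩

end

theorem FO.congr {α : Type} [Ctx α] {φ ψ : α → Prop} (h : FO φ) (e : ∀ a, ψ a ↔ φ a) : FO ψ := by
  rwa [show ψ = φ from funext fun a => propext (e a)]

theorem SO.congr {full : Bool} {α : Type} [Ctx α] {φ ψ : α → Prop} (h : SO full φ)
    (e : ∀ a, ψ a ↔ φ a) : SO full ψ := by
  rwa [show ψ = φ from funext fun a => propext (e a)]

theorem FO.ren {α : Type} [Ctx α] {φ : α → Prop} (h : FO φ) :
    ∀ {β : Type} [Ctx β] {t : β → α}, Ren t → FO fun b => φ (t b) := by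
  induction h with
  | add hf hg hh => intro β _ t ht; exact FO.add (ht.num _ hf) (ht.num _ hg) (ht.num _ hh)
  | mul hf hg hh => intro β _ t ht; exact FO.mul (ht.num _ hf) (ht.num _ hg) (ht.num _ hh)
  | rel hR hf hg => intro β _ t ht; exact FO.rel (ht.rel _ hR) (ht.num _ hf) (ht.num _ hg)
  | not _ ih => intro β _ t ht; exact (ih ht).not
  | and _ _ ih ih' => intro β _ t ht; exact (ih ht).and (ih' ht)
  | ex _ ih =>
    intro β _ t ht
    refine (ih ht.ren_ext).ex.congr fun b => ?_
    simp only [ht.N_eq]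
    rfl

theorem SO.ren {full : Bool} {α : Type} [Ctx α] {φ : α → Prop} (h : SO full φ) :
    ∀ {β : Type} [Ctx β] {t : β → α}, Ren t → SO full fun b => φ (t b) := by
  induction h with
  | fo h => intro β _ t ht; exact .fo (h.ren ht)
  | ex _ ih => intro β _ t ht; exact (ih ht.ren_prod).ex
  | all hf _ ih => intro β _ t ht; exact (ih ht.ren_prod).all hf

/-! #### First-order definable predicates -/

section
variable {α β : Type} [Ctx α] [Ctx β]

theorem FO.or {φ ψ : α → Prop} (h : FO φ) (h' : FO ψ) : FO fun a => φ a ∨ ψ a :=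
  (h.not.and h'.not).not.congr fun a => by tauto

theorem FO.imp {φ ψ : α → Prop} (h : FO φ) (h' : FO ψ) : FO fun a => φ a → ψ a :=
  (h.and h'.not).not.congr fun a => by tauto

theorem FO.iff {φ ψ : α → Prop} (h : FO φ) (h' : FO ψ) : FO fun a => φ a ↔ ψ a :=
  ((h.imp h').and (h'.imp h)).congr fun a => by tauto

theorem FO.exists_le {φ : α → ℕ → Prop} (h : FO fun p : Ext α => φ p.a p.i) :
    FO fun a => ∃ i ≤ N a, φ a i :=
  h.ex.congr fun a => by simp

theorem FO.forall_le {φ : α → ℕ → Prop} (h : FO fun p : Ext α => φ p.a p.i) :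
    FO fun a => ∀ i ≤ N a, φ a i :=
  h.not.ex.not.congr fun a => by simp

theorem num_i : (Ext.i : Ext α → ℕ) ∈ Ctx.num := Or.inl rfl

theorem num_a {f : α → ℕ} (h : f ∈ Ctx.num) : (fun p : Ext α => f p.a) ∈ Ctx.num :=
  Or.inr ⟨f, h, rfl⟩

theorem FO.bot : FO fun _ : α => False := by
  have h : FO fun p : Ext α => p.i + p.i = p.i := .add num_i num_i num_i
  exact (h.and h.not).ex.congr fun a => by simp

theorem FO.top : FO fun _ : α => True := FO.bot.not.congr fun _ => by simp

theorem FO.const (p : Prop) : FO fun _ : α => p := by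
  by_cases h : p
  · exact FO.top.congr fun _ => by simp [h]
  · exact FO.bot.congr fun _ => by simp [h]

/-- Numerical functions with first-order definable graph. -/
def Term (f : α → ℕ) : Prop := FO fun p : Ext α => f p.a = p.i

theorem FO.num_eq {f g : α → ℕ} (hf : f ∈ Ctx.num) (hg : g ∈ Ctx.num) : FO fun a => f a = g a :=
  ((FO.add num_i num_i num_i).and (FO.add (num_a hf) num_i (num_a hg))).ex.congr fun a => by
    constructor
    · intro h
      exact ⟨0, Nat.zero_le _, rfl, h⟩
    · rintro ⟨i, _, h, h'⟩
      simp only at h h'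
      omega

theorem Term.num {f : α → ℕ} (hf : f ∈ Ctx.num) : Term f := FO.num_eq (num_a hf) num_i

theorem Term.ren {f : α → ℕ} (hf : Term f) {t : β → α} (ht : Ren t) : Term fun b => f (t b) :=
  FO.ren hf ht.ren_ext

theorem Term.w {f : α → ℕ} (hf : Term f) : Term fun p : Ext α => f p.a := hf.ren Ren.a

/-- Substitution of a definable number. -/
theorem FO.subst {f : α → ℕ} (hf : Term f) {φ : α → ℕ → Prop} (h : FO fun p : Ext α => φ p.a p.i) :
    FO fun a => f a ≤ N a ∧ φ a (f a) :=
  (FO.exists_le (φ := fun a i => f a = i ∧ φ a i) (FO.and hf h)).congr fun a => by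
    constructor
    · rintro ⟨h, h'⟩
      exact ⟨_, h, rfl, h'⟩
    · rintro ⟨i, h, rfl, h'⟩
      exact ⟨h, h'⟩

end

section
variable {α : Type} [Ctx α]

theorem Term.congr {f g : α → ℕ} (h : Term f) (e : ∀ a, g a = f a) : Term g := by
  rwa [show g = f from funext e]

theorem Term.of {f : α → ℕ} {ψ : α → ℕ → Prop} (h : FO fun p : Ext α => ψ p.a p.i)
    (e : ∀ a, ∀ i ≤ N a, ψ a i ↔ f a = i) : Term f :=
  FO.congr h fun p => (e p.a p.i p.le).symm

theorem Term.bound : Term (fun a : α => N a) := by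
  refine Term.of (ψ := fun a n => ¬ ∃ i ≤ N a, ∃ j ≤ N a, n + j = i ∧ ¬ i = n)
    (FO.exists_le (FO.exists_le ((FO.add (num_a (num_a num_i)) num_i (num_a num_i)).and
      (FO.num_eq (num_a num_i) (num_a (num_a num_i))).not))).not fun a n hn => ?_
  constructor
  · intro h
    by_contra hne
    exact h ⟨N a, le_rfl, N a - n, Nat.sub_le _ _, by omega, fun h => hne h⟩
  · rintro h ⟨i, hi, j, -, h1, h2⟩
    omega

theorem Term.eq_num {f g : α → ℕ} (hf : Term f) (hg : g ∈ Ctx.num) : FO fun a => f a = g a :=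
  (FO.subst hf (φ := fun a i => i = g a) (FO.num_eq num_i (num_a hg))).congr fun a =>
    ⟨fun h => ⟨h.symm ▸ Ctx.num_le g hg a, h⟩, And.right⟩

theorem Term.add {f g : α → ℕ} (hf : Term f) (hg : Term g) : Term fun a => f a + g a := by
  refine Term.of (ψ := fun a n => ∃ i ≤ N a, ∃ j ≤ N a, f a = i ∧ g a = j ∧ i + j = n)
    (FO.exists_le (FO.exists_le ((hf.w.w.w.eq_num (num_a num_i)).and
      ((hg.w.w.w.eq_num num_i).and (FO.add (num_a num_i) num_i (num_a (num_a num_i)))))))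
    fun a n hn => ?_
  constructor
  · rintro ⟨i, _, j, _, rfl, rfl, h⟩
    exact h
  · intro h
    exact ⟨_, by omega, _, by omega, rfl, rfl, h⟩

/-- Numerical functions with first-order definable graph and values up to the bound. -/
structure Num (f : α → ℕ) : Prop where
  term : Term f
  le : ∀ a, f a ≤ N a

theorem Num.reader {f : α → ℕ} (hf : f ∈ Ctx.num) : Num f := ⟨.num hf, Ctx.num_le f hf⟩

theorem Num.v0 : Num (Ext.i : Ext α → ℕ) := .reader num_i

theorem Num.ren {β : Type} [Ctx β] {f : α → ℕ} (hf : Num f) {t : β → α} (ht : Ren t) :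
    Num fun b => f (t b) :=
  ⟨hf.term.ren ht, fun b => (hf.le _).trans_eq (ht.N_eq b)⟩

theorem Num.w {f : α → ℕ} (hf : Num f) : Num fun p : Ext α => f p.a := hf.ren Ren.a

theorem Num.r {f : α → ℕ} (hf : Num f) : Num fun p : α × Rel => f p.1 := hf.ren Ren.fst

theorem FO.eq {f g : α → ℕ} (hf : Term f) (hg : Num g) : FO fun a => f a = g a :=
  (FO.subst hg.term (φ := fun a i => f a = i) (hf.w.eq_num num_i)).congr fun a => by
    simp [hg.le a]

theorem FO.le {f g : α → ℕ} (hf : Num f) (hg : Term g) : FO fun a => f a ≤ g a := by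
  have h : FO fun a : α => g a ≤ N a → ∃ i ≤ N a, f a + i = g a := by
    have := FO.subst hg (φ := fun a j => ¬ ∃ i ≤ N a, f a + i = j)
      (FO.exists_le (FO.eq (f := fun p : Ext (Ext α) => f p.a.a + p.i)
        (hf.w.w.term.add Num.v0.term) Num.v0.w)).not
    exact this.not.congr fun a => by rw [not_and, not_not]
  refine h.congr fun a => ?_
  have := hf.le a
  constructor
  · intro h h'
    exact ⟨g a - f a, by omega, by omega⟩
  · intro h
    by_contra hlt
    obtain ⟨i, -, hi⟩ := h (by omega)
    omega

theorem FO.lt {f g : α → ℕ} (hf : Term f) (hg : Num g) : FO fun a => f a < g a :=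
  (FO.le hg hf).not.congr fun a => by simp

theorem Term.zero : Term fun _ : α => 0 :=
  Term.of (ψ := fun _ n => n + n = n) (FO.add num_i num_i num_i) fun a n hn => by
    constructor <;> intro h <;> omega

theorem Num.zero : Num fun _ : α => 0 := ⟨.zero, fun _ => Nat.zero_le _⟩

theorem Term.one : Term fun _ : α => 1 := by
  refine Term.of (ψ := fun a n => 0 < n ∧ ∀ i ≤ N a, i < n → i = 0)
    ((FO.lt Term.zero .v0).and (FO.forall_le ((FO.lt Num.v0.term Num.v0.w).imp
      (FO.eq Num.v0.term Num.zero)))) fun a n hn => ?_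
  constructor
  · rintro ⟨h, h'⟩
    by_contra hne
    have := h' 1 (by omega) (by omega)
    omega
  · intro h
    exact ⟨by omega, by omega⟩

theorem Term.const (k : ℕ) : Term fun _ : α => k := by
  induction k with
  | zero => exact Term.zero
  | succ k ih => exact ih.add .one

theorem Term.mul {f g : α → ℕ} (hf : Term f) (hg : Term g) : Term fun a => f a * g a := by
  refine Term.of (ψ := fun a n => ((f a = 0 ∨ g a = 0) ∧ n = 0) ∨
      ∃ i ≤ N a, ∃ j ≤ N a, f a = i ∧ g a = j ∧ i * j = n)
    ((((FO.eq hf.w Num.zero).or (FO.eq hg.w Num.zero)).and (FO.eq Num.v0.term Num.zero)).or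
    (FO.exists_le (FO.exists_le ((hf.w.w.w.eq_num (num_a num_i)).and
      ((hg.w.w.w.eq_num num_i).and (FO.mul (num_a num_i) num_i (num_a (num_a num_i))))))))
    fun a n hn => ?_
  constructor
  · rintro (⟨h, h'⟩ | ⟨i, _, j, _, rfl, rfl, h⟩)
    · rw [h']
      simpa using h
    · exact h
  · intro h
    by_cases hz : f a = 0 ∨ g a = 0
    · refine Or.inl ⟨hz, ?_⟩
      rw [← h]
      simpa using hz
    · push Not at hz
      have h1 := Nat.le_mul_of_pos_right (f a) (Nat.pos_of_ne_zero hz.2)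
      have h2 := Nat.le_mul_of_pos_left (g a) (Nat.pos_of_ne_zero hz.1)
      exact Or.inr ⟨_, by omega, _, by omega, rfl, rfl, h⟩

theorem Term.pow {f : α → ℕ} (hf : Term f) (k : ℕ) : Term fun a => f a ^ k := by
  induction k with
  | zero => exact (Term.const 1).congr fun a => by simp
  | succ k ih => exact (ih.mul hf).congr fun a => by rw [pow_succ]

/-- Definable binary relations. -/
def RelIn (R : α → Rel) : Prop := FO fun p : Ext (Ext α) => R p.a.a p.a.i p.i = true

theorem RelIn.reader {R : α → Rel} (h : R ∈ Ctx.rel) : RelIn R :=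
  FO.rel (R := fun p : Ext (Ext α) => R p.a.a) ⟨_, ⟨R, h, rfl⟩, rfl⟩ (num_a num_i) num_i

theorem RelIn.snd : RelIn (Prod.snd : α × Rel → Rel) := .reader (Or.inl rfl)

theorem RelIn.ren {β : Type} [Ctx β] {R : α → Rel} (h : RelIn R) {t : β → α} (ht : Ren t) :
    RelIn fun b => R (t b) :=
  FO.ren h ht.ren_ext.ren_ext

theorem RelIn.w {R : α → Rel} (h : RelIn R) : RelIn fun p : Ext α => R p.a := h.ren Ren.a

theorem RelIn.r {R : α → Rel} (h : RelIn R) : RelIn fun p : α × Rel => R p.1 := h.ren Ren.fst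

theorem FO.subst₂ {φ : α → ℕ → ℕ → Prop} (h : FO fun p : Ext (Ext α) => φ p.a.a p.a.i p.i)
    {f g : α → ℕ} (hf : Term f) (hg : Term g) :
    FO fun a => f a ≤ N a ∧ g a ≤ N a ∧ φ a (f a) (g a) :=
  FO.subst hf (φ := fun a i => g a ≤ N a ∧ φ a i (g a))
    (FO.subst hg.w (φ := fun p j => φ p.a p.i j) h)

theorem FO.app {R : α → Rel} (h : RelIn R) {f g : α → ℕ} (hf : Num f) (hg : Num g) :
    FO fun a => R a (f a) (g a) = true :=
  (FO.subst₂ (φ := fun a i j => R a i j = true) h hf.term hg.term).congr fun a => by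
    simp [hf.le a, hg.le a]

/-- Definable bit strings of length up to the bound. -/
structure WordIn (u : α → List Bool) : Prop where
  bit : FO fun p : Ext α => (u p.a).getD p.i false = true
  len : Num fun a => (u a).length

theorem WordIn.ren {β : Type} [Ctx β] {u : α → List Bool} (h : WordIn u) {t : β → α} (ht : Ren t) :
    WordIn fun b => u (t b) :=
  ⟨FO.ren h.bit ht.ren_ext, h.len.ren ht⟩

theorem WordIn.w {u : α → List Bool} (h : WordIn u) : WordIn fun p : Ext α => u p.a := h.ren Ren.a

theorem WordIn.r {u : α → List Bool} (h : WordIn u) : WordIn fun p : α × Rel => u p.1 :=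
  h.ren Ren.fst

theorem FO.bit {u : α → List Bool} (h : WordIn u) {f : α → ℕ} (hf : Term f) :
    FO fun a => (u a).getD (f a) false = true :=
  (FO.subst hf (φ := fun a i => (u a).getD i false = true) h.bit).congr fun a => by
    have := h.len.le a
    constructor
    · intro h'
      refine ⟨?_, h'⟩
      by_contra hlt
      rw [List.getD_eq_default _ _ (by omega)] at h'
      exact absurd h' (by simp)
    · exact And.right

end

/-! #### Second-order definable predicates -/

section
variable {α β : Type} [Ctx α] [Ctx β] {full : Bool}

theorem SO.and {φ ψ : α → Prop} (h : SO full φ) (h' : SO full ψ) : SO full fun a => φ a ∧ ψ a := by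
  induction h with
  | @fo α _ φ h =>
    induction h' with
    | fo h' => exact .fo (h.and h')
    | @ex α _ ψ _ ih =>
      exact (ih (h.ren Ren.fst)).ex.congr fun a => by simp
    | all hf _ ih =>
      exact ((ih (h.ren Ren.fst)).all hf).congr fun a => by simp [forall_and]
  | ex _ ih => exact (ih (h'.ren Ren.fst)).ex.congr fun a => by simp
  | all hf _ ih => exact ((ih (h'.ren Ren.fst)).all hf).congr fun a => by simp [forall_and]

theorem SO.or {φ ψ : α → Prop} (h : SO full φ) (h' : SO full ψ) : SO full fun a => φ a ∨ ψ a := by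
  induction h with
  | @fo α _ φ h =>
    induction h' with
    | fo h' => exact .fo (h.or h')
    | ex _ ih =>
      exact (ih (h.ren Ren.fst)).ex.congr fun a => by simp [exists_or]
    | all hf _ ih =>
      exact ((ih (h.ren Ren.fst)).all hf).congr fun a => by simp [forall_or_left]
  | ex _ ih => exact (ih (h'.ren Ren.fst)).ex.congr fun a => by simp [exists_or]
  | all hf _ ih => exact ((ih (h'.ren Ren.fst)).all hf).congr fun a => by simp [forall_or_right]

theorem SO.not (hf : full = true) {φ : α → Prop} (h : SO full φ) : SO full fun a => ¬ φ a := by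
  induction h with
  | fo h => exact .fo h.not
  | ex _ ih => exact (ih.all hf).congr fun a => by simp
  | all _ _ ih => exact ih.ex.congr fun a => by simp

theorem SO.const (p : Prop) : SO full fun _ : α => p := .fo (.const p)

/-- Definable functions with values up to the bound. -/
structure FnIn (F : α → ℕ → ℕ) : Prop where
  graph : FO fun p : Ext (Ext α) => F p.a.a p.a.i = p.i
  le : ∀ a i, F a i ≤ N a

theorem FnIn.ren {F : α → ℕ → ℕ} (h : FnIn F) {t : β → α} (ht : Ren t) : FnIn fun b => F (t b) :=
  ⟨FO.ren h.graph ht.ren_ext.ren_ext, fun b i => (h.le _ i).trans_eq (ht.N_eq b)⟩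

theorem FnIn.w {F : α → ℕ → ℕ} (h : FnIn F) : FnIn fun p : Ext α => F p.a := h.ren Ren.a

theorem FnIn.r {F : α → ℕ → ℕ} (h : FnIn F) : FnIn fun p : α × Rel => F p.1 := h.ren Ren.fst

theorem Num.app {F : α → ℕ → ℕ} (h : FnIn F) {f : α → ℕ} (hf : Num f) : Num fun a => F a (f a) := by
  refine ⟨?_, fun a => h.le a _⟩
  exact (FO.subst₂ (φ := fun p i j => F p.a i = j) (h.graph.ren Ren.a.ren_ext.ren_ext)
    hf.w.term Num.v0.term).congr fun p => by
      have h1 : f p.a ≤ N p := hf.le p.a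
      have h2 : p.i ≤ N p := p.le
      simp [h1, h2]

open Classical in
/-- The function with values up to `n` that a relation represents. -/
noncomputable def fnOf (Y : Rel) (n i : ℕ) : ℕ :=
  if h : ∃ c, c ≤ n ∧ Y i c = true then Nat.find h else 0

theorem fnOf_le (Y : Rel) (n i : ℕ) : fnOf Y n i ≤ n := by
  unfold fnOf
  split_ifs with h
  · exact (Nat.find_spec h).1
  · exact Nat.zero_le _

theorem fnOf_eq_iff (Y : Rel) {n i c : ℕ} (hc : c ≤ n) : fnOf Y n i = c ↔
    (Y i c = true ∧ ∀ d ≤ n, d < c → ¬ Y i d = true) ∨ (c = 0 ∧ ∀ d ≤ n, ¬ Y i d = true) := by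
  unfold fnOf
  split_ifs with h
  · rw [Nat.find_eq_iff]
    constructor
    · rintro ⟨h1, h2⟩
      exact Or.inl ⟨h1.2, fun d hd hdc hY => h2 d hdc ⟨hd, hY⟩⟩
    · rintro (⟨h1, h2⟩ | ⟨-, h2⟩)
      · exact ⟨⟨hc, h1⟩, fun d hdc hY => h2 d hY.1 hdc hY.2⟩
      · obtain ⟨d, hd, hY⟩ := h
        exact absurd hY (h2 d hd)
  · push Not at h
    constructor
    · rintro rfl
      exact Or.inr ⟨rfl, h⟩
    · rintro (⟨h1, -⟩ | ⟨h1, -⟩)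
      · exact absurd h1 (h c hc)
      · exact h1.symm

theorem fnOf_graph (F : ℕ → ℕ) {n : ℕ} (hF : ∀ i, F i ≤ n) :
    fnOf (fun i c => decide (F i = c)) n = F := by
  funext i
  rw [fnOf_eq_iff _ (hF i)]
  left
  refine ⟨by simp, fun d _ hd => ?_⟩
  simp only [decide_eq_true_eq]
  omega

theorem FnIn.of_rel : FnIn fun p : α × Rel => fnOf p.2 (N p.1) := by
  refine ⟨?_, fun p i => fnOf_le _ _ _⟩
  have h1 : RelIn fun p : Ext (Ext (α × Rel)) => p.a.a.2 := RelIn.snd.w.w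
  have h : FO fun p : Ext (Ext (α × Rel)) =>
      (p.a.a.2 p.a.i p.i = true ∧ ∀ d ≤ N p, d < p.i → ¬ p.a.a.2 p.a.i d = true) ∨
        (p.i = 0 ∧ ∀ d ≤ N p, ¬ p.a.a.2 p.a.i d = true) :=
    ((FO.app h1 Num.v0.w Num.v0).and (FO.forall_le ((FO.lt Num.v0.term Num.v0.w).imp
      (FO.app h1.w Num.v0.w.w Num.v0).not))).or
    ((FO.eq Num.v0.term Num.zero).and (FO.forall_le (FO.app h1.w Num.v0.w.w Num.v0).not))
  exact h.congr fun p => fnOf_eq_iff _ p.le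

theorem SO.exists_fn {φ : α → (ℕ → ℕ) → Prop}
    (h : SO full fun p : α × Rel => φ p.1 (fnOf p.2 (N p.1))) :
    SO full fun a => ∃ F : ℕ → ℕ, (∀ i, F i ≤ N a) ∧ φ a F := by
  refine h.ex.congr fun a => ?_
  constructor
  · rintro ⟨F, hF, h⟩
    exact ⟨fun i c => decide (F i = c), by simpa [fnOf_graph F hF] using h⟩
  · rintro ⟨Y, h⟩
    exact ⟨_, fnOf_le Y _, h⟩

end

/-! #### Locality and interpretations -/

/-- The two contexts look the same through the readers and relations. -/
structure Agree {α : Type} [Ctx α] (a b : α) : Prop where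
  N_eq : N a = N b
  num : ∀ f ∈ Ctx.num (α := α), f a = f b
  rel : ∀ R ∈ Ctx.rel (α := α), ∀ i ≤ N a, ∀ j ≤ N a, R a i j = R b i j

theorem Agree.ext {α : Type} [Ctx α] {a b : α} (h : Agree a b) {i : ℕ} (hi : i ≤ N a)
    (hi' : i ≤ N b) : Agree (⟨a, i, hi⟩ : Ext α) ⟨b, i, hi'⟩ :=
  ⟨h.N_eq, by
    rintro f (rfl | ⟨f, hf, rfl⟩)
    · rfl
    · exact h.num f hf, by
    rintro R ⟨R, hR, rfl⟩
    exact h.rel R hR⟩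

theorem FO.local {α : Type} [Ctx α] {φ : α → Prop} (h : FO φ) : ∀ {a b : α}, Agree a b →
    (φ a ↔ φ b) := by
  induction h with
  | add hf hg hh => intro a b e; simp only [e.num _ hf, e.num _ hg, e.num _ hh]
  | mul hf hg hh => intro a b e; simp only [e.num _ hf, e.num _ hg, e.num _ hh]
  | rel hR hf hg =>
    intro a b e
    beta_reduce
    rw [e.rel _ hR _ (Ctx.num_le _ hf a) _ (Ctx.num_le _ hg a), e.num _ hf, e.num _ hg]
  | not _ ih => intro a b e; exact not_congr (ih e)
  | and _ _ ih ih' => intro a b e; exact and_congr (ih e) (ih' e)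
  | ex _ ih =>
    intro a b e
    refine exists_congr fun i => ?_
    constructor
    · rintro ⟨hi, h⟩
      exact ⟨e.N_eq ▸ hi, (ih (e.ext hi _)).1 h⟩
    · rintro ⟨hi, h⟩
      exact ⟨e.N_eq ▸ hi, (ih (e.ext _ hi)).2 h⟩

theorem SO.local {full : Bool} {α : Type} [Ctx α] {φ : α → Prop} (h : SO full φ) :
    ∀ {a b : α}, Agree a b → (φ a ↔ φ b) := by
  have aux : ∀ {α : Type} [Ctx α] {a b : α} (Y : Rel), Agree a b → Agree (a, Y) (b, Y) := by
    intro α _ a b Y e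
    refine ⟨e.N_eq, ?_, ?_⟩
    · rintro f ⟨f, hf, rfl⟩
      exact e.num f hf
    · rintro R (rfl | ⟨R, hR, rfl⟩)
      · exact fun _ _ _ _ => rfl
      · exact e.rel R hR
  induction h with
  | fo h => exact h.local
  | ex _ ih => intro a b e; exact exists_congr fun Y => ih (aux Y e)
  | all _ _ ih => intro a b e; exact forall_congr' fun Y => ih (aux Y e)

/-- The readers and relations of the contexts `t c` are definable from the contexts `s c`. -/
structure Interp {γ α δ : Type} [Ctx α] [Ctx δ] (s : γ → δ) (t : γ → α) : Prop where
  N_le : ∀ c, N (t c) ≤ N (s c)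
  N : ∃ ψ : Ext δ → Prop, FO ψ ∧ ∀ c i h, ψ ⟨s c, i, h⟩ ↔ N (t c) = i
  num : ∀ f ∈ Ctx.num (α := α), ∃ ψ : Ext δ → Prop, FO ψ ∧ ∀ c i h, ψ ⟨s c, i, h⟩ ↔ f (t c) = i
  rel : ∀ R ∈ Ctx.rel (α := α), ∃ ψ : Ext (Ext δ) → Prop, FO ψ ∧ ∀ c i h j h',
    i ≤ Ctx.N (t c) → j ≤ Ctx.N (t c) → (ψ ⟨⟨s c, i, h⟩, j, h'⟩ ↔ R (t c) i j = true)

theorem Interp.ext {γ α δ : Type} [Ctx α] [Ctx δ] {s : γ → δ} {t : γ → α} (h : Interp s t) :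
    Interp (γ := {x : γ × ℕ // x.2 ≤ Ctx.N (t x.1)})
      (fun x => (⟨s x.1.1, x.1.2, x.2.trans (h.N_le _)⟩ : Ext δ))
      (fun x => (⟨t x.1.1, x.1.2, x.2⟩ : Ext α)) := by
  refine ⟨fun c => h.N_le _, ?_, ?_, ?_⟩
  · obtain ⟨ψ, hψ, e⟩ := h.N
    exact ⟨_, hψ.ren (Ren.a (α := δ)).ren_ext, fun c i hi => e c.1.1 i hi⟩
  · rintro f (rfl | ⟨f, hf, rfl⟩)
    · exact ⟨_, FO.num_eq (num_a num_i) num_i, fun c i hi => Iff.rfl⟩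
    · obtain ⟨ψ, hψ, e⟩ := h.num f hf
      exact ⟨_, hψ.ren (Ren.a (α := δ)).ren_ext, fun c i hi => e c.1.1 i hi⟩
  · rintro R ⟨R, hR, rfl⟩
    obtain ⟨ψ, hψ, e⟩ := h.rel R hR
    exact ⟨_, hψ.ren (Ren.a (α := δ)).ren_ext.ren_ext, fun c i hi j hj => e c.1.1 i hi j hj⟩

theorem FO.interp {α : Type} [Ctx α] {φ : α → Prop} (h : FO φ) :
    ∀ {γ δ : Type} [Ctx δ] {s : γ → δ} {t : γ → α}, Interp s t →
      ∃ ψ : δ → Prop, FO ψ ∧ ∀ c, ψ (s c) ↔ φ (t c) := by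
  have three : ∀ {δ : Type} [Ctx δ] {ψ₁ ψ₂ ψ₃ : Ext δ → Prop} {χ : Ext (Ext (Ext δ)) → Prop},
      FO ψ₁ → FO ψ₂ → FO ψ₃ → FO χ → FO fun d => ∃ i, ∃ hi : i ≤ Ctx.N d, ∃ j,
        ∃ hj : j ≤ Ctx.N d, ∃ k, ∃ hk : k ≤ Ctx.N d,
        ψ₁ ⟨d, i, hi⟩ ∧ ψ₂ ⟨d, j, hj⟩ ∧ ψ₃ ⟨d, k, hk⟩ ∧ χ ⟨⟨⟨d, i, hi⟩, j, hj⟩, k, hk⟩ := by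
    intro δ _ ψ₁ ψ₂ ψ₃ χ h₁ h₂ h₃ hχ
    have r1 : Ren (Ext.a : Ext δ → δ) := Ren.a
    have r2 : Ren fun p : Ext (Ext δ) => p.a.a := r1.comp Ren.a
    have := (h₁.ren ((Ren.a (α := Ext δ)).comp (Ren.a (α := Ext (Ext δ))))).and
      ((h₂.ren (r1.ren_ext.comp (Ren.a (α := Ext (Ext δ))))).and
      ((h₃.ren r2.ren_ext).and hχ))
    exact this.ex.ex.ex
  induction h with
  | @add α _ f g k hf hg hh =>
    intro γ δ _ s t H
    obtain ⟨ψ₁, h₁, e₁⟩ := H.num _ hf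
    obtain ⟨ψ₂, h₂, e₂⟩ := H.num _ hg
    obtain ⟨ψ₃, h₃, e₃⟩ := H.num _ hh
    refine ⟨_, three h₁ h₂ h₃ (FO.add (num_a (num_a num_i)) (num_a num_i) num_i), fun c => ?_⟩
    have h1 := (Ctx.num_le _ hf (t c)).trans (H.N_le c)
    have h2 := (Ctx.num_le _ hg (t c)).trans (H.N_le c)
    have h3 := (Ctx.num_le _ hh (t c)).trans (H.N_le c)
    simp only [e₁, e₂, e₃]
    constructor
    · rintro ⟨i, _, j, _, k, _, rfl, rfl, rfl, h⟩
      exact h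
    · intro h
      exact ⟨_, h1, _, h2, _, h3, rfl, rfl, rfl, h⟩
  | @mul α _ f g k hf hg hh =>
    intro γ δ _ s t H
    obtain ⟨ψ₁, h₁, e₁⟩ := H.num _ hf
    obtain ⟨ψ₂, h₂, e₂⟩ := H.num _ hg
    obtain ⟨ψ₃, h₃, e₃⟩ := H.num _ hh
    refine ⟨_, three h₁ h₂ h₃ (FO.mul (num_a (num_a num_i)) (num_a num_i) num_i), fun c => ?_⟩
    have h1 := (Ctx.num_le _ hf (t c)).trans (H.N_le c)
    have h2 := (Ctx.num_le _ hg (t c)).trans (H.N_le c)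
    have h3 := (Ctx.num_le _ hh (t c)).trans (H.N_le c)
    simp only [e₁, e₂, e₃]
    constructor
    · rintro ⟨i, _, j, _, k, _, rfl, rfl, rfl, h⟩
      exact h
    · intro h
      exact ⟨_, h1, _, h2, _, h3, rfl, rfl, rfl, h⟩
  | @rel α _ R f g hR hf hg =>
    intro γ δ _ s t H
    obtain ⟨ψ₁, h₁, e₁⟩ := H.num _ hf
    obtain ⟨ψ₂, h₂, e₂⟩ := H.num _ hg
    obtain ⟨ψ₃, h₃, e₃⟩ := H.rel _ hR
    refine ⟨_, three h₁ h₂ FO.top (h₃.ren (Ren.a (α := Ext (Ext δ)))), fun c => ?_⟩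
    have h1 := Ctx.num_le _ hf (t c)
    have h2 := Ctx.num_le _ hg (t c)
    simp only [e₁, e₂]
    constructor
    · rintro ⟨i, _, j, _, k, _, rfl, rfl, -, h⟩
      exact (e₃ _ _ _ _ _ h1 h2).1 h
    · intro h
      exact ⟨_, h1.trans (H.N_le c), _, h2.trans (H.N_le c), 0, Nat.zero_le _, rfl, rfl, trivial,
        (e₃ _ _ _ _ _ h1 h2).2 h⟩
  | not _ ih =>
    intro γ δ _ s t H
    obtain ⟨ψ, h, e⟩ := ih H
    exact ⟨_, h.not, fun c => not_congr (e c)⟩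
  | and _ _ ih ih' =>
    intro γ δ _ s t H
    obtain ⟨ψ, h, e⟩ := ih H
    obtain ⟨ψ', h', e'⟩ := ih' H
    exact ⟨_, h.and h', fun c => and_congr (e c) (e' c)⟩
  | @ex α _ φ _ ih =>
    intro γ δ _ s t H
    obtain ⟨ψ, h, e⟩ := ih H.ext
    obtain ⟨χ, hχ, eχ⟩ := H.N
    have hle : FO fun p : Ext δ => ∃ n, ∃ hn : n ≤ Ctx.N p, χ ⟨p.a, n, hn⟩ ∧ p.i ≤ n :=
      FO.ex (φ := fun q : Ext (Ext δ) => χ ⟨q.a.a, q.i, q.le⟩ ∧ q.a.i ≤ q.i)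
        ((hχ.ren (Ren.a (α := δ)).ren_ext).and (FO.le Num.v0.w Num.v0.term))
    refine ⟨_, (hle.and h).ex, fun c => ?_⟩
    constructor
    · rintro ⟨i, hi, ⟨n, hn, h1, h2⟩, h3⟩
      have hni : Ctx.N (t c) = n := (eχ c n hn).1 h1
      have hin : i ≤ Ctx.N (t c) := by simp only at h2; omega
      exact ⟨i, hin, (e ⟨(c, i), hin⟩).1 h3⟩
    · rintro ⟨i, hi, h'⟩
      exact ⟨i, hi.trans (H.N_le c), ⟨_, H.N_le c, (eχ c _ _).2 rfl, hi⟩, (e ⟨(c, i), hi⟩).2 h'⟩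

end Definability

/-! ### First-order definable languages are in P -/

namespace StackProgram

open Function Complexity Definability

namespace Cmd

theorem Exec.to {c : Cmd} {S S' S'' : Store} {t : ℕ} (h : Exec c S S' t) (e : S'' = S') :
    Exec c S S'' t := e ▸ h

theorem Exec.to' {c : Cmd} {S S' S'' : Store} {t : ℕ} (h : Exec c S S' t) (e : S'' = S) :
    Exec c S'' S' t := e ▸ h

theorem Exec.ite_of {k : ℕ} {c : Option Bool → Cmd} {c' : Cmd} {S S₁ S' : Store} {t : ℕ}
    (h : Exec c' S₁ S' t) (hc : c (S k).head? = c') (hS : update S k (S k).tail = S₁) :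
    Exec (Cmd.ite k c) S S' (t + 1) := by
  subst hc hS
  exact .ite h

/-- A loop runs in time proportional to the length of the stack if its body preserves an invariant
and runs in bounded time. -/
theorem exec_loop {k : ℕ} {c : Bool → Cmd} {T : ℕ} (I : List Bool → Store → Prop)
    (hI : ∀ l S, I l S → S k = l)
    (h : ∀ b l S, I (b :: l) S → ∃ S' t, Exec (c b) (update S k l) S' t ∧ t ≤ T ∧ I l S') :
    ∀ l S, I l S → ∃ S' t, Exec (loop k c) S S' t ∧ t ≤ l.length * (T + 1) + 1 ∧ I [] S' := by
  intro l
  induction l with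
  | nil => intro S hS; exact ⟨S, 1, .loop_nil (hI _ _ hS), by simp, hS⟩
  | cons b l ih =>
    intro S hS
    obtain ⟨S', t, h1, h2, h3⟩ := h b l S hS
    obtain ⟨S'', t', h1', h2', h3'⟩ := ih S' h3
    refine ⟨S'', _, .loop_cons (hI _ _ hS) h1 h1', ?_, h3'⟩
    rw [List.length_cons, add_mul]
    omega

/-- Add the length of stack `k` in unary to stack `j`, with the auxiliary stack 3. -/
def copy (k j : ℕ) : Cmd :=
  seq (loop k fun b => seq (push j true) (push 3 b)) (loop 3 fun b => push k b)

theorem exec_copy {k j : ℕ} (hkj : k ≠ j) (hk : k ≠ 3) (hj : j ≠ 3) {S : Store} (h3 : S 3 = []) :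
    ∃ t, Exec (copy k j) S (update S j (List.replicate (S k).length true ++ S j)) t ∧
      t ≤ 5 * (S k).length + 2 := by
  obtain ⟨S₁, t₁, h1, h2, l₁, e₁, rfl⟩ := exec_loop (k := k)
    (c := fun b => seq (push j true) (push 3 b)) (T := 2)
    (fun l S' => ∃ l', l'.reverse ++ l = S k ∧ S' = update (update (update S k l) 3 l') j
      (List.replicate l'.length true ++ S j))
    (by rintro l S' ⟨l', _, rfl⟩; simp [hkj, hk])
    (by
      rintro b l S' ⟨l', e, rfl⟩
      refine ⟨_, _, .seq (.push _ _ _) (.push _ _ _), le_rfl, b :: l', by simp [e], ?_⟩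
      funext i
      simp only [update_apply]
      split_ifs <;> simp_all [List.replicate_succ])
    (S k) S ⟨[], by simp, by funext i; simp only [update_apply]; split_ifs <;> simp_all⟩
  obtain ⟨S₂, t₂, h1', h2', l₂, e₂, rfl⟩ := exec_loop (k := 3) (c := fun b => push k b) (T := 1)
    (fun l S' => ∃ l', l.reverse ++ l' = S k ∧ S' = update (update (update S k l') 3 l) j
      (List.replicate (S k).length true ++ S j))
    (by rintro l S' ⟨l', _, rfl⟩; simp [hj.symm])
    (by
      rintro b l S' ⟨l', e, rfl⟩
      refine ⟨_, _, .push _ _ _, le_rfl, b :: l', by simpa using e, ?_⟩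
      funext i
      simp only [update_apply]
      split_ifs <;> simp_all)
    l₁ _ ⟨[], by simpa using e₁, by
      have : (S k).length = l₁.length := by simp [← e₁]
      rw [this]⟩
  have hl : l₁.length = (S k).length := by simp [← e₁]
  refine ⟨_, (Exec.seq h1 h1').to ?_, by omega⟩
  simp only [List.reverse_nil, List.nil_append] at e₂
  subst e₂
  funext i
  simp only [update_apply]
  split_ifs <;> simp_all

/-- Compare the lengths of the stacks 2 and 4, empty them, and put the result on stack 1. -/
def eqTest : Cmd :=
  seq (loop 2 fun _ => ite 4 fun o => o.elim (push 5 true) fun _ => skip)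
    (seq (loop 4 fun _ => push 5 true)
      (ite 5 fun o => o.elim (push 1 true) fun _ => seq (loop 5 fun _ => skip) (push 1 false)))

theorem exec_eqTest {S : Store} (h5 : S 5 = []) (h1 : S 1 = []) :
    ∃ t, Exec eqTest S (update (update (update S 2 []) 4 [])
        1 [decide ((S 2).length = (S 4).length)]) t ∧
      t ≤ 8 * (S 2).length + 8 * (S 4).length + 8 := by
  obtain ⟨S₁, t₁, e1, b1, l₁, d₁, i₁, rfl, hd₁, hc₁⟩ := exec_loop (k := 2)
    (c := fun _ => ite 4 fun o => o.elim (push 5 true) fun _ => skip) (T := 2)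
    (fun l S' => ∃ r d : List Bool, ∃ i, S' = update (update (update S 2 l) 4 r) 5 d ∧
      i + l.length = (S 2).length ∧
      ((d = [] ∧ r.length + i = (S 4).length) ∨
        (r = [] ∧ d.length + (S 4).length = i ∧ d ≠ [])))
    (by rintro l S' ⟨r, d, i, rfl, _⟩; simp)
    (by
      rintro b l S' ⟨r, d, i, rfl, hi, h⟩
      rw [List.length_cons] at hi
      rcases r with _ | ⟨x, r⟩
      · refine ⟨_, 2, Exec.ite_of (.push 5 true _) (by simp) rfl, le_rfl, [], true :: d, i + 1, ?_, by omega, Or.inr ⟨rfl, ?_, by simp⟩⟩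
        · funext j
          simp only [update_apply]
          split_ifs <;> grind
        · rcases h with ⟨rfl, h⟩ | ⟨_, h, _⟩
          · simp at h ⊢; omega
          · simp; omega
      · rcases h with ⟨rfl, h⟩ | ⟨h, _⟩
        · refine ⟨_, 2, Exec.ite_of (.skip _) (by simp) rfl, le_rfl, r, [], i + 1, ?_, by omega, Or.inl ⟨rfl, ?_⟩⟩
          · funext i
            simp only [update_apply]
            split_ifs <;> simp_all
          · simp at h; omega
        · simp at h)
    (S 2) S ⟨S 4, [], 0, by funext i; simp only [update_apply]; split_ifs <;> simp_all, by simp,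
      Or.inl ⟨rfl, by simp⟩⟩
  simp only [List.length_nil, add_zero] at hd₁
  subst hd₁
  obtain ⟨S₂, t₂, e2, b2, l₂, rfl, hl₂⟩ := exec_loop (k := 4)
    (c := fun _ => push 5 true) (T := 1)
    (fun l S' => ∃ d : List Bool, S' = update (update (update S 2 []) 4 l) 5 d ∧
      d.length + l.length = d₁.length + l₁.length)
    (by rintro l S' ⟨d, rfl, _⟩; simp)
    (by
      rintro b l S' ⟨d, rfl, h⟩
      refine ⟨_, _, .push _ _ _, le_rfl, true :: d, ?_, by simp at h ⊢; omega⟩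
      funext i
      simp only [update_apply]
      split_ifs <;> simp_all)
    l₁ _ ⟨d₁, rfl, rfl⟩
  simp only [List.length_nil, add_zero] at hl₂
  have hsum : d₁.length + l₁.length ≤ (S 2).length + (S 4).length := by
    rcases hc₁ with ⟨rfl, h⟩ | ⟨rfl, h, _⟩
    · simp; omega
    · simp; omega
  rcases l₂ with _ | ⟨x, l₂⟩
  · have heq : (S 2).length = (S 4).length := by
      simp at hl₂
      rcases hc₁ with ⟨rfl, h⟩ | ⟨rfl, h, h'⟩
      · simp at hl₂; omega
      · simp at hl₂; exact absurd (List.length_eq_zero_iff.1 hl₂.symm) h'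
    refine ⟨_, .seq e1 (.seq e2 ((Exec.ite_of (.push 1 true _) (by simp) rfl).to ?_)), by omega⟩
    clear hc₁ hl₂ e1 e2 b1 b2 hsum
    funext i
    simp only [update_apply]
    split_ifs <;> simp_all
  · have hne : (S 2).length ≠ (S 4).length := by
      simp at hl₂
      rcases hc₁ with ⟨rfl, h⟩ | ⟨rfl, h, h'⟩
      · simp at hl₂; omega
      · simp at hl₂; omega
    obtain ⟨S₃, t₃, e3, b3, rfl⟩ := exec_loop (k := 5)
      (c := fun _ => skip) (T := 1)
      (fun l S' => S' = update (update (update S 2 []) 4 []) 5 l)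
      (by rintro l S' rfl; simp)
      (by
        rintro b l S' rfl
        refine ⟨_, _, .skip _, le_rfl, by simp⟩)
      l₂ _ rfl
    rw [List.length_cons] at hl₂
    refine ⟨_, .seq e1 (.seq e2 ((Exec.ite_of (.seq e3 (.push 1 false _)) (by simp)
      (by simp)).to ?_)), by omega⟩
    funext i
    simp only [update_apply]
    split_ifs <;> simp_all

/-- Put the bit of stack 0 whose number is the length of stack `k` on stack 1. -/
def bitTest (k : ℕ) : Cmd :=
  seq (copy k 2) (seq (loop 2 fun _ => ite 0 fun o => o.elim skip fun b => push 4 b)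
    (seq (ite 0 fun o => o.elim (push 1 false) fun b => seq (push 0 b) (push 1 b))
      (loop 4 fun b => push 0 b)))

theorem exec_bitTest {k : ℕ} (hk : k = 0 ∨ 7 ≤ k) {S : Store} (h : ∀ i, 1 ≤ i → i < 7 → S i = []) :
    ∃ t, Exec (bitTest k) S (update S 1 [(S 0).getD (S k).length false]) t ∧
      t ≤ 10 * (S k).length + 9 := by
  have h1 := h 1 (by omega) (by omega)
  have h2 := h 2 (by omega) (by omega)
  have h3 := h 3 (by omega) (by omega)
  have h4 := h 4 (by omega) (by omega)
  obtain ⟨t₀, e0, b0⟩ := exec_copy (k := k) (j := 2) (by omega) (by omega) (by omega) h3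
  obtain ⟨S₁, t₁, e1, b1, i, rfl, hi⟩ := exec_loop (k := 2)
    (c := fun _ => ite 0 fun o => o.elim skip fun b => push 4 b) (T := 2)
    (fun l S' => ∃ i, S' = update (update (update S 2 l) 0 ((S 0).drop i)) 4 ((S 0).take i).reverse ∧
      i + l.length = (S k).length)
    (by rintro l S' ⟨i, rfl, _⟩; simp)
    (by
      rintro b l S' ⟨i, rfl, hi⟩
      rw [List.length_cons] at hi
      by_cases hlt : i < (S 0).length
      · refine ⟨_, 2, Exec.ite_of (.push 4 (S 0)[i] _) (by simp [hlt]) rfl, le_rfl, i + 1, ?_,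
          by omega⟩
        have : ((S 0).take (i + 1)).reverse = (S 0)[i] :: ((S 0).take i).reverse := by
          rw [← List.take_append_getElem hlt, List.reverse_append]
          rfl
        rw [this]
        funext j
        simp only [update_apply]
        split_ifs <;> simp_all
      · have e : (S 0).drop i = [] := List.drop_eq_nil_of_le (by omega)
        have e' : (S 0).drop (i + 1) = [] := List.drop_eq_nil_of_le (by omega)
        have e'' : (S 0).take (i + 1) = (S 0).take i := by
          rw [List.take_of_length_le (by omega), List.take_of_length_le (by omega)]
        refine ⟨_, 2, Exec.ite_of (.skip _) (by simp [e]) rfl, le_rfl, i + 1, ?_, by omega⟩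
        funext j
        simp only [update_apply]
        split_ifs <;> simp_all)
    (List.replicate (S k).length true) (update S 2 (List.replicate (S k).length true ++ S 2))
    ⟨0, by funext i; simp only [update_apply]; split_ifs <;> simp_all, by simp⟩
  simp only [List.length_nil, add_zero] at hi
  subst hi
  set n := (S k).length with hn
  set c := (S 0).getD n false with hc
  have e2 : ∃ t, t ≤ 3 ∧ Exec (ite 0 fun o => o.elim (push 1 false) fun b => seq (push 0 b) (push 1 b))
      (update (update (update S 2 []) 0 ((S 0).drop n)) 4 ((S 0).take n).reverse)
      (update (update (update (update S 2 []) 0 ((S 0).drop n)) 4 ((S 0).take n).reverse) 1 [c]) t := by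
    by_cases hlt : n < (S 0).length
    · have hcc : c = (S 0)[n] := by simp [hc, hlt]
      refine ⟨3, le_rfl, (Exec.ite_of (.seq (.push 0 (S 0)[n] _) (.push 1 (S 0)[n] _))
        (by simp [hlt]) rfl).to ?_⟩
      have hd : (S 0).drop n = (S 0)[n] :: (S 0).drop (n + 1) := by simp
      funext j
      simp only [update_apply, hcc]
      split_ifs <;> simp_all
    · have e : (S 0).drop n = [] := List.drop_eq_nil_of_le (by omega)
      have hcc : c = false := by simp [hc, not_lt.1 hlt]
      refine ⟨2, by omega, (Exec.ite_of (.push 1 false _) (by simp [e]) rfl).to ?_⟩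
      have e' : (S 0).drop (n + 1) = [] := List.drop_eq_nil_of_le (by omega)
      funext j
      simp only [update_apply, hcc]
      split_ifs <;> simp_all
  obtain ⟨t₂, b2, e2⟩ := e2
  obtain ⟨S₃, t₃, e3, b3, l', hl', rfl⟩ := exec_loop (k := 4)
    (c := fun b => push 0 b) (T := 1)
    (fun l S' => ∃ l', l.reverse ++ l' = S 0 ∧
      S' = update (update (update (update S 2 []) 0 l') 4 l) 1 [c])
    (by rintro l S' ⟨l', _, rfl⟩; simp)
    (by
      rintro b l S' ⟨l', e, rfl⟩
      refine ⟨_, _, .push _ _ _, le_rfl, b :: l', by simpa using e, ?_⟩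
      funext i
      simp only [update_apply]
      split_ifs <;> simp_all)
    ((S 0).take n).reverse _ ⟨(S 0).drop n, by simp, rfl⟩
  have hlen : ((S 0).take n).reverse.length ≤ n := by simp
  simp only [List.length_replicate] at b1
  refine ⟨_, (Exec.seq e0 (Exec.seq e1 (Exec.seq e2 e3))).to ?_, by omega⟩
  simp only [List.reverse_nil, List.nil_append] at hl'
  subst hl'
  funext i
  simp only [update_apply]
  split_ifs <;> simp_all

end Cmd

end StackProgram

namespace StackProgram

open Function Complexity Definability

instance wordCtx : Ctx Word where
  N := List.length
  num := {List.length}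
  rel := {fun w i _ => w.getD i false}
  num_le := by
    rintro f rfl a
    exact le_rfl

/-- The stacks in front of the quantifier number `d`: the input on stack 0, the stacks 1 to 6 are
empty, and the values of the quantified variables are on every third of the following stacks. -/
structure Layout (d : ℕ) (w : Word) (v : ℕ → ℕ) (S : Store) : Prop where
  input : S 0 = w
  scratch : ∀ k, 1 ≤ k → k < 7 → S k = []
  reg : ∀ r < d, S (7 + 3 * r) = List.replicate (v r) true
  le : ∀ r, v r ≤ w.length
  zero : ∀ r, d ≤ r → v r = 0
  rest : ∀ k, 7 + 3 * d ≤ k → S k = []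

open Classical in
/-- The command puts the truth value of `φ` on stack 1, in polynomial time. -/
def Decides (d : ℕ) (c : Cmd) (φ : Word → (ℕ → ℕ) → Prop) : Prop :=
  ∃ q : Polynomial ℕ, ∀ w v S, Layout d w v S →
    ∃ t ≤ q.eval w.length, c.Exec S (update S 1 [decide (φ w v)]) t

/-- Stack `k` holds the value of `f` in unary. -/
def Holds (d k : ℕ) (f : Word → (ℕ → ℕ) → ℕ) : Prop :=
  (k = 0 ∨ 7 ≤ k) ∧ k < 7 + 3 * d ∧ ∀ w v S, Layout d w v S → (S k).length = f w v

theorem Holds.succ {d k : ℕ} {f : Word → (ℕ → ℕ) → ℕ} (h : Holds d k f) :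
    Holds (d + 1) k fun w v => f w (update v d 0) := by
  refine ⟨h.1, by have := h.2.1; omega, fun w v S hS => ?_⟩
  have : Layout d w (update v d 0) (fun j => if j < 7 + 3 * d then S j else []) := by
    refine ⟨by simp [hS.input], fun k h1 h2 => ?_, fun r hr => ?_, fun r => ?_, fun r hr => ?_,
      fun k hk => ?_⟩
    · simp [hS.scratch k h1 h2]
    · have h1 : r < d + 1 := by omega
      have h2 : r ≠ d := by omega
      simp [hS.reg r h1, h2, hr]
    · by_cases h : r = d
      · simp [h]
      · simp [h, hS.le r]
    · by_cases h : r = d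
      · simp [h]
      · simp [h, hS.zero r (by omega)]
    · have : ¬ k < 7 + 3 * d := by omega
      simp [this]
  have := h.2.2 _ _ _ this
  simpa [h.2.1] using this

theorem Decides.congr {d : ℕ} {c : Cmd} {φ ψ : Word → (ℕ → ℕ) → Prop} (h : Decides d c φ)
    (e : ∀ w v, (∀ r, v r ≤ w.length) → (∀ r, d ≤ r → v r = 0) → (ψ w v ↔ φ w v)) :
    Decides d c ψ := by
  obtain ⟨q, h⟩ := h
  refine ⟨q, fun w v S hS => ?_⟩
  obtain ⟨t, ht, hE⟩ := h w v S hS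
  refine ⟨t, ht, ?_⟩
  convert hE using 4
  exact e w v hS.le hS.zero

theorem Holds.le {d k : ℕ} {f : Word → (ℕ → ℕ) → ℕ} (h : Holds d k f) {w v S}
    (hS : Layout d w v S) : (S k).length ≤ w.length := by
  have h1 := h.1
  by_cases h0 : k = 0
  · subst h0
    simp [hS.input]
  · by_cases hr : ∃ r < d, k = 7 + 3 * r
    · obtain ⟨r, hr, rfl⟩ := hr
      simp [hS.reg r hr, hS.le r]
    · exfalso
      have key : ∀ l, Layout d w v (update S k l) := by
        intro l
        push Not at hr
        refine ⟨?_, fun j h1 h2 => ?_, fun r h1 => ?_, hS.le, hS.zero, fun j hj => ?_⟩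
        · simp [Ne.symm h0, hS.input]
        · have : j ≠ k := by omega
          simp [this, hS.scratch j h1 h2]
        · simp [(hr r h1).symm, hS.reg r h1]
        · have := h.2.1
          have : j ≠ k := by omega
          simp [this, hS.rest j hj]
      have h1 := h.2.2 _ _ _ (key [])
      have h2 := h.2.2 _ _ _ (key [true])
      simp at h1 h2
      omega

theorem decides_add {d k₁ k₂ k₃ : ℕ} {f g h : Word → (ℕ → ℕ) → ℕ} (h₁ : Holds d k₁ f)
    (h₂ : Holds d k₂ g) (h₃ : Holds d k₃ h) :
    Decides d (.seq (.copy k₁ 2) (.seq (.copy k₂ 2) (.seq (.copy k₃ 4) .eqTest)))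
      fun w v => f w v + g w v = h w v := by
  classical
  refine ⟨Polynomial.C 60 * Polynomial.X + Polynomial.C 30, fun w v S hS => ?_⟩
  have a₁ := h₁.1
  have a₂ := h₂.1
  have a₃ := h₃.1
  have n₁ : k₁ ≠ 2 := by omega
  have n₂ : k₂ ≠ 2 := by omega
  have n₃ : k₃ ≠ 2 := by omega
  have n₃' : k₃ ≠ 4 := by omega
  have s1 := hS.scratch 1 (by omega) (by omega)
  have s2 := hS.scratch 2 (by omega) (by omega)
  have s3 := hS.scratch 3 (by omega) (by omega)
  have s4 := hS.scratch 4 (by omega) (by omega)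
  have s5 := hS.scratch 5 (by omega) (by omega)
  obtain ⟨t₁, e₁, b₁⟩ := Cmd.exec_copy (k := k₁) (j := 2) (by omega) (by omega) (by omega) s3
  obtain ⟨t₂, e₂, b₂⟩ := Cmd.exec_copy (k := k₂) (j := 2) (by omega) (by omega) (by omega)
    (S := update S 2 (List.replicate (S k₁).length true ++ S 2)) (by simp [s3])
  obtain ⟨t₃, e₃, b₃⟩ := Cmd.exec_copy (k := k₃) (j := 4) (by omega) (by omega) (by omega)
    (S := update S 2 (List.replicate (S k₂).length true ++ List.replicate (S k₁).length true))
    (by simp [s3])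
  obtain ⟨t₄, e₄, b₄⟩ := Cmd.exec_eqTest
    (S := update (update S 2 (List.replicate (S k₂).length true ++
      List.replicate (S k₁).length true)) 4 (List.replicate (S k₃).length true))
    (by simp [s5]) (by simp [s1])
  have l₁ := h₁.le hS
  have l₂ := h₂.le hS
  have l₃ := h₃.le hS
  simp only [n₂, n₃, ne_eq, not_false_eq_true, update_of_ne, update_self,
    List.length_replicate, s2, List.append_nil, update_idem] at e₁ e₂ e₃ e₄ b₁ b₂ b₃ b₄
  simp only [ne_eq, not_false_eq_true, update_of_ne, update_self, List.length_append,
    List.length_replicate, s4, List.append_nil,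
    show (2 : ℕ) ≠ 4 by decide, show (4 : ℕ) ≠ 2 by decide] at e₃ e₄ b₄
  refine ⟨_, ?_, ((e₁.seq (e₂.seq (e₃.seq e₄))).to ?_)⟩
  · simp
    omega
  · have hd : f w v + g w v = h w v ↔ (S k₂).length + (S k₁).length = (S k₃).length := by
      rw [h₁.2.2 _ _ _ hS, h₂.2.2 _ _ _ hS, h₃.2.2 _ _ _ hS, add_comm]
    simp only [hd]
    funext i
    simp only [update_apply]
    split_ifs <;> simp_all

theorem decides_mul {d k₁ k₂ k₃ : ℕ} {f g h : Word → (ℕ → ℕ) → ℕ} (h₁ : Holds d k₁ f)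
    (h₂ : Holds d k₂ g) (h₃ : Holds d k₃ h) :
    Decides d (.seq (.copy k₁ 6) (.seq (.loop 6 fun _ => .copy k₂ 2) (.seq (.copy k₃ 4) .eqTest)))
      fun w v => f w v * g w v = h w v := by
  classical
  refine ⟨Polynomial.C 60 * Polynomial.X * Polynomial.X + Polynomial.C 60 * Polynomial.X +
    Polynomial.C 30, fun w v S hS => ?_⟩
  have a₁ := h₁.1
  have a₂ := h₂.1
  have a₃ := h₃.1
  have s1 := hS.scratch 1 (by omega) (by omega)
  have s2 := hS.scratch 2 (by omega) (by omega)
  have s3 := hS.scratch 3 (by omega) (by omega)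
  have s4 := hS.scratch 4 (by omega) (by omega)
  have s5 := hS.scratch 5 (by omega) (by omega)
  have s6 := hS.scratch 6 (by omega) (by omega)
  have l₁ := h₁.le hS
  have l₂ := h₂.le hS
  have l₃ := h₃.le hS
  have n₂ : k₂ ≠ 2 := by omega
  have n₂' : k₂ ≠ 6 := by omega
  have n₃ : k₃ ≠ 2 := by omega
  have n₃' : k₃ ≠ 4 := by omega
  have n₃'' : k₃ ≠ 6 := by omega
  obtain ⟨t₁, e₁, b₁⟩ := Cmd.exec_copy (k := k₁) (j := 6) (by omega) (by omega) (by omega) s3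
  obtain ⟨S₂, t₂, e₂, b₂, i, hi, rfl⟩ := Cmd.exec_loop (k := 6) (c := fun _ => .copy k₂ 2)
    (T := 5 * (S k₂).length + 2)
    (fun l S' => ∃ i, i + l.length = (S k₁).length ∧
      S' = update (update S 6 l) 2 (List.replicate (i * (S k₂).length) true))
    (by rintro l S' ⟨i, _, rfl⟩; simp)
    (by
      rintro b l S' ⟨i, hi, rfl⟩
      obtain ⟨t, e, b⟩ := Cmd.exec_copy (k := k₂) (j := 2) (by omega) (by omega) (by omega)
        (S := update (update S 6 l) 2 (List.replicate (i * (S k₂).length) true)) (by simp [s3])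
      simp only [n₂, n₂', ne_eq, not_false_eq_true, update_of_ne, update_self, update_idem,
        List.replicate_append_replicate] at e b
      rw [List.length_cons] at hi
      refine ⟨_, _, ?_, b, i + 1, by omega, rfl⟩
      rw [show (S k₂).length + i * (S k₂).length = (i + 1) * (S k₂).length by ring] at e
      convert e using 1
      funext j
      simp only [update_apply]
      split_ifs <;> simp_all)
    (List.replicate (S k₁).length true) (update S 6 (List.replicate (S k₁).length true ++ S 6))
    ⟨0, by simp, by funext i; simp only [update_apply]; split_ifs <;> simp_all⟩
  simp only [List.length_nil, add_zero, List.length_replicate] at hi b₂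
  subst hi
  obtain ⟨t₃, e₃, b₃⟩ := Cmd.exec_copy (k := k₃) (j := 4) (by omega) (by omega) (by omega)
    (S := update (update S 6 []) 2 (List.replicate ((S k₁).length * (S k₂).length) true))
    (by simp [s3])
  simp only [n₃, n₃'', ne_eq, not_false_eq_true, update_of_ne] at e₃ b₃
  obtain ⟨t₄, e₄, b₄⟩ := Cmd.exec_eqTest
    (S := update (update (update S 6 []) 2 (List.replicate ((S k₁).length * (S k₂).length) true)) 4
      (List.replicate (S k₃).length true))
    (by simp [s5]) (by simp [s1])
  have e₃' := e₃.to (S'' := update (update (update S 6 []) 2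
      (List.replicate ((S k₁).length * (S k₂).length) true)) 4
      (List.replicate (S k₃).length true)) (by simp [s4])
  have hm : (S k₁).length * (S k₂).length ≤ w.length * w.length := Nat.mul_le_mul l₁ l₂
  have b₂' : t₂ ≤ 5 * (w.length * w.length) + 3 * w.length + 1 := by
    refine b₂.trans ?_
    have := Nat.mul_le_mul l₁ (show 5 * (S k₂).length + 2 + 1 ≤ 5 * w.length + 3 by omega)
    nlinarith
  simp only [update_self, ne_eq, not_false_eq_true, update_of_ne, List.length_replicate,
    show (2 : ℕ) ≠ 4 by decide] at b₄ e₄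
  refine ⟨_, ?_, ((e₁.seq (e₂.seq (e₃'.seq e₄))).to ?_)⟩
  · simp only [Polynomial.eval_add, Polynomial.eval_mul, Polynomial.eval_C, Polynomial.eval_X]
    rw [mul_assoc]
    omega
  · have hd : f w v * g w v = h w v ↔ (S k₁).length * (S k₂).length = (S k₃).length := by
      rw [h₁.2.2 _ _ _ hS, h₂.2.2 _ _ _ hS, h₃.2.2 _ _ _ hS]
    simp only [hd]
    clear e₁ e₂ e₃ e₃' e₄ b₁ b₂ b₂' b₃ b₄ hm hd
    funext i
    simp only [update_apply]
    split_ifs <;> simp_all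

theorem decides_bit {d k : ℕ} {f : Word → (ℕ → ℕ) → ℕ} (h : Holds d k f) :
    Decides d (.bitTest k) fun w v => w.getD (f w v) false = true := by
  classical
  refine ⟨Polynomial.C 10 * Polynomial.X + Polynomial.C 9, fun w v S hS => ?_⟩
  obtain ⟨t, e, b⟩ := Cmd.exec_bitTest (S := S) h.1 hS.scratch
  have := h.le hS
  refine ⟨t, by simp; omega, e.to ?_⟩
  rw [h.2.2 _ _ _ hS, hS.input]
  simp

theorem Decides.not {d : ℕ} {c : Cmd} {φ : Word → (ℕ → ℕ) → Prop} (h : Decides d c φ) :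
    Decides d (.seq c (.ite 1 fun o => .push 1 (o.elim true (! ·)))) fun w v => ¬ φ w v := by
  classical
  obtain ⟨q, h⟩ := h
  refine ⟨q + Polynomial.C 2, fun w v S hS => ?_⟩
  obtain ⟨t, ht, hE⟩ := h w v S hS
  have s1 := hS.scratch 1 (by omega) (by omega)
  refine ⟨_, ?_, (hE.seq (Cmd.Exec.ite_of (.push 1 (! decide (φ w v)) _) (by simp) rfl)).to ?_⟩
  · simp; omega
  · simp

theorem Decides.and {d : ℕ} {c c' : Cmd} {φ ψ : Word → (ℕ → ℕ) → Prop} (h : Decides d c φ)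
    (h' : Decides d c' ψ) :
    Decides d (.seq c (.ite 1 fun o => if o = some true then c' else .push 1 false))
      fun w v => φ w v ∧ ψ w v := by
  classical
  obtain ⟨q, h⟩ := h
  obtain ⟨q', h'⟩ := h'
  refine ⟨q + q' + Polynomial.C 2, fun w v S hS => ?_⟩
  obtain ⟨t, ht, hE⟩ := h w v S hS
  obtain ⟨t', ht', hE'⟩ := h' w v S hS
  have s1 := hS.scratch 1 (by omega) (by omega)
  have s1' : update S 1 [] = S := by rw [← s1, update_eq_self]
  by_cases hφ : φ w v
  · refine ⟨_, ?_, (hE.seq (Cmd.Exec.ite_of hE' (by simp [hφ]) (by simp [s1']))).to ?_⟩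
    · simp; omega
    · simp [hφ]
  · refine ⟨_, ?_, (hE.seq (Cmd.Exec.ite_of (.push 1 false _) (by simp [hφ]) rfl)).to ?_⟩
    · simp; omega
    · simp [hφ]

/-- The search for a number up to the length of the input that satisfies a condition. -/
def Cmd.search (d : ℕ) (c : Cmd) : Cmd :=
  .seq (.push (8 + 3 * d) true) (.seq (.copy 0 (8 + 3 * d))
    (.seq (.loop (8 + 3 * d) fun _ => .seq c (.seq
      (.ite 1 fun o => if o = some true then .push (9 + 3 * d) true else .skip)
      (.push (7 + 3 * d) true)))
    (.seq (.loop (7 + 3 * d) fun _ => .skip)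
      (.ite (9 + 3 * d) fun o => o.elim (.push 1 false) fun _ =>
        .seq (.loop (9 + 3 * d) fun _ => .skip) (.push 1 true)))))

theorem Cmd.exec_clear (k : ℕ) (S : Store) :
    ∃ t, (Cmd.loop k fun _ => .skip).Exec S (update S k []) t ∧ t ≤ (S k).length * 2 + 1 := by
  obtain ⟨S', t, h1, h2, rfl⟩ := Cmd.exec_loop (k := k) (c := fun _ => .skip) (T := 1)
    (fun l S' => S' = update S k l) (by rintro l S' rfl; simp)
    (by rintro b l S' rfl; exact ⟨_, _, .skip _, le_rfl, by simp⟩) (S k) S (by simp)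
  exact ⟨t, h1, h2⟩

theorem Decides.search {d : ℕ} {c : Cmd} {φ : Word → (ℕ → ℕ) → Prop} (h : Decides (d + 1) c φ) :
    Decides d (.search d c) fun w v => ∃ i ≤ w.length, φ w (update v d i) := by
  classical
  obtain ⟨q, h⟩ := h
  refine ⟨(Polynomial.X + 1) * (q + Polynomial.C 10) + Polynomial.C 20 * Polynomial.X +
    Polynomial.C 30, fun w v S hS => ?_⟩
  have s1 := hS.scratch 1 (by omega) (by omega)
  have s3 := hS.scratch 3 (by omega) (by omega)
  have sa := hS.rest (7 + 3 * d) (by omega)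
  have sb := hS.rest (8 + 3 * d) (by omega)
  have sc := hS.rest (9 + 3 * d) (by omega)
  obtain ⟨a, ha⟩ : ∃ a, a = 7 + 3 * d := ⟨_, rfl⟩
  obtain ⟨b, hb⟩ : ∃ b, b = 8 + 3 * d := ⟨_, rfl⟩
  obtain ⟨e, he⟩ : ∃ e, e = 9 + 3 * d := ⟨_, rfl⟩
  have hv : update v d 0 = v := by
    rw [← hS.zero d le_rfl, update_eq_self]
  unfold Cmd.search
  rw [← ha, ← hb, ← he]
  rw [← ha] at sa
  rw [← hb] at sb
  rw [← he] at sc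
  have dab : a ≠ b := by omega
  have dae : a ≠ e := by omega
  have dbe : b ≠ e := by omega
  have a1 : a ≠ 1 := by omega
  have b1 : b ≠ 1 := by omega
  have e1 : e ≠ 1 := by omega
  obtain ⟨t₁, e₁, b₁⟩ := Cmd.exec_copy (k := 0) (j := b) (by omega) (by omega) (by omega)
    (S := update S b [true]) (by rw [update_of_ne (by omega), s3])
  have h0 : (0 : ℕ) ≠ b := by omega
  simp only [h0, ne_eq, not_false_eq_true, update_of_ne, update_self, update_idem, hS.input]
    at e₁ b₁
  obtain ⟨S₂, t₂, e₂, b₂, i, n, hi, hn, hni, rfl⟩ := Cmd.exec_loop (k := b)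
    (c := fun _ => .seq c (.seq
      (.ite 1 fun o => if o = some true then .push e true else .skip) (.push a true)))
    (T := q.eval w.length + 3)
    (fun l S' => ∃ i n, i + l.length = w.length + 1 ∧ (0 < n ↔ ∃ j < i, φ w (update v d j)) ∧
      n ≤ i ∧ S' = update (update (update S b l) a (List.replicate i true)) e
        (List.replicate n true))
    (by rintro l S' ⟨i, n, _, _, _, rfl⟩; simp [dab.symm, dbe])
    (by
      rintro x l S' ⟨i, n, hi, hn, hni, rfl⟩
      rw [List.length_cons] at hi
      have hL : Layout (d + 1) w (update v d i) (update (update (update S b l) a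
          (List.replicate i true)) e (List.replicate n true)) := by
        refine ⟨?_, fun k h1 h2 => ?_, fun r hr => ?_, fun r => ?_, fun r hr => ?_, fun k hk => ?_⟩
        · rw [update_of_ne (by omega), update_of_ne (by omega), update_of_ne (by omega), hS.input]
        · rw [update_of_ne (by omega), update_of_ne (by omega), update_of_ne (by omega),
            hS.scratch k h1 h2]
        · rw [update_of_ne (by omega)]
          by_cases h : r = d
          · subst h
            rw [← ha]
            simp
          · rw [update_of_ne (by omega), update_of_ne (by omega), update_of_ne h,
              hS.reg r (by omega)]
        · by_cases h : r = d
          · subst h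
            simp
            omega
          · rw [update_of_ne h]
            exact hS.le r
        · rw [update_of_ne (by omega)]
          exact hS.zero r (by omega)
        · rw [update_of_ne (by omega), update_of_ne (by omega), update_of_ne (by omega),
            hS.rest k (by omega)]
      obtain ⟨t, ht, hE⟩ := h _ _ _ hL
      have hupd : update (update (update (update S b (x :: l)) a (List.replicate i true)) e
          (List.replicate n true)) b l = update (update (update S b l) a (List.replicate i true)) e
          (List.replicate n true) := by
        clear hE hL hn h e₁ hv ha hb he
        funext j
        simp only [update_apply]
        split_ifs <;> simp_all
      rw [hupd]
      by_cases hφ : φ w (update v d i)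
      · refine ⟨_, _, hE.seq ((Cmd.Exec.ite_of (.push e true _) (by simp [hφ]) rfl).seq
          (.push a true _)), by omega, i + 1, n + 1, by omega, ?_, by omega, ?_⟩
        · exact ⟨fun _ => ⟨i, by omega, hφ⟩, fun _ => by omega⟩
        · clear hE hL hupd h hn hφ e₁ hv ha hb he
          funext j
          simp only [update_apply]
          split_ifs <;> simp_all [List.replicate_succ]
      · refine ⟨_, _, hE.seq ((Cmd.Exec.ite_of (.skip _) (by simp [hφ]) rfl).seq
          (.push a true _)), by omega, i + 1, n, by omega, ?_, by omega, ?_⟩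
        · rw [hn]
          constructor
          · rintro ⟨j, hj, h'⟩
            exact ⟨j, by omega, h'⟩
          · rintro ⟨j, hj, h'⟩
            refine ⟨j, ?_, h'⟩
            have : j ≠ i := by rintro rfl; exact hφ h'
            omega
        · clear hE hL hupd h hn hφ e₁ hv ha hb he
          funext j
          simp only [update_apply]
          split_ifs <;> simp_all [List.replicate_succ])
    (List.replicate w.length true ++ [true])
    (update S b (List.replicate w.length true ++ [true])) ⟨0, 0, by simp, by simp, le_rfl, by
      clear h e₁ hv ha hb he
      funext j
      simp only [update_apply]
      split_ifs <;> simp_all⟩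
  simp only [List.length_append, List.length_replicate, List.length_singleton, List.length_nil,
    add_zero] at hi b₂
  subst hi
  obtain ⟨t₃, e₃, b₃⟩ := Cmd.exec_clear a (update (update (update S b []) a
    (List.replicate (w.length + 1) true)) e (List.replicate n true))
  rw [update_of_ne dae, update_self, List.length_replicate] at b₃
  have hfin : ∃ t ≤ 2 * w.length + 6, (Cmd.ite e fun o => o.elim (.push 1 false) fun _ =>
      .seq (.loop e fun _ => .skip) (.push 1 true)).Exec (update (update (update (update S b []) a
      (List.replicate (w.length + 1) true)) e (List.replicate n true)) a [])
      (update S 1 [decide (0 < n)]) t := by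
    rcases n with _ | n
    · refine ⟨2, by omega, (Cmd.Exec.ite_of (.push 1 false _) ?_ rfl).to ?_⟩
      · rw [update_of_ne dae.symm, update_self]
        rfl
      · clear e₂ e₃ e₁ h hn hni b₃ hv ha hb he
        funext j
        simp only [update_apply]
        split_ifs <;> simp_all
    · obtain ⟨t₄, e₄, b₄⟩ := Cmd.exec_clear e (update (update (update S b []) a []) e
        (List.replicate n true))
      rw [update_self, List.length_replicate] at b₄
      refine ⟨_, ?_, (Cmd.Exec.ite_of (e₄.seq (.push 1 true _)) ?_ ?_).to ?_⟩
      · omega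
      · rw [update_of_ne dae.symm, update_self]
        rfl
      · clear e₂ e₃ e₄ e₁ h hn hni b₃ b₄ hv ha hb he
        funext j
        simp only [update_apply]
        split_ifs <;> simp_all [List.replicate_succ]
      · clear e₂ e₃ e₄ e₁ h hn hni b₃ b₄ hv ha hb he
        funext j
        simp only [update_apply]
        split_ifs <;> simp_all
  obtain ⟨t₄, b₄, e₄⟩ := hfin
  have hiff : (∃ i ≤ w.length, φ w (update v d i)) ↔ 0 < n := by
    rw [hn]
    exact exists_congr fun i => and_congr_left fun _ => Nat.lt_succ_iff.symm
  refine ⟨_, ?_, ((Cmd.Exec.push b true S).seq ((Cmd.Exec.to' e₁ ?_).seq (e₂.seq (e₃.seq e₄)))).to ?_⟩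
  · simp only [Polynomial.eval_add, Polynomial.eval_mul, Polynomial.eval_C, Polynomial.eval_X,
      Polynomial.eval_one]
    have : (w.length + 1) * (q.eval w.length + 3 + 1) ≤ (w.length + 1) * (q.eval w.length + 10) :=
      Nat.mul_le_mul_left _ (by omega)
    omega
  · rw [sb]
  · simp only [hiff]

theorem holds_reg (d : ℕ) : Holds (d + 1) (7 + 3 * d) fun w v => min (v d) w.length := by
  refine ⟨Or.inr (by omega), by omega, fun w v S hS => ?_⟩
  simp [hS.reg d (by omega), hS.le d]

theorem decides_of_fo {α : Type} [Ctx α] {φ : α → Prop} (h : FO φ) :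
    ∀ (d : ℕ) (u : Word → (ℕ → ℕ) → α), (∀ w v, N (u w v) = w.length) →
      (∀ f ∈ Ctx.num (α := α), ∃ k, Holds d k fun w v => f (u w v)) →
      (∀ R ∈ Ctx.rel (α := α), ∀ w v i j, R (u w v) i j = w.getD i false) →
      ∃ c, Decides d c fun w v => φ (u w v) := by
  induction h with
  | add hf hg hh =>
    intro d u _ hn _
    obtain ⟨k₁, h₁⟩ := hn _ hf
    obtain ⟨k₂, h₂⟩ := hn _ hg
    obtain ⟨k₃, h₃⟩ := hn _ hh
    exact ⟨_, decides_add h₁ h₂ h₃⟩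
  | mul hf hg hh =>
    intro d u _ hn _
    obtain ⟨k₁, h₁⟩ := hn _ hf
    obtain ⟨k₂, h₂⟩ := hn _ hg
    obtain ⟨k₃, h₃⟩ := hn _ hh
    exact ⟨_, decides_mul h₁ h₂ h₃⟩
  | rel hR hf hg =>
    intro d u _ hn hr
    obtain ⟨k₁, h₁⟩ := hn _ hf
    exact ⟨_, (decides_bit h₁).congr fun w v _ _ => by beta_reduce; rw [hr _ hR]⟩
  | not _ ih =>
    intro d u hN hn hr
    obtain ⟨c, hc⟩ := ih d u hN hn hr
    exact ⟨_, hc.not⟩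
  | and _ _ ih ih' =>
    intro d u hN hn hr
    obtain ⟨c, hc⟩ := ih d u hN hn hr
    obtain ⟨c', hc'⟩ := ih' d u hN hn hr
    exact ⟨_, hc.and hc'⟩
  | @ex α _ φ _ ih =>
    intro d u hN hn hr
    obtain ⟨c, hc⟩ := ih (d + 1)
      (fun w v => ⟨u w (update v d 0), min (v d) w.length, (hN _ _).symm ▸ min_le_right _ _⟩)
      (fun w v => hN _ _) (by
        rintro f (rfl | ⟨f, hf, rfl⟩)
        · exact ⟨_, holds_reg d⟩
        · obtain ⟨k, hk⟩ := hn f hf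
          exact ⟨k, hk.succ⟩) (by
        rintro R ⟨R, hR, rfl⟩ w v i j
        exact hr R hR _ _ _ _)
    refine ⟨_, hc.search.congr fun w v _ hz => ?_⟩
    have hv : update v d 0 = v := by rw [← hz d le_rfl, update_eq_self]
    simp only [update_idem, hv, update_self]
    constructor
    · rintro ⟨i, hi, h⟩
      rw [hN] at hi
      refine ⟨i, hi, ?_⟩
      simpa only [min_eq_left hi] using h
    · rintro ⟨i, hi, h⟩
      refine ⟨i, (hN w v).symm ▸ hi, ?_⟩
      simpa only [min_eq_left hi] using h

/-- First-order definable languages are decidable in polynomial time. -/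
theorem mem_P_of_fo {φ : Word → Prop} (h : FO φ) : {w | φ w} ∈ P := by
  classical
  obtain ⟨c, q, hc⟩ := decides_of_fo h 0 (fun w _ => w) (fun _ _ => rfl) (by
    rintro f rfl
    refine ⟨0, Or.inl rfl, by omega, fun w v S hS => ?_⟩
    rw [hS.input]) (by
    rintro R rfl w v i j
    rfl)
  refine mem_P_of_exec (.seq c (.loop 0 fun _ => .skip))
    (q + Polynomial.C 2 * Polynomial.X + Polynomial.C 1) (fun w => decide (φ w)) (by simp)
    fun w => ?_
  obtain ⟨t, ht, e⟩ := hc w (fun _ => 0) (Store.single 0 w) ⟨by simp [Store.single],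
    fun k h _ => by simp [Store.single]; omega, fun r hr => absurd hr (Nat.not_lt_zero r),
    fun _ => Nat.zero_le _, fun _ _ => rfl, fun k h => by simp [Store.single]; omega⟩
  obtain ⟨t', e', b'⟩ := Cmd.exec_clear 0 (update (Store.single 0 w) 1 [decide (φ w)])
  rw [update_of_ne (by decide)] at b'
  refine ⟨_, ?_, (e.seq e').to ?_⟩
  · simp [Store.single] at b' ⊢
    omega
  · funext k
    by_cases h0 : k = 0 <;> by_cases h1 : k = 1 <;> simp [Store.single, h0, h1]

end StackProgram

/-! ### Second-order definability and the polynomial hierarchy -/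

namespace Definability

open Complexity StackProgram

instance {α : Type} [Ctx α] (ok : α → Prop) : Ctx {a // ok a} where
  N p := N p.1
  num := {g | ∃ f ∈ Ctx.num, g = fun p => f p.1}
  rel := {g | ∃ R ∈ Ctx.rel, g = fun p => R p.1}
  num_le := by
    rintro f ⟨f, hf, rfl⟩ p
    exact Ctx.num_le f hf p.1

instance {α : Type} [Ctx α] (r : ℕ) : Ctx (α × (Fin r → Rel)) where
  N p := N p.1
  num := {g | ∃ f ∈ Ctx.num, g = fun p => f p.1}
  rel := {g | ∃ R ∈ Ctx.rel, g = fun p => R p.1} ∪ {g | ∃ j, g = fun p => p.2 j}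
  num_le := by
    rintro f ⟨f, hf, rfl⟩ p
    exact Ctx.num_le f hf p.1

theorem Ren.val {α : Type} [Ctx α] (ok : α → Prop) : Ren (Subtype.val : {a // ok a} → α) :=
  ⟨fun _ => rfl, fun f h => ⟨f, h, rfl⟩, fun R h => ⟨R, h, rfl⟩⟩

theorem FO.val {α : Type} [Ctx α] {ok : α → Prop} {φ : {a // ok a} → Prop} (h : FO φ) :
    ∃ ψ : α → Prop, FO ψ ∧ ∀ a, ψ a.1 ↔ φ a := by
  refine h.interp (s := Subtype.val) (t := id) ⟨fun _ => le_rfl, ?_, ?_, ?_⟩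
  · exact ⟨_, Term.bound, fun _ _ _ => Iff.rfl⟩
  · rintro f ⟨f, hf, rfl⟩
    exact ⟨_, Term.num hf, fun _ _ _ => Iff.rfl⟩
  · rintro R ⟨R, hR, rfl⟩
    exact ⟨_, RelIn.reader hR, fun _ _ _ _ _ _ _ => Iff.rfl⟩

theorem SO.interp {full : Bool} {α : Type} [Ctx α] {φ : α → Prop} (h : SO full φ) :
    ∀ {γ δ : Type} [Ctx δ] {s : γ → δ} {t : γ → α}, Interp s t →
      ∃ ψ : δ → Prop, SO full ψ ∧ ∀ c, ψ (s c) ↔ φ (t c) := by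
  have aux : ∀ {α γ δ : Type} [Ctx α] [Ctx δ] {s : γ → δ} {t : γ → α}, Interp s t →
      Interp (fun p : γ × Rel => (s p.1, p.2)) (fun p => (t p.1, p.2)) := by
    intro α γ δ _ _ s t H
    refine ⟨fun c => H.N_le _, ?_, ?_, ?_⟩
    · obtain ⟨ψ, h, e⟩ := H.N
      exact ⟨_, h.ren (Ren.fst (α := δ)).ren_ext, fun c i hi => e c.1 i hi⟩
    · rintro f ⟨f, hf, rfl⟩
      obtain ⟨ψ, h, e⟩ := H.num f hf
      exact ⟨_, h.ren (Ren.fst (α := δ)).ren_ext, fun c i hi => e c.1 i hi⟩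
    · rintro R (rfl | ⟨R, hR, rfl⟩)
      · exact ⟨_, RelIn.snd, fun _ _ _ _ _ _ _ => Iff.rfl⟩
      · obtain ⟨ψ, h, e⟩ := H.rel R hR
        exact ⟨_, h.ren (Ren.fst (α := δ)).ren_ext.ren_ext, fun c i hi j hj => e c.1 i hi j hj⟩
  induction h with
  | fo h =>
    intro γ δ _ s t H
    obtain ⟨ψ, h, e⟩ := h.interp H
    exact ⟨ψ, .fo h, e⟩
  | ex _ ih =>
    intro γ δ _ s t H
    obtain ⟨ψ, h, e⟩ := ih (aux H)
    exact ⟨_, h.ex, fun c => exists_congr fun Y => e (c, Y)⟩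
  | all hf _ ih =>
    intro γ δ _ s t H
    obtain ⟨ψ, h, e⟩ := ih (aux H)
    exact ⟨_, h.all hf, fun c => forall_congr' fun Y => e (c, Y)⟩

/-- Maps between contexts under which the readers and the relations become definable. -/
structure Def {α γ : Type} [Ctx α] [Ctx γ] (t : γ → α) : Prop where
  N_le : ∀ c, N (t c) ≤ N c
  N : Term fun c => N (t c)
  num : ∀ f ∈ Ctx.num (α := α), Term fun c => f (t c)
  rel : ∀ R ∈ Ctx.rel (α := α), FO fun p : Ext (Ext γ) =>
    p.a.i ≤ Ctx.N (t p.a.a) → p.i ≤ Ctx.N (t p.a.a) → R (t p.a.a) p.a.i p.i = true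

section
variable {α β γ : Type} [Ctx α] [Ctx β] [Ctx γ]

theorem Def.interp {t : γ → α} (h : Def t) : Interp id t :=
  ⟨h.N_le, ⟨_, h.N, fun _ _ _ => Iff.rfl⟩, fun f hf => ⟨_, h.num f hf, fun _ _ _ => Iff.rfl⟩,
    fun R hR => ⟨_, h.rel R hR, fun c i hi j hj h1 h2 => by simp_all⟩⟩

theorem FO.def {φ : α → Prop} (h : FO φ) {t : γ → α} (ht : Def t) : FO fun c => φ (t c) := by
  obtain ⟨ψ, hψ, e⟩ := h.interp ht.interp
  exact hψ.congr fun c => (e c).symm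

theorem SO.def {full : Bool} {φ : α → Prop} (h : SO full φ) {t : γ → α} (ht : Def t) :
    SO full fun c => φ (t c) := by
  obtain ⟨ψ, hψ, e⟩ := h.interp ht.interp
  exact hψ.congr fun c => (e c).symm

theorem Def.fo_ext {φ : Ext α → Prop} (h : FO φ) {t : γ → α} (ht : Def t) :
    FO fun p : Ext γ => ∃ hi : p.i ≤ Ctx.N (t p.a), φ ⟨t p.a, p.i, hi⟩ := by
  obtain ⟨ψ, hψ, e⟩ := h.interp ht.interp.ext
  refine ((FO.le Num.v0 ht.N.w).and hψ).congr fun p => ?_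
  constructor
  · rintro ⟨hi, h⟩
    exact ⟨hi, (e ⟨(p.a, p.i), hi⟩).2 h⟩
  · rintro ⟨hi, h⟩
    exact ⟨hi, (e ⟨(p.a, p.i), hi⟩).1 h⟩

theorem Def.fo_ext₂ {φ : Ext (Ext α) → Prop} (h : FO φ) {t : γ → α} (ht : Def t) :
    FO fun p : Ext (Ext γ) => ∃ (hi : p.a.i ≤ Ctx.N (t p.a.a)) (hj : p.i ≤ Ctx.N (t p.a.a)),
      φ ⟨⟨t p.a.a, p.a.i, hi⟩, p.i, hj⟩ := by
  obtain ⟨ψ, hψ, e⟩ := h.interp ht.interp.ext.ext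
  refine ((FO.le Num.v0.w ht.N.w.w).and ((FO.le Num.v0 ht.N.w.w).and hψ)).congr fun p => ?_
  constructor
  · rintro ⟨hi, hj, h⟩
    exact ⟨hi, hj, (e ⟨(⟨(p.a.a, p.a.i), hi⟩, p.i), hj⟩).2 h⟩
  · rintro ⟨hi, hj, h⟩
    exact ⟨hi, hj, (e ⟨(⟨(p.a.a, p.a.i), hi⟩, p.i), hj⟩).1 h⟩

theorem Def.term {t : γ → α} (ht : Def t) {f : α → ℕ} (hf : Num f) : Term fun c => f (t c) :=
  (ht.fo_ext hf.term).congr fun p => by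
    constructor
    · intro h
      exact ⟨h ▸ hf.le _, h⟩
    · rintro ⟨_, h⟩
      exact h

theorem Def.comp {t : γ → α} (ht : Def t) {k : β → γ} (hk : Def k) : Def fun b => t (k b) := by
  refine ⟨fun b => (ht.N_le _).trans (hk.N_le b), hk.term ⟨ht.N, ht.N_le⟩, fun f hf => hk.term
    ⟨ht.num f hf, fun c => (Ctx.num_le f hf _).trans (ht.N_le c)⟩, fun R hR => ?_⟩
  have hN := hk.term ⟨ht.N, ht.N_le⟩
  refine ((FO.le Num.v0.w hN.w.w).imp ((FO.le Num.v0 hN.w.w).imp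
    (hk.fo_ext₂ (ht.rel R hR)))).congr fun p => ?_
  refine forall_congr' fun hi => forall_congr' fun hj => ?_
  have := ht.N_le (k p.a.a)
  constructor
  · intro h
    exact ⟨hi.trans this, hj.trans this, fun _ _ => h⟩
  · rintro ⟨_, _, h⟩
    exact h hi hj

theorem Def.of_ren {t : γ → α} (ht : Ren t) : Def t :=
  ⟨fun c => (ht.N_eq c).le, Term.bound.congr ht.N_eq, fun f hf => .num (ht.num f hf),
    fun R hR => (RelIn.reader (ht.rel R hR)).congr fun p => by
      have h1 := p.a.le
      have h2 : p.i ≤ Ctx.N p.a.a := p.le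
      simp [ht.N_eq, h1, h2]⟩

end

/-! #### Pairs of words -/

/-- The bit string whose self-delimiting code starts a bit string. -/
def readName : Word → Word
  | true :: b :: r => b :: readName r
  | [true] => [false]
  | _ => []

theorem readName_delimit (x y : Word) : readName (delimit x ++ y) = x := by
  induction x with
  | nil => simp [delimit, readName]
  | cons b x ih => simpa [delimit, readName] using ih

theorem delimit_length (x : Word) : (delimit x).length = 2 * x.length + 1 := by
  induction x with
  | nil => rfl
  | cons b x ih => simp [delimit] at ih ⊢; omega

theorem readName_spec (W : Word) : W.getD (2 * (readName W).length) false = false ∧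
    ∀ j < (readName W).length, W.getD (2 * j) false = true ∧
      (readName W).getD j false = W.getD (2 * j + 1) false := by
  fun_induction readName W with
  | case1 b r ih =>
    obtain ⟨h1, h2⟩ := ih
    refine ⟨by simpa [Nat.mul_add] using h1, fun j hj => ?_⟩
    rcases j with _ | j
    · simp
    · simpa [Nat.mul_add] using h2 j (by simpa using hj)
  | case2 => simp
  | case3 W h1 h2 =>
    refine ⟨?_, by simp⟩
    match W, h1, h2 with
    | [], _, _ => rfl
    | false :: r, _, _ => rfl
    | [true], _, h2 => exact absurd rfl h2
    | true :: b :: r, h1, _ => exact absurd rfl (h1 b r)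

theorem getD_true_lt {W : Word} {i : ℕ} (h : W.getD i false = true) : i < W.length := by
  by_contra hlt
  rw [List.getD_eq_default _ _ (by omega)] at h
  exact absurd h (by simp)

theorem readName_length_le (W : Word) : (readName W).length ≤ W.length := by
  by_contra h
  have := getD_true_lt ((readName_spec W).2 W.length (by omega)).1
  rcases W with _ | ⟨b, W⟩
  · simp [readName] at h
  · simp at this
    omega

theorem readName_length_eq_iff (W : Word) (i : ℕ) : (readName W).length = i ↔
    W.getD (2 * i) false = false ∧ ∀ j < i, W.getD (2 * j) false = true := by
  obtain ⟨h1, h2⟩ := readName_spec W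
  constructor
  · rintro rfl
    exact ⟨h1, fun j hj => (h2 j hj).1⟩
  · rintro ⟨h3, h4⟩
    rcases lt_trichotomy (readName W).length i with h | h | h
    · exact absurd (h1.symm.trans (h4 _ h)) (by simp)
    · exact h
    · exact absurd (h3.symm.trans (h2 i h).1) (by simp)

theorem readName_getD (W : Word) (i : ℕ) : (readName W).getD i false = true ↔
    i < (readName W).length ∧ W.getD (2 * i + 1) false = true := by
  constructor
  · intro h
    have := getD_true_lt h
    exact ⟨this, ((readName_spec W).2 i this).2 ▸ h⟩
  · rintro ⟨h, h'⟩
    rw [((readName_spec W).2 i h).2, h']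

theorem getD_drop (W : Word) (i j : ℕ) : (W.drop i).getD j false = W.getD (i + j) false := by
  simp [List.getD_eq_getElem?_getD]

theorem Num.congr {α : Type} [Ctx α] {f g : α → ℕ} (h : Num f) (e : ∀ a, g a = f a) : Num g := by
  rwa [show g = f from funext e]

section
variable {α : Type} [Ctx α]

theorem Term.sub {f g : α → ℕ} (hf : Num f) (hg : Term g) : Num fun a => f a - g a :=
  ⟨Term.of (ψ := fun a n => n + g a = f a ∨ (f a ≤ g a ∧ n = 0))
    ((FO.eq (Num.v0.term.add hg.w) hf.w).or ((FO.le hf.w hg.w).and (FO.eq Num.v0.term .zero)))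
    fun a n _ => by omega, fun a => (Nat.sub_le _ _).trans (hf.le a)⟩

theorem WordIn.drop {u : α → Word} (hu : WordIn u) {f : α → ℕ} (hf : Term f) :
    WordIn fun a => (u a).drop (f a) :=
  ⟨(FO.bit hu.w (hf.w.add Num.v0.term)).congr fun p => by rw [getD_drop],
    (Term.sub hu.len hf).congr fun a => by simp⟩

theorem WordIn.readName {u : α → Word} (hu : WordIn u) : WordIn fun a => readName (u a) := by
  have hl : Num fun a => (Definability.readName (u a)).length := by
    refine ⟨Term.of (ψ := fun a n => ¬ (u a).getD (2 * n) false = true ∧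
        ∀ j ≤ N a, j < n → (u a).getD (2 * j) false = true)
      ((FO.bit hu.w ((Term.const 2).mul Num.v0.term)).not.and (FO.forall_le
        ((FO.lt Num.v0.term Num.v0.w).imp (FO.bit hu.w.w ((Term.const 2).mul Num.v0.term)))))
      fun a n hn => ?_, fun a => (readName_length_le _).trans (hu.len.le a)⟩
    rw [readName_length_eq_iff, Bool.not_eq_true]
    exact and_congr_right fun _ => ⟨fun h j hj => h j (by omega) hj, fun h j _ hj => h j hj⟩
  refine ⟨((FO.lt Num.v0.term hl.w).and
    (FO.bit hu.w (((Term.const 2).mul Num.v0.term).add .one))).congr fun p => ?_, hl⟩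
  rw [readName_getD]

end

theorem wordIn_word : WordIn fun w : Word => w :=
  ⟨(FO.rel (R := fun p : Ext Word => fun i _ => p.a.getD i false) ⟨_, rfl, rfl⟩ num_i num_i),
    .reader rfl⟩

/-- The part of a bit string after the self-delimiting code at its beginning. -/
def readRest (W : Word) : Word := W.drop (2 * (readName W).length + 1)

theorem readName_pair (x y : Word) : readName (pair x y) = x := readName_delimit x y

theorem readRest_pair (x y : Word) : readRest (pair x y) = y := by
  rw [readRest, readName_pair, pair, ← delimit_length, List.drop_left]

theorem WordIn.readRest {α : Type} [Ctx α] {u : α → Word} (hu : WordIn u) :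
    WordIn fun a => readRest (u a) :=
  hu.drop (((Term.const 2).mul hu.readName.len.term).add .one)

theorem def_of_word {γ : Type} [Ctx γ] {u : γ → Word} (hu : WordIn u) : Def u :=
  ⟨hu.len.le, hu.len.term, by rintro f rfl; exact hu.len.term, by
    rintro R rfl
    exact ((FO.le Num.v0.w hu.len.term.w.w).imp ((FO.le Num.v0 hu.len.term.w.w).imp
      (FO.bit hu.w.w Num.v0.w.term)))⟩

/-! #### Relations as parts of certificates -/

/-- The relation number `j` on the numbers up to `n` that is coded by a bit string. -/
def decodeRel (y : Word) (n j : ℕ) : Rel := fun a b =>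
  y.getD ((j * (n + 1) + a) * (n + 1) + b) false

theorem exists_decodeRel (n r : ℕ) (Ys : Fin r → Rel) : ∃ y : Word,
    y.length = r * (n + 1) * (n + 1) ∧ ∀ j : Fin r, ∀ a ≤ n, ∀ b ≤ n, ∀ z : Word,
      decodeRel (y ++ z) n j a b = Ys j a b := by
  refine ⟨List.ofFn (n := r * (n + 1) * (n + 1)) fun i => Ys ⟨i / (n + 1) / (n + 1), ?_⟩
    (i / (n + 1) % (n + 1)) (i % (n + 1)), by simp, ?_⟩
  · have := i.2
    rw [Nat.div_div_eq_div_mul, Nat.div_lt_iff_lt_mul (by positivity), ← mul_assoc]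
    exact this
  · intro j a ha b hb z
    have h1 : j * (n + 1) + a < r * (n + 1) := by
      have := Nat.mul_le_mul_right (n + 1) (Nat.succ_le_of_lt j.2)
      rw [Nat.succ_mul] at this
      omega
    have h2 : (j * (n + 1) + a) * (n + 1) + b < r * (n + 1) * (n + 1) := by
      have := Nat.mul_le_mul_right (n + 1) (Nat.succ_le_of_lt h1)
      rw [Nat.succ_mul] at this
      omega
    have e1 : ((j * (n + 1) + a) * (n + 1) + b) / (n + 1) = j * (n + 1) + a := by
      rw [add_comm, Nat.add_mul_div_right _ _ (by omega), Nat.div_eq_of_lt (by omega), zero_add]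
    have e2 : ((j : ℕ) * (n + 1) + a) / (n + 1) = j := by
      rw [add_comm, Nat.add_mul_div_right _ _ (by omega), Nat.div_eq_of_lt (by omega), zero_add]
    have e3 : ((j * (n + 1) + a) * (n + 1) + b) % (n + 1) = b := by
      rw [add_comm, Nat.add_mul_mod_self_right, Nat.mod_eq_of_lt (by omega)]
    have e4 : ((j : ℕ) * (n + 1) + a) % (n + 1) = a := by
      rw [add_comm, Nat.add_mul_mod_self_right, Nat.mod_eq_of_lt (by omega)]
    rw [decodeRel, List.getD_append _ _ _ _ (by simpa using h2), List.getD_eq_getElem _ _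
      (by simpa using h2), List.getElem_ofFn]
    simp only [e1, e2, e3, e4]

theorem Def.decodeRel {α γ : Type} [Ctx α] [Ctx γ] {t : γ → α} (ht : Def t) {u : γ → Word}
    (hu : WordIn u) (r : ℕ) :
    Def fun c => (t c, fun j : Fin r => Definability.decodeRel (u c) (Ctx.N (t c)) j) := by
  refine ⟨ht.N_le, ht.N, ?_, ?_⟩
  · rintro f ⟨f, hf, rfl⟩
    exact ht.num f hf
  · rintro R (⟨R, hR, rfl⟩ | ⟨j, rfl⟩)
    · exact ht.rel R hR
    · have hn : Term fun p : Ext (Ext γ) => Ctx.N (t p.a.a) + 1 := ht.N.w.w.add .one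
      exact (FO.le Num.v0.w ht.N.w.w).imp ((FO.le Num.v0 ht.N.w.w).imp (FO.bit hu.w.w
        ((((Term.const j).mul hn).add Num.v0.w.term).mul hn |>.add Num.v0.term)))

theorem Agree.rels {α : Type} [Ctx α] (a : α) {r : ℕ} {Ys Zs : Fin r → Rel}
    (h : ∀ j, ∀ i ≤ N a, ∀ i' ≤ N a, Ys j i i' = Zs j i i') : Agree (a, Ys) (a, Zs) :=
  ⟨rfl, by rintro f ⟨f, hf, rfl⟩; rfl, by
    rintro R (⟨R, hR, rfl⟩ | ⟨j, rfl⟩)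
    · exact fun _ _ _ _ => rfl
    · exact h j⟩

theorem SO.prenex {α : Type} [Ctx α] {φ : α → Prop} (h : SO false φ) :
    ∃ (r : ℕ) (ψ : α × (Fin r → Rel) → Prop), FO ψ ∧ ∀ a, φ a ↔ ∃ Ys, ψ (a, Ys) := by
  induction h with
  | @fo α _ φ h =>
    refine ⟨0, fun p => φ p.1, h.ren ⟨fun _ => rfl, fun f hf => ⟨f, hf, rfl⟩,
      fun R hR => Or.inl ⟨R, hR, rfl⟩⟩, fun a => by simp⟩
  | @ex α _ φ _ ih =>
    obtain ⟨r, ψ, hψ, e⟩ := ih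
    refine ⟨r + 1, fun p => ψ ((p.1, p.2 0), Fin.tail p.2), hψ.ren ⟨fun _ => rfl, ?_, ?_⟩, ?_⟩
    · rintro f ⟨f, ⟨f, hf, rfl⟩, rfl⟩
      exact ⟨f, hf, rfl⟩
    · rintro R (⟨R, rfl | ⟨R, hR, rfl⟩, rfl⟩ | ⟨j, rfl⟩)
      · exact Or.inr ⟨0, rfl⟩
      · exact Or.inl ⟨R, hR, rfl⟩
      · exact Or.inr ⟨j.succ, rfl⟩
    · intro a
      simp only [e]
      constructor
      · rintro ⟨Y, Ys, h⟩
        exact ⟨Fin.cons Y Ys, by simpa using h⟩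
      · rintro ⟨Ys, h⟩
        exact ⟨_, _, h⟩
  | all hf => exact absurd hf (by simp)

/-- A bit string as a context with a polynomial bound. -/
structure Inp (T : ℕ) where
  word : Word

/-- The bound of the contexts `Inp T`. -/
def Inp.bound (T n : ℕ) : ℕ := (n + T) ^ T

theorem Inp.le_bound {T : ℕ} (hT : T ≠ 0) (n : ℕ) : n + T ≤ Inp.bound T n :=
  Nat.le_self_pow hT _

instance (T : ℕ) [NeZero T] : Ctx (Inp T) where
  N c := Inp.bound T c.word.length
  num := {fun c => c.word.length}
  rel := {fun c i _ => c.word.getD i false}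
  num_le := by
    rintro f rfl c
    exact (Nat.le_add_right _ T).trans (Inp.le_bound (NeZero.ne T) _)

theorem Inp.wordIn (T : ℕ) [NeZero T] : WordIn fun c : Inp T => c.word :=
  ⟨(FO.rel (R := fun p : Ext (Inp T) => fun i _ => p.a.word.getD i false) ⟨_, rfl, rfl⟩
    num_i num_i), .reader rfl⟩

/-- The bit strings that are long enough for the bound of the context coded at their beginning. -/
abbrev Padded (T : ℕ) : Type := {W : Word // Inp.bound T (readName W).length ≤ W.length}

theorem fo_padded (T : ℕ) : FO fun W : Word => Inp.bound T (readName W).length ≤ W.length := by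
  have h : Term fun W : Word => Inp.bound T (readName W).length :=
    (wordIn_word.readName.len.term.add (.const T)).pow T
  exact (FO.subst h (φ := fun _ _ => True) .top).congr fun W => by simp; rfl

theorem def_padded (T : ℕ) [NeZero T] : Def fun W : Padded T => (⟨readName W.1⟩ : Inp T) := by
  have hw : WordIn fun W : Padded T => W.1 := wordIn_word.ren (.val _)
  have h : Term fun W : Padded T => Inp.bound T (readName W.1).length :=
    (hw.readName.len.term.add (.const T)).pow T
  refine ⟨fun W => W.2, h, ?_, ?_⟩
  · rintro f rfl
    exact hw.readName.len.term
  · rintro R rfl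
    exact (FO.le Num.v0.w h.w.w).imp ((FO.le Num.v0 h.w.w).imp
      (FO.bit hw.readName.w.w Num.v0.w.term))

open Polynomial in
/-- Existential second-order definable languages are in NP. -/
theorem mem_NP_of_so {T : ℕ} [NeZero T] {φ : Inp T → Prop} (h : SO false φ) :
    {w | φ ⟨w⟩} ∈ NP := by
  obtain ⟨r, ψ, hψ, e⟩ := h.prenex
  have hw : WordIn fun W : Padded T => W.1 := wordIn_word.ren (.val _)
  obtain ⟨χ, hχ, e'⟩ := (hψ.def ((def_padded T).decodeRel hw.readRest r)).val
  refine ⟨_, mem_P_of_fo ((fo_padded T).and hχ), C r * ((X + C T) ^ T + 1) * ((X + C T) ^ T + 1) +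
    (X + C T) ^ T, fun w => ?_⟩
  simp only [Set.mem_ofPred_eq, e]
  constructor
  · rintro ⟨Ys, h⟩
    obtain ⟨y, hy, hd⟩ := exists_decodeRel (Inp.bound T w.length) r Ys
    have hp : Inp.bound T (readName (pair w (y ++ List.replicate (Inp.bound T w.length)
        false))).length ≤ (pair w (y ++ List.replicate (Inp.bound T w.length) false)).length := by
      rw [readName_pair]
      simp [pair]
      omega
    refine ⟨y ++ List.replicate (Inp.bound T w.length) false, by simp [hy, Inp.bound], hp, ?_⟩
    refine (e' ⟨_, hp⟩).2 ?_
    simp only [readName_pair, readRest_pair]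
    exact (hψ.local (Agree.rels _ fun j i hi i' hi' => hd j i hi i' hi' _)).2 h
  · rintro ⟨y, -, hp, h⟩
    have := (e' ⟨_, hp⟩).1 h
    simp only [readName_pair, readRest_pair] at this
    exact ⟨_, this⟩

open Polynomial in
theorem mem_levels_of_so {full : Bool} {α : Type} [Ctx α] {φ : α → Prop} (h : SO full φ) :
    ∃ k, ∀ t : Word → α, Def t → ∀ k' ≥ k,
      {W | φ (t W)} ∈ SigmaP k' ∧ {W | φ (t W)} ∈ PiP k' := by
  have dfst : Def fun W : Word => readName W := def_of_word wordIn_word.readName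
  have drel : ∀ {α : Type} [Ctx α] {t : Word → α}, Def t → Def fun W : Word =>
      (t (readName W), decodeRel (readRest W) (N (t (readName W))) 0) := by
    intro α _ t ht
    refine (Def.of_ren (t := fun p : α × (Fin 1 → Rel) => (p.1, p.2 0)) ⟨fun _ => rfl, ?_, ?_⟩).comp
      ((ht.comp dfst).decodeRel wordIn_word.readRest 1)
    · rintro f ⟨f, hf, rfl⟩
      exact ⟨f, hf, rfl⟩
    · rintro R (rfl | ⟨R, hR, rfl⟩)
      · exact Or.inr ⟨0, rfl⟩
      · exact Or.inl ⟨R, hR, rfl⟩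
  have agree : ∀ {α : Type} [Ctx α] {φ : α × Rel → Prop}, SO full φ → ∀ {t : Word → α}, Def t →
      ∀ W Y, ∃ y : Word, y.length ≤ ((X + 1) * (X + 1) : Polynomial ℕ).eval W.length ∧
        (φ (t W, Y) ↔ φ (t W, decodeRel y (N (t W)) 0)) := by
    intro α _ φ h t ht W Y
    obtain ⟨y, hy, hd⟩ := exists_decodeRel (N (t W)) 1 fun _ => Y
    refine ⟨y, ?_, h.local ⟨rfl, ?_, ?_⟩⟩
    · have : N (t W) + 1 ≤ W.length + 1 := Nat.succ_le_succ (ht.N_le W)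
      simpa [hy] using Nat.mul_le_mul this this
    · rintro f ⟨f, hf, rfl⟩
      rfl
    · rintro R (rfl | ⟨R, hR, rfl⟩)
      · intro i hi j hj
        have := hd 0 i hi j hj []
        simpa using this.symm
      · exact fun _ _ _ _ => rfl
  have sigma_step : ∀ {α : Type} [Ctx α] {φ : α → Prop} {t : Word → α} {k : ℕ},
      {W | φ (t (readName W))} ∈ PiP k → {W | φ (t W)} ∈ SigmaP (k + 1) := by
    intro α _ φ t k h
    rw [SigmaP]
    exact ⟨_, h, 0, fun x => by
      simp only [Set.mem_ofPred_eq, readName_pair]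
      exact ⟨fun h => ⟨[], by simp, h⟩, fun ⟨_, _, h⟩ => h⟩⟩
  have pi_step : ∀ {α : Type} [Ctx α] {φ : α → Prop} {t : Word → α} {k : ℕ},
      {W | φ (t (readName W))} ∈ SigmaP k → {W | φ (t W)} ∈ PiP (k + 1) := by
    intro α _ φ t k h
    rw [PiP]
    exact ⟨_, h, 0, fun x => by
      simp only [Set.mem_ofPred_eq, readName_pair]
      exact ⟨fun h _ _ => h, fun h => h [] (by simp)⟩⟩
  induction h with
  | @fo α _ φ h =>
    refine ⟨0, fun t ht k' _ => ?_⟩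
    induction k' generalizing t with
    | zero =>
      rw [SigmaP, PiP]
      exact ⟨mem_P_of_fo (h.def ht), mem_P_of_fo (h.def ht)⟩
    | succ k ih =>
      have := ih (fun W => t (readName W)) (ht.comp dfst) (Nat.zero_le _)
      exact ⟨sigma_step this.2, pi_step this.1⟩
  | @ex α _ φ h ih =>
    obtain ⟨k, hk⟩ := ih
    have hs : ∀ t : Word → α, Def t → ∀ k' ≥ k + 1, {W | ∃ Y, φ (t W, Y)} ∈ SigmaP k' := by
      intro t ht k' hk'
      obtain ⟨j, rfl⟩ : ∃ j, k' = j + 1 := ⟨k' - 1, by omega⟩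
      rw [SigmaP]
      refine ⟨_, (hk _ (drel ht) j (by omega)).2, (X + 1) * (X + 1), fun x => ?_⟩
      simp only [Set.mem_ofPred_eq, readName_pair, readRest_pair]
      constructor
      · rintro ⟨Y, hY⟩
        obtain ⟨y, hy, e⟩ := agree h ht x Y
        exact ⟨y, hy, e.1 hY⟩
      · rintro ⟨y, -, h⟩
        exact ⟨_, h⟩
    refine ⟨k + 2, fun t ht k' hk' => ⟨hs t ht k' (by omega), ?_⟩⟩
    obtain ⟨j, rfl⟩ : ∃ j, k' = j + 1 := ⟨k' - 1, by omega⟩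
    exact pi_step (φ := fun a => ∃ Y, φ (a, Y)) (hs _ (ht.comp dfst) j (by omega))
  | @all α _ φ _ h ih =>
    obtain ⟨k, hk⟩ := ih
    have hs : ∀ t : Word → α, Def t → ∀ k' ≥ k + 1, {W | ∀ Y, φ (t W, Y)} ∈ PiP k' := by
      intro t ht k' hk'
      obtain ⟨j, rfl⟩ : ∃ j, k' = j + 1 := ⟨k' - 1, by omega⟩
      rw [PiP]
      refine ⟨_, (hk _ (drel ht) j (by omega)).1, (X + 1) * (X + 1), fun x => ?_⟩
      simp only [Set.mem_ofPred_eq, readName_pair, readRest_pair]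
      constructor
      · intro h y _
        exact h _
      · intro hall Y
        obtain ⟨y, hy, e⟩ := agree h ht x Y
        exact e.2 (hall y hy)
    refine ⟨k + 2, fun t ht k' hk' => ⟨?_, hs t ht k' (by omega)⟩⟩
    obtain ⟨j, rfl⟩ : ∃ j, k' = j + 1 := ⟨k' - 1, by omega⟩
    exact sigma_step (φ := fun a => ∀ Y, φ (a, Y)) (hs _ (ht.comp dfst) j (by omega))

open Polynomial in
/-- Second-order definable languages are in the polynomial hierarchy. -/
theorem mem_PH_of_so {T : ℕ} [NeZero T] {φ : Inp T → Prop} (h : SO true φ) :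
    {w | φ ⟨w⟩} ∈ PH := by
  obtain ⟨ψ, hψ, e⟩ := (h.def (def_padded T)).interp (s := Subtype.val) (t := id)
    ⟨fun _ => le_rfl, ⟨_, Term.bound, fun _ _ _ => Iff.rfl⟩, by
      rintro f ⟨f, hf, rfl⟩
      exact ⟨_, Term.num hf, fun _ _ _ => Iff.rfl⟩, by
      rintro R ⟨R, hR, rfl⟩
      exact ⟨_, RelIn.reader hR, fun _ _ _ _ _ _ _ => Iff.rfl⟩⟩
  obtain ⟨k, hk⟩ := mem_levels_of_so ((SO.fo (fo_padded T)).and hψ)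
  have := (hk _ (Def.of_ren Ren.id) k le_rfl).2
  refine ⟨k + 1, ?_⟩
  rw [SigmaP]
  refine ⟨_, this, (X + C T) ^ T, fun w => ?_⟩
  simp only [Set.mem_ofPred_eq, id]
  constructor
  · intro h
    have hp : Inp.bound T (readName (pair w (List.replicate (Inp.bound T w.length)
        false))).length ≤ (pair w (List.replicate (Inp.bound T w.length) false)).length := by
      rw [readName_pair]
      simp [pair]
    refine ⟨List.replicate (Inp.bound T w.length) false, by simp [Inp.bound], hp, ?_⟩
    refine (e ⟨_, hp⟩).2 ?_
    simpa only [id, readName_pair] using h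
  · rintro ⟨y, -, hp, h⟩
    have := (e ⟨_, hp⟩).1 h
    simpa only [id, readName_pair] using this

end Definability

/-! ### Paths and basic patterns -/

namespace GQL

namespace GPath

theorem last_append {p q : GPath} (h : p.last = q.first) : (p.append q).last = q.last := by
  unfold last at *
  simp only [append, List.map_append, List.getLastD_eq_getLast?, List.getLast?_append] at h ⊢
  cases (List.map Prod.snd q.steps).getLast? with
  | none => simpa using h
  | some a => simp

theorem len_append (p q : GPath) : (p.append q).len = p.len + q.len := by
  simp [len, append]

end GPath

/-- The composition of relations. -/
def relComp {X : Type} (A B : X → X → Prop) (a b : X) : Prop := ∃ c, A a c ∧ B c b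

/-- The composition of `k + 1` copies of a relation. -/
def relPow {X : Type} (A : X → X → Prop) : ℕ → X → X → Prop
  | 0 => A
  | k + 1 => relComp A (relPow A k)

theorem relPow_iff_exists {X : Type} {A : X → X → Prop} {k : ℕ} {a b : X} :
    relPow A k a b ↔ ∃ f : ℕ → X, f 0 = a ∧ f (k + 1) = b ∧ ∀ l ≤ k, A (f l) (f (l + 1)) := by
  induction k generalizing a with
  | zero =>
    constructor
    · intro h
      refine ⟨fun l => if l = 0 then a else b, by simp, by simp, fun l hl => ?_⟩
      obtain rfl : l = 0 := by omega
      simpa using show A a b from h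
    · rintro ⟨f, rfl, rfl, h⟩
      exact h 0 le_rfl
  | succ k ih =>
    simp only [relPow, relComp, ih]
    constructor
    · rintro ⟨c, h, f, rfl, rfl, hf⟩
      refine ⟨fun l => if l = 0 then a else f (l - 1), by simp, by simp, fun l hl => ?_⟩
      rcases l with _ | l
      · simpa using h
      · simpa using hf l (by omega)
    · rintro ⟨f, rfl, rfl, h⟩
      exact ⟨f 1, h 0 (by omega), fun l => f (l + 1), rfl, rfl, fun l hl => h (l + 1) (by omega)⟩

theorem exists_relPow_iff {X : Type} {A : X → X → Prop} {i : ℕ} {a b : X} :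
    (∃ k, i ≤ k ∧ relPow A k a b) ↔ relComp (relPow A i) (Relation.ReflTransGen A) a b := by
  induction i generalizing a with
  | zero =>
    constructor
    · rintro ⟨k, -, h⟩
      induction k generalizing a with
      | zero => exact ⟨b, h, .refl⟩
      | succ k ih =>
        obtain ⟨c, h1, h2⟩ := h
        obtain ⟨d, h3, h4⟩ := ih h2
        exact ⟨c, h1, .head h3 h4⟩
    · rintro ⟨c, h1, h2⟩
      induction h2 using Relation.ReflTransGen.head_induction_on generalizing a with
      | refl => exact ⟨0, le_rfl, h1⟩
      | head h _ ih =>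
        obtain ⟨k, -, hk⟩ := ih h
        exact ⟨k + 1, Nat.zero_le _, _, h1, hk⟩
  | succ i ih =>
    constructor
    · rintro ⟨_ | k, hk, h⟩
      · omega
      · obtain ⟨c, h1, h2⟩ := h
        obtain ⟨d, h3, h4⟩ := ih.1 ⟨k, by omega, h2⟩
        exact ⟨d, ⟨c, h1, h3⟩, h4⟩
    · rintro ⟨d, ⟨c, h1, h2⟩, h3⟩
      obtain ⟨k, hk, h⟩ := ih.2 ⟨d, h2, h3⟩
      exact ⟨k + 1, by omega, c, h1, h⟩

/-- A walk through at most `M` points can be shortened. -/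
theorem relPow_shorten {X : Type} {A : X → X → Prop} (code : X → ℕ) {M : ℕ}
    (hinj : ∀ a b c d, A a b → A c d → code a = code c → a = c)
    (hM : ∀ a b, A a b → code a < M) {i k : ℕ} {a b : X} (hik : i ≤ k) (h : relPow A k a b) :
    ∃ k', i ≤ k' ∧ k' ≤ i + M ∧ k' ≤ k ∧ relPow A k' a b := by
  induction k using Nat.strong_induction_on with
  | _ k ih =>
    by_cases hk : k ≤ i + M
    · exact ⟨k, hik, hk, le_rfl, h⟩
    obtain ⟨f, h0, h1, hf⟩ := relPow_iff_exists.1 h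
    obtain ⟨x, hx, y, hy, hxy, he⟩ := Finset.exists_ne_map_eq_of_card_lt_of_maps_to
      (s := Finset.Ioc i k) (t := Finset.range M) (f := fun l => code (f l)) (by simp; omega)
      (fun l hl => by
        have := hM _ _ (hf l (by simp at hl; omega))
        simpa using this)
    rw [Finset.mem_Ioc] at hx hy
    have hex : f x = f y := hinj _ _ _ _ (hf x (by omega)) (hf y (by omega)) he
    have cut : ∀ x y, i < x → y ≤ k → x < y → f x = f y →
        ∃ k', i ≤ k' ∧ k' ≤ i + M ∧ k' ≤ k ∧ relPow A k' a b := by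
      intro x y hx hy hxy e
      have hc : relPow A (k - (y - x)) a b := by
        refine relPow_iff_exists.2 ⟨fun l => if l ≤ x then f l else f (l + (y - x)), ?_, ?_, ?_⟩
        · simp [h0]
        · beta_reduce
          rw [if_neg (by omega), ← h1]
          congr 1
          omega
        · intro l hl
          beta_reduce
          by_cases hlx : l < x
          · rw [if_pos hlx.le, if_pos (by omega)]
            exact hf l (by omega)
          · by_cases hlx' : l = x
            · subst hlx'
              rw [if_pos le_rfl, if_neg (by omega), e,
                show l + 1 + (y - l) = y + 1 by omega]
              exact hf y hy
            · rw [if_neg (by omega), if_neg (by omega),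
                show l + 1 + (y - x) = l + (y - x) + 1 by omega]
              exact hf _ (by omega)
      obtain ⟨k', h1', h2', h3', h4'⟩ := ih (k - (y - x)) (by omega) (by omega) hc
      exact ⟨k', h1', h2', by omega, h4'⟩
    rcases lt_or_gt_of_ne hxy with hlt | hlt
    · exact cut x y hx.1 hy.2 hlt hex
    · exact cut y x hy.1 hx.2 hlt hex.symm

/-- The concatenations of `k + 1` paths from a set. -/
def pathPow (R : Set GPath) : ℕ → Set GPath
  | 0 => R
  | k + 1 => {r | ∃ p ∈ R, ∃ q ∈ pathPow R k, p.last = q.first ∧ r = p.append q}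

theorem mem_pathPow_iff {R : Set GPath} {k : ℕ} {p : GPath} : p ∈ pathPow R k ↔
    ∃ l : List GPath, l.length = k + 1 ∧ (∀ q ∈ l, q ∈ R) ∧ GPath.Concat l p := by
  induction k generalizing p with
  | zero =>
    constructor
    · intro h
      exact ⟨[p], rfl, by simpa using show p ∈ R from h, .single p⟩
    · rintro ⟨l, hl, h, hc⟩
      cases hc with
      | single => exact h p (by simp)
      | cons _ hc' =>
        cases hc' <;> simp at hl
  | succ k ih =>
    constructor
    · rintro ⟨q, hq, r, hr, e, rfl⟩
      obtain ⟨l, hl, h, hc⟩ := ih.1 hr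
      exact ⟨q :: l, by simp [hl], by simpa [hq] using h, .cons e hc⟩
    · rintro ⟨l, hl, h, hc⟩
      cases hc with
      | single => simp at hl
      | @cons q r l e hc =>
        exact ⟨q, h q (by simp), r, ih.2 ⟨l, by simpa using hl,
          fun q' hq' => h q' (by simp [hq']), hc⟩, e, rfl⟩

theorem mem_iterate_succ {G : PropertyGraph} {R : Set (GPath × Assignment)} {k : ℕ} {p : GPath}
    {μ : Assignment} : (p, μ) ∈ iterate G ∅ R (k + 1) ↔
      μ = Assignment.empty ∧ p ∈ pathPow {p | ∃ μ, (p, μ) ∈ R} k := by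
  rw [mem_pathPow_iff]
  constructor
  · rintro ⟨l, hl, h, hc, -, he⟩
    refine ⟨funext fun x => he x (by simp), l.map Prod.fst, by simpa using hl, ?_, hc⟩
    intro q hq
    obtain ⟨t, ht, rfl⟩ := List.mem_map.1 hq
    exact ⟨t.2, h t ht⟩
  · rintro ⟨rfl, l, hl, h, hc⟩
    choose! f hf using h
    refine ⟨l.map fun q => (q, f q), by simpa using hl, ?_, ?_, by simp, fun _ _ => rfl⟩
    · intro t ht
      obtain ⟨q, hq, rfl⟩ := List.mem_map.1 ht
      exact hf q hq
    · simpa [Function.comp_def] using hc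

/-! #### Domains of the assignments of a pattern -/

/-- The graph elements of the database satisfy a condition. -/
structure Covers {m : ℕ} (good : Value → Prop) (𝒢 : Database m) : Prop where
  node : ∀ g, ∀ n ∈ (𝒢 g).nodes, good (.elem (.node n))
  dir : ∀ g, ∀ e ∈ (𝒢 g).dirEdges, good (.elem (.edge (.directed e)))
  undir : ∀ g, ∀ e ∈ (𝒢 g).undirEdges, good (.elem (.edge (.undirected e)))
  src : ∀ g, ∀ r ∈ (𝒢 g).src, good (.elem (.node r.2))
  tgt : ∀ g, ∀ r ∈ (𝒢 g).tgt, good (.elem (.node r.2))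

/-- All nodes and edges of a path satisfy a condition. -/
def GPath.All (good : Value → Prop) (p : GPath) : Prop :=
  good (.elem (.node p.first)) ∧ ∀ s ∈ p.steps, good (.elem (.edge s.1)) ∧ good (.elem (.node s.2))

theorem GPath.All.append {good : Value → Prop} {p q : GPath} (hp : p.All good) (hq : q.All good) :
    (p.append q).All good :=
  ⟨hp.1, fun s hs => (List.mem_append.1 hs).elim (hp.2 s) (hq.2 s)⟩

/-- The assignment has a given domain and its values satisfy a condition. -/
def Assignment.Over (good : Value → Prop) (S : Finset Var) (μ : Assignment) : Prop :=
  (∀ x ∈ S, ∃ v, good v ∧ μ x = some v) ∧ ∀ x ∉ S, μ x = none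

theorem Assignment.over_bind {good : Value → Prop} {v : Value} (h : good v) (x : Option Var) :
    Assignment.Over good x.toFinset (Assignment.bind x v) := by
  constructor
  · intro y hy
    exact ⟨v, h, by simp_all [Assignment.bind]⟩
  · intro y hy
    simp_all [Assignment.bind]

theorem Assignment.Over.join {good : Value → Prop} {S S' : Finset Var} {μ μ' : Assignment}
    (h : μ.Over good S) (h' : μ'.Over good S') : (μ.join μ').Over good (S ∪ S') := by
  constructor
  · intro x hx
    by_cases hS : x ∈ S
    · obtain ⟨v, hv, e⟩ := h.1 x hS
      exact ⟨v, hv, by simp [Assignment.join, e]⟩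
    · obtain ⟨v, hv, e⟩ := h'.1 x (by simpa [hS] using hx)
      exact ⟨v, hv, by simp [Assignment.join, e, h.2 x hS]⟩
  · intro x hx
    rw [Finset.mem_union, not_or] at hx
    simp [Assignment.join, h.2 x hx.1, h'.2 x hx.2]

theorem Pat.sem_over {m : ℕ} {good : Value → Prop} {𝒢 : Database m} (hc : Covers good 𝒢) :
    ∀ (π : Pat m) (g : Fin m), π.Basic → π.WellFormed → ∀ p μ, (p, μ) ∈ π.sem 𝒢 g →
      p.All good ∧ μ.Over good π.sch
  | .node x l, g, _, _, p, μ, h => by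
    simp only [Pat.sem, Set.mem_ofPred_eq, Prod.mk.injEq] at h
    obtain ⟨n, hn, -, rfl, rfl⟩ := h
    exact ⟨⟨hc.node g n hn, by simp⟩, Assignment.over_bind (hc.node g n hn) x⟩
  | .fwd x l, g, _, _, p, μ, h => by
    simp only [Pat.sem, Set.mem_ofPred_eq, Prod.mk.injEq] at h
    obtain ⟨e, n₁, n₂, he, h1, h2, -, rfl, rfl⟩ := h
    exact ⟨⟨hc.src g _ h1, by simpa using ⟨hc.dir g e he, hc.tgt g _ h2⟩⟩,
      Assignment.over_bind (hc.dir g e he) x⟩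
  | .bwd x l, g, _, _, p, μ, h => by
    simp only [Pat.sem, Set.mem_ofPred_eq, Prod.mk.injEq] at h
    obtain ⟨e, n₁, n₂, he, h1, h2, -, rfl, rfl⟩ := h
    exact ⟨⟨hc.tgt g _ h2, by simpa using ⟨hc.dir g e he, hc.src g _ h1⟩⟩,
      Assignment.over_bind (hc.dir g e he) x⟩
  | .undir x l, g, _, _, p, μ, h => by
    simp only [Pat.sem, Set.mem_ofPred_eq, Prod.mk.injEq] at h
    obtain ⟨e, n₁, n₂, he, h1 | h1, -, rfl, rfl⟩ := h
    · exact ⟨⟨hc.src g _ h1.1, by simpa using ⟨hc.undir g e he, hc.tgt g _ h1.2⟩⟩,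
        Assignment.over_bind (hc.undir g e he) x⟩
    · exact ⟨⟨hc.tgt g _ h1.2, by simpa using ⟨hc.undir g e he, hc.src g _ h1.1⟩⟩,
        Assignment.over_bind (hc.undir g e he) x⟩
  | .concat π₁ π₂, g, hb, hw, p, μ, h => by
    simp only [Pat.sem, Set.mem_ofPred_eq, Prod.mk.injEq] at h
    obtain ⟨p₁, μ₁, p₂, μ₂, h1, h2, -, -, rfl, rfl⟩ := h
    have i1 := sem_over hc π₁ g hb.2.1 hw.1 _ _ h1
    have i2 := sem_over hc π₂ g hb.2.2 hw.2 _ _ h2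
    exact ⟨i1.1.append i2.1, i1.2.join i2.2⟩
  | .union π₁ π₂, g, hb, hw, p, μ, h => by
    simp only [Pat.sem] at h
    rcases h with h | h
    · exact sem_over hc π₁ g hb.1 hw.2.1 _ _ h
    · have := sem_over hc π₂ g hb.2 hw.2.2 _ _ h
      rw [← hw.1] at this
      exact this
  | .rep π i j, g, hb, hw, p, μ, h => by
    simp only [Pat.sem, Set.mem_ofPred_eq] at h
    obtain ⟨k, -, -, h⟩ := h
    have hs : Pat.sch (.rep π i j) = ∅ := hb.1
    rw [hs]
    rw [hb.1] at h
    rcases k with _ | k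
    · obtain ⟨n, hn, e⟩ := h
      obtain ⟨rfl, rfl⟩ := Prod.mk.inj e
      exact ⟨⟨hc.node g n hn, by simp⟩, by simp [Assignment.Over, Assignment.empty]⟩
    · obtain ⟨rfl, h'⟩ := mem_iterate_succ.1 h
      refine ⟨?_, by simp [Assignment.Over, Assignment.empty]⟩
      clear hs h
      induction k generalizing p with
      | zero =>
        obtain ⟨μ, h⟩ := h'
        exact (sem_over hc π g hb.2 hw.2 _ _ h).1
      | succ k ih =>
        obtain ⟨q, ⟨μ, hq⟩, r, hr, -, rfl⟩ := h'
        exact (sem_over hc π g hb.2 hw.2 _ _ hq).1.append (ih _ hr)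
  | .filter π θ, g, hb, hw, p, μ, h => by
    simp only [Pat.sem, Set.mem_ofPred_eq] at h
    exact sem_over hc π g hb.1 hw.1 _ _ h.1

/-! #### Short paths -/

theorem pathPow_ends {R : Set GPath} {L k : ℕ} {a b : Name}
    (h : relPow (fun n n' => ∃ p ∈ R, p.first = n ∧ p.last = n' ∧ p.len ≤ L) k a b) :
    ∃ p ∈ pathPow R k, p.first = a ∧ p.last = b ∧ p.len ≤ (k + 1) * L := by
  induction k generalizing a with
  | zero => simpa [relPow, pathPow] using h
  | succ k ih =>
    obtain ⟨c, ⟨p, hp, rfl, rfl, hl⟩, h⟩ := h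
    obtain ⟨q, hq, e, rfl, hl'⟩ := ih h
    refine ⟨_, ⟨p, hp, q, hq, e.symm, rfl⟩, rfl, GPath.last_append e.symm, ?_⟩
    rw [GPath.len_append, Nat.succ_mul]
    omega

theorem relPow_of_pathPow {R : Set GPath} {A : Name → Name → Prop} {k : ℕ} {p : GPath}
    (hA : ∀ p ∈ R, A p.first p.last) (h : p ∈ pathPow R k) : relPow A k p.first p.last := by
  induction k generalizing p with
  | zero => exact hA p h
  | succ k ih =>
    obtain ⟨q, hq, r, hr, e, rfl⟩ := h
    rw [GPath.last_append e]
    exact ⟨q.last, hA q hq, e ▸ ih hr⟩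

theorem Pat.exists_short {m : ℕ} {𝒢 : Database m} {dec : ℕ → Value} {M : ℕ}
    (hc : Covers (fun v => ∃ c < M, dec c = v) 𝒢) {B : ℕ} (hB : 2 ≤ B) : ∀ (π : Pat m) (g : Fin m),
      π.Basic → π.WellFormed → sizeOf π + M + 1 ≤ B → ∀ p μ, (p, μ) ∈ π.sem 𝒢 g →
      ∃ p', (p', μ) ∈ π.sem 𝒢 g ∧ p'.first = p.first ∧ p'.last = p.last ∧ p'.len ≤ B ^ sizeOf π
  | .node x l, g, _, _, _, p, μ, h => by
    refine ⟨p, h, rfl, rfl, ?_⟩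
    simp only [Pat.sem, Set.mem_ofPred_eq, Prod.mk.injEq] at h
    obtain ⟨n, hn, -, rfl, rfl⟩ := h
    simp [GPath.len]
  | .fwd x l, g, _, _, _, p, μ, h => by
    refine ⟨p, h, rfl, rfl, ?_⟩
    simp only [Pat.sem, Set.mem_ofPred_eq, Prod.mk.injEq] at h
    obtain ⟨e, n₁, n₂, he, h1, h2, -, rfl, rfl⟩ := h
    simpa [GPath.len] using Nat.one_le_pow _ _ (by omega)
  | .bwd x l, g, _, _, _, p, μ, h => by
    refine ⟨p, h, rfl, rfl, ?_⟩
    simp only [Pat.sem, Set.mem_ofPred_eq, Prod.mk.injEq] at h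
    obtain ⟨e, n₁, n₂, he, h1, h2, -, rfl, rfl⟩ := h
    simpa [GPath.len] using Nat.one_le_pow _ _ (by omega)
  | .undir x l, g, _, _, _, p, μ, h => by
    refine ⟨p, h, rfl, rfl, ?_⟩
    simp only [Pat.sem, Set.mem_ofPred_eq, Prod.mk.injEq] at h
    obtain ⟨e, n₁, n₂, he, h1, -, rfl, rfl⟩ := h
    simpa [GPath.len] using Nat.one_le_pow _ _ (by omega)
  | .concat π₁ π₂, g, hb, hw, hs, p, μ, h => by
    simp only [Pat.concat.sizeOf_spec] at hs ⊢
    simp only [Pat.sem, Set.mem_ofPred_eq, Prod.mk.injEq] at h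
    obtain ⟨p₁, μ₁, p₂, μ₂, h1, h2, e, hμ, rfl, rfl⟩ := h
    obtain ⟨q₁, i1, f1, l1, b1⟩ := exists_short hc hB π₁ g hb.2.1 hw.1 (by omega) _ _ h1
    obtain ⟨q₂, i2, f2, l2, b2⟩ := exists_short hc hB π₂ g hb.2.2 hw.2 (by omega) _ _ h2
    have e' : q₁.last = q₂.first := by rw [l1, e, f2]
    refine ⟨q₁.append q₂, ?_, f1, ?_, ?_⟩
    · simp only [Pat.sem, Set.mem_ofPred_eq, Prod.mk.injEq]
      exact ⟨q₁, μ₁, q₂, μ₂, i1, i2, e', hμ, rfl, rfl⟩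
    · rw [GPath.last_append e, GPath.last_append e', l2]
    · rw [GPath.len_append]
      have h1 : B ^ sizeOf π₁ ≤ B ^ (sizeOf π₁ + sizeOf π₂) := Nat.pow_le_pow_right (by omega) (by omega)
      have h2 : B ^ sizeOf π₂ ≤ B ^ (sizeOf π₁ + sizeOf π₂) := Nat.pow_le_pow_right (by omega) (by omega)
      rw [show 1 + sizeOf π₁ + sizeOf π₂ = (sizeOf π₁ + sizeOf π₂) + 1 by omega, pow_succ]
      have := Nat.mul_le_mul_left (B ^ (sizeOf π₁ + sizeOf π₂)) hB
      omega
  | .union π₁ π₂, g, hb, hw, hs, p, μ, h => by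
    simp only [Pat.union.sizeOf_spec] at hs ⊢
    simp only [Pat.sem] at h ⊢
    rcases h with h | h
    · obtain ⟨q, i, f, l, b⟩ := exists_short hc hB π₁ g hb.1 hw.2.1 (by omega) _ _ h
      exact ⟨q, Or.inl i, f, l, b.trans (Nat.pow_le_pow_right (by omega) (by omega))⟩
    · obtain ⟨q, i, f, l, b⟩ := exists_short hc hB π₂ g hb.2 hw.2.2 (by omega) _ _ h
      exact ⟨q, Or.inr i, f, l, b.trans (Nat.pow_le_pow_right (by omega) (by omega))⟩
  | .rep π i j, g, hb, hw, hs, p, μ, h => by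
    simp only [Pat.rep.sizeOf_spec] at hs ⊢
    simp only [Pat.sem, Set.mem_ofPred_eq] at h ⊢
    obtain ⟨k, hik, hkj, h⟩ := h
    rw [hb.1] at h ⊢
    rcases k with _ | k
    · refine ⟨p, ⟨0, hik, hkj, h⟩, rfl, rfl, ?_⟩
      obtain ⟨n, hn, e⟩ := h
      obtain ⟨rfl, rfl⟩ := Prod.mk.inj e
      simp [GPath.len]
    obtain ⟨rfl, h'⟩ := mem_iterate_succ.1 h
    have short : ∀ p ∈ {p | ∃ μ, (p, μ) ∈ π.sem 𝒢 g}, ∃ p' ∈ {p | ∃ μ, (p, μ) ∈ π.sem 𝒢 g},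
        p'.first = p.first ∧ p'.last = p.last ∧ p'.len ≤ B ^ sizeOf π := by
      rintro p ⟨μ, hp⟩
      obtain ⟨q, i, f⟩ := exists_short hc hB π g hb.2 hw.2 (by omega) _ _ hp
      exact ⟨q, ⟨μ, i⟩, f⟩
    have coded : ∀ n, (∃ n', ∃ p ∈ {p | ∃ μ, (p, μ) ∈ π.sem 𝒢 g}, p.first = n ∧ p.last = n' ∧
        p.len ≤ B ^ sizeOf π) → ∃ c < M, dec c = .elem (.node n) := by
      rintro n ⟨n', p, ⟨μ, hp⟩, rfl, -, -⟩
      exact (sem_over hc π g hb.2 hw.2 _ _ hp).1.1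
    choose! code hcode using coded
    obtain ⟨k', h1, h2, h3, h4⟩ := relPow_shorten (i := i - 1) (k := k) code (M := M)
      (fun a b c d hab hcd e => by
        have h1 := (hcode _ ⟨_, hab⟩).2
        have h2 := (hcode _ ⟨_, hcd⟩).2
        rw [e, h2] at h1
        simpa using h1.symm) (fun a b hab => (hcode _ ⟨_, hab⟩).1) (by omega)
      (relPow_of_pathPow (A := fun n n' => ∃ p ∈ {p | ∃ μ, (p, μ) ∈ π.sem 𝒢 g},
        p.first = n ∧ p.last = n' ∧ p.len ≤ B ^ sizeOf π) short h')
    obtain ⟨q, hq, f, l, b⟩ := pathPow_ends h4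
    refine ⟨q, ⟨k' + 1, by omega, le_trans ?_ hkj, mem_iterate_succ.2 ⟨rfl, hq⟩⟩, f, l, b.trans ?_⟩
    · exact_mod_cast Nat.succ_le_succ h3
    · have : k' + 1 ≤ B := by
        have : sizeOf i = i := rfl
        omega
      calc (k' + 1) * B ^ sizeOf π ≤ B * B ^ sizeOf π := Nat.mul_le_mul_right _ this
        _ = B ^ (sizeOf π + 1) := by rw [pow_succ, mul_comm]
        _ ≤ _ := Nat.pow_le_pow_right (by omega) (by omega)
  | .filter π θ, g, hb, hw, hs, p, μ, h => by
    simp only [Pat.filter.sizeOf_spec] at hs ⊢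
    simp only [Pat.sem, Set.mem_ofPred_eq] at h ⊢
    obtain ⟨q, i, f, l, b⟩ := exists_short hc hB π g hb.1 hw.1 (by omega) _ _ h.1
    exact ⟨q, ⟨i, h.2⟩, f, l, b.trans (Nat.pow_le_pow_right (by omega) (by omega))⟩

/-! #### Traces of paths -/

/-- The functions `F` and `E` list the codes of the nodes and of the edges of some steps. -/
def Trace (dec : ℕ → Value) (F E : ℕ → ℕ) : ℕ → List (Edge × Name) → Prop
  | _, [] => True
  | i, s :: l => dec (E i) = .elem (.edge s.1) ∧ dec (F (i + 1)) = .elem (.node s.2) ∧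
      Trace dec F E (i + 1) l

/-- The functions `F` and `E` list the codes of the nodes and of the edges of a path between two
positions. -/
structure Seg (dec : ℕ → Value) (F E : ℕ → ℕ) (i j : ℕ) (p : GPath) : Prop where
  first : dec (F i) = .elem (.node p.first)
  steps : Trace dec F E i p.steps
  eq : j = i + p.len

section
variable {dec : ℕ → Value} {F E : ℕ → ℕ} {i j k : ℕ} {p q : GPath}

theorem trace_append {s s' : List (Edge × Name)} : Trace dec F E i (s ++ s') ↔
    Trace dec F E i s ∧ Trace dec F E (i + s.length) s' := by
  induction s generalizing i with
  | nil => simp [Trace]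
  | cons a s ih =>
    simp only [List.cons_append, Trace, ih, List.length_cons, and_assoc,
      show i + 1 + s.length = i + (s.length + 1) by omega]

theorem Seg.last (h : Seg dec F E i j p) : dec (F j) = .elem (.node p.last) := by
  obtain ⟨n, s⟩ := p
  obtain ⟨h1, h2, rfl⟩ := h
  simp only [GPath.last, GPath.len] at *
  induction s generalizing i n with
  | nil => simpa using h1
  | cons a s ih =>
    have := ih (i := i + 1) a.2 h2.2.1 h2.2.2
    rw [List.map_cons, List.getLastD_cons, List.length_cons]
    rwa [show i + (s.length + 1) = i + 1 + s.length by omega]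

theorem Seg.append (hp : Seg dec F E i k p) (hq : Seg dec F E k j q) :
    p.last = q.first ∧ Seg dec F E i j (p.append q) := by
  constructor
  · have := hp.last.symm.trans hq.first
    simpa using this
  · refine ⟨hp.first, trace_append.2 ⟨hp.steps, ?_⟩, ?_⟩
    · have := hq.steps
      rwa [hp.eq] at this
    · rw [hq.eq, hp.eq, GPath.len_append, add_assoc]

theorem Seg.split (h : Seg dec F E i j (p.append q)) (e : p.last = q.first) :
    ∃ k, Seg dec F E i k p ∧ Seg dec F E k j q := by
  have hp : Seg dec F E i (i + p.len) p := ⟨h.first, (trace_append.1 h.steps).1, rfl⟩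
  refine ⟨_, hp, ?_, (trace_append.1 h.steps).2, ?_⟩
  · rw [hp.last, e]
  · rw [h.eq, GPath.len_append, add_assoc]

theorem trace_iff {s : List (Edge × Name)} : Trace dec F E i s ↔ ∀ k (hk : k < s.length),
    dec (E (i + k)) = .elem (.edge s[k].1) ∧ dec (F (i + k + 1)) = .elem (.node s[k].2) := by
  induction s generalizing i with
  | nil => simp [Trace]
  | cons a s ih =>
    simp only [Trace, ih]
    constructor
    · rintro ⟨h1, h2, h3⟩ (_ | k) hk
      · exact ⟨h1, h2⟩
      · have := h3 k (by simpa using hk)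
        simpa [add_assoc, add_comm 1] using this
    · intro h
      refine ⟨(h 0 (by simp)).1, (h 0 (by simp)).2, fun k hk => ?_⟩
      have := h (k + 1) (by simpa using hk)
      simpa [add_assoc, add_comm 1] using this

/-- The part of the trace between two positions is the trace of a path from `R`. -/
def At (dec : ℕ → Value) (F E : ℕ → ℕ) (R : Set GPath) (i j : ℕ) : Prop :=
  ∃ p ∈ R, Seg dec F E i j p

theorem At.le {R : Set GPath} (h : At dec F E R i j) : i ≤ j := by
  obtain ⟨p, -, h⟩ := h
  rw [h.eq]
  omega

theorem at_comp {R₁ R₂ : Set GPath} :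
    At dec F E {r | ∃ p ∈ R₁, ∃ q ∈ R₂, p.last = q.first ∧ r = p.append q} i j ↔
      relComp (At dec F E R₁) (At dec F E R₂) i j := by
  constructor
  · rintro ⟨_, ⟨p, hp, q, hq, e, rfl⟩, h⟩
    obtain ⟨k, h1, h2⟩ := h.split e
    exact ⟨k, ⟨p, hp, h1⟩, ⟨q, hq, h2⟩⟩
  · rintro ⟨k, ⟨p, hp, h1⟩, ⟨q, hq, h2⟩⟩
    obtain ⟨e, h⟩ := h1.append h2
    exact ⟨_, ⟨p, hp, q, hq, e, rfl⟩, h⟩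

theorem at_pathPow {R : Set GPath} {k : ℕ} :
    At dec F E (pathPow R k) i j ↔ relPow (At dec F E R) k i j := by
  induction k generalizing i with
  | zero => rfl
  | succ k ih =>
    rw [pathPow, at_comp]
    exact exists_congr fun c => and_congr_right fun _ => ih

theorem Seg.nodup_edges {L : ℕ} (h : Seg dec F E 0 L p) :
    p.edges.Nodup ↔ ∀ l < L, ∀ k < l, dec (E k) ≠ dec (E l) := by
  have hL : L = p.steps.length := by simpa [GPath.len] using h.eq
  have ht := trace_iff.1 h.steps
  simp only [zero_add] at ht
  rw [List.Nodup, List.pairwise_iff_getElem]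
  subst hL
  constructor
  · intro hn l hl k hk e
    refine hn k l (by simp [GPath.edges]; omega) (by simp [GPath.edges]; omega) hk ?_
    rw [(ht k (by omega)).1, (ht l hl).1] at e
    simpa [GPath.edges] using e
  · intro hn k l hk hl hkl e
    simp only [GPath.edges, List.length_map] at hk hl
    refine hn l hl k hkl ?_
    rw [(ht k hk).1, (ht l hl).1]
    simpa [GPath.edges] using e

theorem Seg.nodup_nodes {L : ℕ} (h : Seg dec F E 0 L p) :
    p.nodes.Nodup ↔ ∀ l ≤ L, ∀ k < l, dec (F k) ≠ dec (F l) := by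
  have hL : L = p.steps.length := by simpa [GPath.len] using h.eq
  have ht : ∀ k (hk : k < p.nodes.length), dec (F k) = .elem (.node p.nodes[k]) := by
    rintro (_ | k) hk
    · exact h.first
    · have := trace_iff.1 h.steps k (by simpa [GPath.nodes] using hk)
      simpa [GPath.nodes] using this.2
  have hlen : p.nodes.length = L + 1 := by simp [GPath.nodes, hL]
  rw [List.Nodup, List.pairwise_iff_getElem]
  constructor
  · intro hn l hl k hk e
    refine hn k l (by omega) (by omega) hk ?_
    rw [ht k (by omega), ht l (by omega)] at e
    simpa using e
  · intro hn k l hk hl hkl e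
    refine hn l (by omega) k hkl ?_
    rw [ht k hk, ht l hl, e]

theorem exists_seg {M : ℕ} (hp : p.All fun v => ∃ c < M, dec c = v) :
    ∃ F E : ℕ → ℕ, (∀ i, F i < M) ∧ (∀ i, E i < M) ∧ Seg dec F E 0 p.len p := by
  obtain ⟨⟨c₀, hc₀, e₀⟩, hs⟩ := hp
  choose! f hf using fun s hs' => (hs s hs').1
  choose! f' hf' using fun s hs' => (hs s hs').2
  refine ⟨fun i => if h : 0 < i ∧ i - 1 < p.steps.length then f' (p.steps[i - 1]'h.2) else c₀,
    fun i => if h : i < p.steps.length then f p.steps[i] else c₀, fun i => ?_, fun i => ?_,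
    ?_, ?_, ?_⟩
  · dsimp only
    split_ifs with h
    · exact (hf' _ (List.getElem_mem h.2)).1
    · exact hc₀
  · dsimp only
    split_ifs with h
    · exact (hf _ (List.getElem_mem h)).1
    · exact hc₀
  · simpa using e₀
  · rw [trace_iff]
    intro k hk
    have h' : 0 < k + 1 ∧ k + 1 - 1 < p.steps.length := ⟨by omega, by simpa using hk⟩
    simp only [zero_add, dif_pos hk, dif_pos h']
    exact ⟨(hf _ (List.getElem_mem hk)).2, (hf' _ (List.getElem_mem hk)).2⟩
  · simp

end

end GQL

/-! ### Definability of queries -/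

namespace Definability

section
variable {α β : Type} [Ctx α] [Ctx β] {full : Bool}

theorem FO.at₁ {φ : Ext α → Prop} (h : FO φ) {t : β → α} (ht : Ren t) {f : β → ℕ} (hf : Num f) :
    FO fun b => φ ⟨t b, f b, (hf.le b).trans_eq (ht.N_eq b).symm⟩ :=
  (hf.term.and (h.ren ht.ren_ext)).ex.congr fun b => by
    constructor
    · intro h
      exact ⟨_, hf.le b, rfl, h⟩
    · rintro ⟨i, _, e, h⟩
      obtain rfl : f b = i := e
      exact h

theorem FO.at₂ {φ : Ext (Ext α) → Prop} (h : FO φ) {t : β → α} (ht : Ren t) {f g : β → ℕ}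
    (hf : Num f) (hg : Num g) :
    FO fun b => φ ⟨⟨t b, f b, (hf.le b).trans_eq (ht.N_eq b).symm⟩, g b,
      (hg.le b).trans_eq (ht.N_eq b).symm⟩ :=
  ((FO.ren hf.term Ren.a).and (hg.w.term.and (h.ren ht.ren_ext.ren_ext))).ex.ex.congr fun b => by
    constructor
    · intro h
      exact ⟨_, hf.le b, _, hg.le b, rfl, rfl, h⟩
    · rintro ⟨i, _, j, _, e, e', h⟩
      obtain rfl : f b = i := e
      obtain rfl : g b = j := e'
      exact h

theorem SO.forall_list {ι : Type} (s : List ι) {φ : ι → α → Prop} (h : ∀ i ∈ s, SO full (φ i)) :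
    SO full fun a => ∀ i ∈ s, φ i a := by
  induction s with
  | nil => exact (SO.const True).congr fun a => by simp
  | cons i s ih =>
    exact ((h i (by simp)).and (ih fun j hj => h j (by simp [hj]))).congr fun a => by simp

theorem Num.const {k : ℕ} (h : ∀ a : α, k ≤ N a) : Num fun _ : α => k := ⟨.const k, h⟩

/-- The relations below `A` are second-order definable. -/
structure Below (full : Bool) (A : α → ℕ → ℕ → Prop) : Prop where
  so : ∀ {γ : Type} [Ctx γ] (t : γ → α), Ren t → ∀ Z : γ → Rel, RelIn Z →
    SO full fun c => ∀ i ≤ N c, ∀ j ≤ N c, Z c i j = true → A (t c) i j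

theorem Below.congr {A B : α → ℕ → ℕ → Prop} (h : Below full A)
    (e : ∀ a, ∀ i ≤ N a, ∀ j ≤ N a, B a i j ↔ A a i j) : Below full B := by
  constructor
  intro γ _ t ht Z hZ
  refine (h.so t ht Z hZ).congr fun c => ?_
  refine forall_congr' fun i => forall_congr' fun hi => forall_congr' fun j =>
    forall_congr' fun hj => forall_congr' fun _ => ?_
  rw [← ht.N_eq] at hi hj
  exact e _ i hi j hj

theorem Below.of_fo {A : α → ℕ → ℕ → Prop} (h : FO fun p : Ext (Ext α) => A p.a.a p.a.i p.i) :
    Below full A := by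
  constructor
  intro γ _ t ht Z hZ
  exact .fo (FO.forall_le (FO.forall_le ((FO.app hZ.w.w Num.v0.w Num.v0).imp
    (FO.ren h ht.ren_ext.ren_ext))))

theorem Below.comp {A B : α → ℕ → ℕ → Prop} (hA : Below full A) (hB : Below full B)
    (hle : ∀ a i j, B a i j → i ≤ j) : Below full fun a => GQL.relComp (A a) (B a) := by
  classical
  constructor
  intro γ _ t ht Z hZ
  have ht' : Ren fun p : (γ × Rel) × Rel => t p.1.1 := (ht.comp Ren.fst).comp Ren.fst
  have h1 : RelIn fun p : (γ × Rel) × Rel => p.1.2 := RelIn.snd.r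
  have h2 : RelIn fun p : (γ × Rel) × Rel => p.2 := RelIn.snd
  have h3 : FO fun p : (γ × Rel) × Rel => ∀ i ≤ N p, ∀ j ≤ N p, Z p.1.1 i j = true →
      ∃ k ≤ N p, p.1.2 i k = true ∧ p.2 k j = true :=
    FO.forall_le (FO.forall_le ((FO.app hZ.r.r.w.w Num.v0.w Num.v0).imp (FO.exists_le
      ((FO.app h1.w.w.w Num.v0.w.w Num.v0).and (FO.app h2.w.w.w Num.v0 Num.v0.w)))))
  refine ((hA.so _ ht' _ h1).and ((hB.so _ ht' _ h2).and (.fo h3))).ex.ex.congr fun c => ?_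
  constructor
  · intro h
    refine ⟨fun i j => decide (A (t c) i j), fun i j => decide (B (t c) i j), by simp, by simp, ?_⟩
    intro i hi j hj hz
    obtain ⟨k, h1, h2⟩ := h i hi j hj hz
    exact ⟨k, (hle _ _ _ h2).trans hj, by simpa using h1, by simpa using h2⟩
  · rintro ⟨Z₁, Z₂, h1, h2, h⟩ i hi j hj hz
    obtain ⟨k, hk, h3, h4⟩ := h i hi j hj hz
    exact ⟨k, h1 i hi k hk h3, h2 k hk j hj h4⟩

theorem Below.or {A B : α → ℕ → ℕ → Prop} (hA : Below full A) (hB : Below full B) :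
    Below full fun a i j => A a i j ∨ B a i j := by
  classical
  constructor
  intro γ _ t ht Z hZ
  have ht' : Ren fun p : (γ × Rel) × Rel => t p.1.1 := (ht.comp Ren.fst).comp Ren.fst
  have h1 : RelIn fun p : (γ × Rel) × Rel => p.1.2 := RelIn.snd.r
  have h2 : RelIn fun p : (γ × Rel) × Rel => p.2 := RelIn.snd
  have h3 : FO fun p : (γ × Rel) × Rel => ∀ i ≤ N p, ∀ j ≤ N p, Z p.1.1 i j = true →
      p.1.2 i j = true ∨ p.2 i j = true :=
    FO.forall_le (FO.forall_le ((FO.app hZ.r.r.w.w Num.v0.w Num.v0).imp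
      ((FO.app h1.w.w Num.v0.w Num.v0).or (FO.app h2.w.w Num.v0.w Num.v0))))
  refine ((hA.so _ ht' _ h1).and ((hB.so _ ht' _ h2).and (.fo h3))).ex.ex.congr fun c => ?_
  constructor
  · intro h
    refine ⟨fun i j => decide (A (t c) i j), fun i j => decide (B (t c) i j), by simp, by simp, ?_⟩
    intro i hi j hj hz
    simpa using h i hi j hj hz
  · rintro ⟨Z₁, Z₂, h1, h2, h⟩ i hi j hj hz
    exact (h i hi j hj hz).imp (h1 i hi j hj) (h2 i hi j hj)

theorem Below.and {A : α → ℕ → ℕ → Prop} (hA : Below full A) {φ : α → Prop} (h : SO full φ) :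
    Below full fun a i j => A a i j ∧ φ a := by
  constructor
  intro γ _ t ht Z hZ
  have h1 : FO fun c => ∀ i ≤ N c, ∀ j ≤ N c, ¬ Z c i j = true :=
    FO.forall_le (FO.forall_le (FO.app hZ.w.w Num.v0.w Num.v0).not)
  refine ((SO.fo h1).or ((hA.so t ht Z hZ).and (h.ren ht))).congr fun c => ?_
  constructor
  · intro h
    by_cases hz : ∀ i ≤ N c, ∀ j ≤ N c, ¬ Z c i j = true
    · exact Or.inl hz
    · push Not at hz
      obtain ⟨i, hi, j, hj, hz⟩ := hz
      exact Or.inr ⟨fun i hi j hj hz => (h i hi j hj hz).1, (h i hi j hj hz).2⟩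
  · rintro (h | ⟨h1, h2⟩) i hi j hj hz
    · exact absurd hz (h i hi j hj)
    · exact ⟨h1 i hi j hj hz, h2⟩

theorem Below.star {A : α → ℕ → ℕ → Prop} (hA : Below full A) (hle : ∀ a i j, A a i j → i ≤ j) :
    Below full fun a => Relation.ReflTransGen (A a) := by
  classical
  constructor
  intro γ _ t ht Z hZ
  have ht' : Ren fun p : (γ × Rel) × Rel => t p.1.1 := (ht.comp Ren.fst).comp Ren.fst
  have h1 : RelIn fun p : (γ × Rel) × Rel => p.1.2 := RelIn.snd.r
  have h2 : RelIn fun p : (γ × Rel) × Rel => p.2 := RelIn.snd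
  have h3 : FO fun p : (γ × Rel) × Rel => (∀ i ≤ N p, ∀ j ≤ N p, Z p.1.1 i j = true →
      p.2 i j = true) ∧ ∀ i ≤ N p, ∀ j ≤ N p, p.2 i j = true → i = j ∨
        ∃ k ≤ N p, i < k ∧ p.1.2 i k = true ∧ p.2 k j = true :=
    (FO.forall_le (FO.forall_le ((FO.app hZ.r.r.w.w Num.v0.w Num.v0).imp
      (FO.app h2.w.w Num.v0.w Num.v0)))).and
    (FO.forall_le (FO.forall_le ((FO.app h2.w.w Num.v0.w Num.v0).imp
      ((FO.eq Num.v0.w.term Num.v0).or (FO.exists_le ((FO.lt Num.v0.w.w.term Num.v0).and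
        ((FO.app h1.w.w.w Num.v0.w.w Num.v0).and (FO.app h2.w.w.w Num.v0 Num.v0.w))))))))
  refine ((hA.so _ ht' _ h1).and (.fo h3)).ex.ex.congr fun c => ?_
  have hle' : ∀ i j, Relation.ReflTransGen (A (t c)) i j → i ≤ j := by
    intro i j h
    induction h with
    | refl => exact le_rfl
    | tail _ h ih => exact ih.trans (hle _ _ _ h)
  constructor
  · intro h
    refine ⟨fun i j => decide (A (t c) i j), fun i j =>
      decide (Relation.ReflTransGen (A (t c)) i j), by simp, ?_, ?_⟩
    · exact fun i hi j hj hz => by simpa using h i hi j hj hz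
    · intro i hi j hj hz
      simp only [decide_eq_true_eq] at hz ⊢
      induction hz using Relation.ReflTransGen.head_induction_on with
      | refl => exact Or.inl rfl
      | @head i k h1 h2 ih =>
        rcases (hle _ _ _ h1).eq_or_lt with rfl | hlt
        · exact ih hi
        · exact Or.inr ⟨k, (hle' _ _ h2).trans hj, hlt, h1, h2⟩
  · rintro ⟨Z₁, Z₂, h1, h2, h3⟩ i hi j hj hz
    have key : ∀ d i, i ≤ N c → N c - i ≤ d → Z₂ i j = true →
        Relation.ReflTransGen (A (t c)) i j := by
      intro d
      induction d with
      | zero =>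
        intro i hi hd hz
        rcases h3 i hi j hj hz with rfl | ⟨k, hk, hik, -⟩
        · exact .refl
        · have : N ((c, Z₁), Z₂) = N c := rfl
          omega
      | succ d ih =>
        intro i hi hd hz
        rcases h3 i hi j hj hz with rfl | ⟨k, hk, hik, h4, h5⟩
        · exact .refl
        · exact .head (h1 i hi k hk h4) (ih k hk (by omega) h5)
    exact key _ i hi le_rfl (h2 i hi j hj hz)

theorem Below.exists_lt {A : ℕ → α → ℕ → ℕ → Prop} (n : ℕ) (h : ∀ k, Below full (A k)) :
    Below full fun a i j => ∃ k < n, A k a i j := by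
  induction n with
  | zero => exact (Below.of_fo (A := fun _ _ _ => False) (FO.const False)).congr fun a i _ j _ => by simp
  | succ n ih =>
    exact (ih.or (h n)).congr fun a i _ j _ => by
      simp only [Nat.lt_succ_iff_lt_or_eq, or_and_right, exists_or, exists_eq_left]

theorem Below.relPow {A : α → ℕ → ℕ → Prop} (h : Below full A) (hle : ∀ a i j, A a i j → i ≤ j)
    (k : ℕ) : Below full (fun a => GQL.relPow (A a) k) ∧
      ∀ a i j, GQL.relPow (A a) k i j → i ≤ j := by
  induction k with
  | zero => exact ⟨h, hle⟩
  | succ k ih =>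
    exact ⟨h.comp ih.1 ih.2, fun a i j ⟨c, h1, h2⟩ => (hle _ _ _ h1).trans (ih.2 _ _ _ h2)⟩

theorem Below.apply {A : α → ℕ → ℕ → Prop} (h : Below full A) {f g : α → ℕ} (hf : Num f)
    (hg : Num g) : SO full fun a => A a (f a) (g a) := by
  refine ((SO.fo (FO.app RelIn.snd hf.r hg.r)).and
    (h.so Prod.fst Ren.fst _ RelIn.snd)).ex.congr fun a => ?_
  constructor
  · intro h
    refine ⟨fun i j => decide (i = f a ∧ j = g a), by simp, fun i hi j hj hz => ?_⟩
    obtain ⟨rfl, rfl⟩ : i = f a ∧ j = g a := by simpa using hz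
    exact h
  · rintro ⟨Z, h1, h2⟩
    exact h2 _ (hf.le a) _ (hg.le a) h1

end

end Definability

namespace GQL

open Definability

/-- Definable presentations of databases by numbers: the number `i` stands for the value `dec i`. -/
structure Pres {β : Type} [Ctx β] {m : ℕ} (K : ℕ) (𝒢 : β → Database m) (dec : β → ℕ → Value)
    (M : β → ℕ) : Prop where
  eqV : FO fun p : Ext (Ext β) => dec p.a.a p.a.i = dec p.a.a p.i
  node : ∀ g, FO fun p : Ext β => ∃ n ∈ (𝒢 p.a g).nodes, dec p.a p.i = .elem (.node n)
  dir : ∀ g, FO fun p : Ext β => ∃ e ∈ (𝒢 p.a g).dirEdges,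
    dec p.a p.i = .elem (.edge (.directed e))
  undir : ∀ g, FO fun p : Ext β => ∃ e ∈ (𝒢 p.a g).undirEdges,
    dec p.a p.i = .elem (.edge (.undirected e))
  src : ∀ g, FO fun p : Ext (Ext β) => ∃ r ∈ (𝒢 p.a.a g).src,
    dec p.a.a p.a.i = .elem (.edge r.1) ∧ dec p.a.a p.i = .elem (.node r.2)
  tgt : ∀ g, FO fun p : Ext (Ext β) => ∃ r ∈ (𝒢 p.a.a g).tgt,
    dec p.a.a p.a.i = .elem (.edge r.1) ∧ dec p.a.a p.i = .elem (.node r.2)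
  prop : ∀ g k, FO fun p : Ext (Ext β) => ∃ a c, (a, k, c) ∈ (𝒢 p.a.a g).property ∧
    dec p.a.a p.a.i = .elem a ∧ dec p.a.a p.i = .const c
  label : ∀ g l, FO fun p : Ext β => ∃ a, (a, l) ∈ (𝒢 p.a g).label ∧ dec p.a p.i = .elem a
  const : ∀ c, FO fun p : Ext β => dec p.a p.i = .const c
  simple : ∀ b i, (∃ a, dec b i = .elem a) ∨ ∃ c, dec b i = .const c
  covers : ∀ b, Covers (fun v => ∃ c < M b, dec b c = v) (𝒢 b)
  M_le : ∀ b, (M b + K + 3) ^ K ≤ N b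
  K_pos : K ≠ 0
  prop_code : ∀ b g a k c, (a, k, c) ∈ (𝒢 b g).property → ∃ i ≤ N b, dec b i = .const c
  const_code : ∀ b (c : Name), c.length ≤ K → ∃ i ≤ N b, dec b i = .const c

/-- The assignment with domain `S` that is coded by a function. -/
def assign (dec : ℕ → Value) (S : Finset Var) (ν : ℕ → ℕ) : Assignment := fun x =>
  if x ∈ S then some (dec (ν x)) else none

section
variable {dec : ℕ → Value} {S S' : Finset Var} {ν : ℕ → ℕ}

theorem assign_eq_bind {x : Option Var} {v : Value} :
    assign dec x.toFinset ν = Assignment.bind x v ↔ ∀ y ∈ x, dec (ν y) = v := by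
  constructor
  · intro h y hy
    have := congrFun h y
    simpa [assign, Assignment.bind, Option.mem_def.1 hy] using this
  · intro h
    funext y
    cases x with
    | none => simp [assign, Assignment.bind]
    | some x =>
      by_cases hy : x = y
      · subst hy
        simpa [assign, Assignment.bind] using h x rfl
      · simp [assign, Assignment.bind, hy, Ne.symm hy]

theorem compatible_assign : Assignment.Compatible (assign dec S ν) (assign dec S' ν) := by
  intro x v₁ v₂ h1 h2
  simp only [assign, Option.ite_none_right_eq_some, Option.some.injEq] at h1 h2
  rw [← h1.2, ← h2.2]

theorem join_assign : (assign dec S ν).join (assign dec S' ν) = assign dec (S ∪ S') ν := by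
  funext x
  by_cases h : x ∈ S <;> by_cases h' : x ∈ S' <;> simp [Assignment.join, assign, h, h']

theorem assign_eq_join {good good' : Value → Prop} {μ μ' : Assignment} (h : μ.Over good S)
    (h' : μ'.Over good' S') (hc : μ.Compatible μ') (e : assign dec (S ∪ S') ν = μ.join μ') :
    μ = assign dec S ν ∧ μ' = assign dec S' ν := by
  constructor
  · funext x
    by_cases hx : x ∈ S
    · obtain ⟨v, -, hv⟩ := h.1 x hx
      have := congrFun e x
      simp [assign, Assignment.join, hx, hv] at this
      simp [assign, hx, hv, this]
    · simp [assign, hx, h.2 x hx]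
  · funext x
    by_cases hx : x ∈ S'
    · obtain ⟨v', -, hv'⟩ := h'.1 x hx
      have := congrFun e x
      by_cases hS : x ∈ S
      · obtain ⟨v, -, hv⟩ := h.1 x hS
        simp [assign, Assignment.join, hx, hv] at this
        simp [assign, hx, hv', this, hc x v v' hv hv']
      · simp [assign, Assignment.join, hx, h.2 x hS, hv'] at this
        simp [assign, hx, hv', this]
    · simp [assign, hx, h'.2 x hx]

theorem over_assign {n : ℕ} (h : ∀ i, ν i ≤ n) :
    (assign dec S ν).Over (fun v => ∃ c ≤ n, dec c = v) S :=
  ⟨fun x hx => ⟨_, ⟨_, h x, rfl⟩, by simp [assign, hx]⟩, fun x hx => by simp [assign, hx]⟩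

theorem exists_assign {n : ℕ} {μ : Assignment} (h : μ.Over (fun v => ∃ c ≤ n, dec c = v) S) :
    ∃ ν : ℕ → ℕ, (∀ i, ν i ≤ n) ∧ μ = assign dec S ν := by
  have : Nonempty Value := ⟨.const []⟩
  choose! f hf using h.1
  choose! c hc using fun x hx => (hf x hx).1
  refine ⟨fun x => if x ∈ S then c x else 0, fun i => ?_, funext fun x => ?_⟩
  · dsimp only
    split_ifs with hi
    · exact (hc i hi).1
    · exact Nat.zero_le _
  · by_cases hx : x ∈ S
    · simp [assign, hx, (hf x hx).2, (hc x hx).2]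
    · simp [assign, hx, h.2 x hx]

end

section
variable {β γ : Type} [Ctx β] [Ctx γ] {m K : ℕ} {𝒢 : β → Database m} {dec : β → ℕ → Value}
  {M : β → ℕ} {full : Bool}

theorem Pres.ren (P : Pres K 𝒢 dec M) {t : γ → β} (ht : Ren t) :
    Pres K (fun c => 𝒢 (t c)) (fun c => dec (t c)) (fun c => M (t c)) where
  eqV := FO.ren P.eqV ht.ren_ext.ren_ext
  node g := FO.ren (P.node g) ht.ren_ext
  dir g := FO.ren (P.dir g) ht.ren_ext
  undir g := FO.ren (P.undir g) ht.ren_ext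
  src g := FO.ren (P.src g) ht.ren_ext.ren_ext
  tgt g := FO.ren (P.tgt g) ht.ren_ext.ren_ext
  prop g k := FO.ren (P.prop g k) ht.ren_ext.ren_ext
  label g l := FO.ren (P.label g l) ht.ren_ext
  const c := FO.ren (P.const c) ht.ren_ext
  simple c := P.simple (t c)
  covers c := P.covers (t c)
  M_le c := ht.N_eq c ▸ P.M_le (t c)
  K_pos := P.K_pos
  prop_code c := ht.N_eq c ▸ P.prop_code (t c)
  const_code c := ht.N_eq c ▸ P.const_code (t c)

theorem Pres.le_N (P : Pres K 𝒢 dec M) (b : β) : M b + K + 3 ≤ N b :=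
  (Nat.le_self_pow P.K_pos _).trans (P.M_le b)

theorem Pres.num (P : Pres K 𝒢 dec M) {k : ℕ} (h : k ≤ K) : Num fun _ : β => k :=
  .const fun b => by have := P.le_N b; omega

/-- Tables of assignments with domain `S` that are definable. -/
structure DefTable (full : Bool) (K : ℕ) (dec : β → ℕ → Value) (S : Finset Var) (T : β → Table) :
    Prop where
  vars : ∀ x ∈ S, x ≤ K
  dom : ∀ b, ∀ μ ∈ T b, μ.Over (fun v => ∃ c ≤ N b, dec b c = v) S
  mem : ∀ {γ : Type} [Ctx γ] (t : γ → β), Ren t → ∀ ν : γ → ℕ → ℕ, FnIn ν →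
    SO full fun c => assign (dec (t c)) S (ν c) ∈ T (t c)

theorem DefTable.exists {S : Finset Var} {T : β → Table} (h : DefTable full K dec S T)
    {φ : β → Assignment → Prop} (hφ : ∀ {γ : Type} [Ctx γ] (t : γ → β), Ren t →
      ∀ ν : γ → ℕ → ℕ, FnIn ν → SO full fun c => φ (t c) (assign (dec (t c)) S (ν c))) :
    SO full fun b => ∃ μ ∈ T b, φ b μ := by
  refine (SO.exists_fn (φ := fun b ν => assign (dec b) S ν ∈ T b ∧ φ b (assign (dec b) S ν))
    ((h.mem Prod.fst Ren.fst _ FnIn.of_rel).and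
      (hφ Prod.fst Ren.fst _ FnIn.of_rel))).congr fun b => ?_
  constructor
  · rintro ⟨μ, hμ, h'⟩
    obtain ⟨ν, hν, rfl⟩ := exists_assign (h.dom b μ hμ)
    exact ⟨ν, hν, hμ, h'⟩
  · rintro ⟨ν, -, h1, h2⟩
    exact ⟨_, h1, h2⟩

theorem DefTable.join {S S' : Finset Var} {T T' : β → Table} (h : DefTable full K dec S T)
    (h' : DefTable full K dec S' T') : DefTable full K dec (S ∪ S') fun b =>
      {ν | ∃ μ ∈ T b, ∃ μ' ∈ T' b, Assignment.Compatible μ μ' ∧ ν = μ.join μ'} where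
  vars x hx := (Finset.mem_union.1 hx).elim (h.vars x) (h'.vars x)
  dom := by
    rintro b _ ⟨μ, hμ, μ', hμ', -, rfl⟩
    exact (h.dom b μ hμ).join (h'.dom b μ' hμ')
  mem t ht ν hν := by
    refine ((h.mem t ht ν hν).and (h'.mem t ht ν hν)).congr fun c => ?_
    constructor
    · rintro ⟨μ, hμ, μ', hμ', hc, e⟩
      obtain ⟨rfl, rfl⟩ := assign_eq_join (h.dom _ μ hμ) (h'.dom _ μ' hμ') hc e
      exact ⟨hμ, hμ'⟩
    · rintro ⟨h1, h2⟩
      exact ⟨_, h1, _, h2, compatible_assign, join_assign.symm⟩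

/-! #### Terms -/

theorem Trm.fo_mem (P : Pres K 𝒢 dec M) (g : Fin m) {S : Finset Var} {ν : β → ℕ → ℕ}
    (hν : FnIn ν) (hS : ∀ x ∈ S, x ≤ K) (χ : Trm) (hχ : χ.vars ⊆ S) :
    FO fun p : Ext β => dec p.a p.i ∈ χ.sem (𝒢 p.a g) (assign (dec p.a) S (ν p.a)) := by
  cases χ with
  | var x =>
    have hx : x ∈ S := hχ (by simp [Trm.vars])
    exact (FO.at₂ P.eqV Ren.a (Num.app hν.w (P.num (hS x hx)).w)
      Num.v0).congr fun p => by simp [Trm.sem, assign, hx, eq_comm]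
  | prop x a =>
    have hx : x ∈ S := hχ (by simp [Trm.vars])
    refine (FO.at₂ (P.prop g a) Ren.a
      (Num.app hν.w (P.num (hS x hx)).w) Num.v0).congr fun p => ?_
    simp only [Trm.sem, assign, hx, if_true, Option.some.injEq]
    refine exists_congr fun e => exists_congr fun c => ?_
    exact ⟨fun ⟨h1, h2, h3⟩ => ⟨h2, h1, h3⟩, fun ⟨h1, h2, h3⟩ => ⟨h2, h1, h3⟩⟩
  | const c => exact (P.const c).congr fun p => by simp [Trm.sem]

theorem length_le_sizeOf (c : List Bool) : c.length ≤ sizeOf c := by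
  induction c with
  | nil => simp
  | cons _ _ ih =>
    simp only [List.length_cons, List.cons.sizeOf_spec]
    omega

theorem Trm.exists_code (P : Pres K 𝒢 dec M) (g : Fin m) {S : Finset Var} (b : β) {μ : Assignment}
    (hμ : μ.Over (fun v => ∃ c ≤ N b, dec b c = v) S) (χ : Trm) (hχ : χ.vars ⊆ S)
    (hK : sizeOf χ ≤ K) {v : Value} (hv : v ∈ χ.sem (𝒢 b g) μ) : ∃ i ≤ N b, dec b i = v := by
  cases χ with
  | var x =>
    obtain ⟨v', h1, h2⟩ := hμ.1 x (hχ (by simp [Trm.vars]))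
    simp only [Trm.sem, Set.mem_ofPred_eq, h2, Option.some.injEq] at hv
    exact hv ▸ h1
  | prop x a =>
    obtain ⟨e, c, -, h, rfl⟩ := hv
    exact P.prop_code b g _ _ _ h
  | const c =>
    obtain rfl : v = .const c := hv
    refine P.const_code b c ?_
    have h := length_le_sizeOf c
    rw [Trm.const.sizeOf_spec] at hK
    omega

/-! #### Path patterns -/

theorem seg_single {dec : ℕ → Value} {F E : ℕ → ℕ} {i j : ℕ} {n : Name} :
    Seg dec F E i j ⟨n, []⟩ ↔ j = i ∧ dec (F i) = .elem (.node n) :=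
  ⟨fun h => ⟨h.eq, h.first⟩, fun h => ⟨h.2, trivial, h.1⟩⟩

theorem seg_step {dec : ℕ → Value} {F E : ℕ → ℕ} {i j : ℕ} {n n' : Name} {e : Edge} :
    Seg dec F E i j ⟨n, [(e, n')]⟩ ↔ j = i + 1 ∧ dec (F i) = .elem (.node n) ∧
      dec (E i) = .elem (.edge e) ∧ dec (F j) = .elem (.node n') :=
  ⟨fun h => ⟨h.eq, h.first, h.steps.1, h.eq ▸ h.steps.2.1⟩,
    fun h => ⟨h.2.1, ⟨h.2.2.1, h.1 ▸ h.2.2.2, trivial⟩, h.1⟩⟩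

variable {ν F E : β → ℕ → ℕ}

/-- The positions between which the trace given by `F` and `E` is a match of a pattern. -/
def Pat.at {m : ℕ} (π : Pat m) (g : Fin m) (𝒢 : β → Database m) (dec : β → ℕ → Value)
    (ν F E : β → ℕ → ℕ) (b : β) : ℕ → ℕ → Prop :=
  At (dec b) (F b) (E b) {p | (p, assign (dec b) π.sch (ν b)) ∈ π.sem (𝒢 b) g}

theorem fo_labelled (P : Pres K 𝒢 dec M) (g : Fin m) (l : Option Name) :
    FO fun p : Ext β => ∀ k ∈ l, ∃ a, (a, k) ∈ (𝒢 p.a g).label ∧ dec p.a p.i = .elem a := by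
  cases l with
  | none => exact FO.top.congr fun p => by simp
  | some l => exact (P.label g l).congr fun p => by simp

theorem fo_bound (P : Pres K 𝒢 dec M) (hν : FnIn ν) {x : Option Var} (hx : ∀ y ∈ x, y ≤ K) :
    FO fun p : Ext β => ∀ y ∈ x, dec p.a (ν p.a y) = dec p.a p.i := by
  cases x with
  | none => exact FO.top.congr fun p => by simp
  | some x =>
    exact (FO.at₂ P.eqV Ren.a (Num.app hν.w (P.num (hx x rfl)).w)
      Num.v0).congr fun p => by simp

theorem Pat.below_node (P : Pres K 𝒢 dec M) (hν : FnIn ν) (hF : FnIn F) (g : Fin m)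
    {x : Option Var} (hx : ∀ y ∈ x, y ≤ K) (l : Option Name) :
    Below full ((Pat.node x l).at g 𝒢 dec ν F E) := by
  have hFi : Num fun p : Ext (Ext β) => F p.a.a p.a.i := Num.app hF.w.w Num.v0.w
  have r : Ren fun p : Ext (Ext β) => p.a.a := Ren.a.comp Ren.a
  refine Below.of_fo (((FO.eq Num.v0.term Num.v0.w).and ((FO.at₁ (P.node g) r hFi).and
    ((FO.at₁ (fo_labelled P g l) r hFi).and (FO.at₁ (fo_bound P hν hx) r hFi)))).congr fun p => ?_)
  simp only [Pat.at, At, Pat.sem, Pat.sch, Set.mem_ofPred_eq, Prod.mk.injEq, assign_eq_bind,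
    PropertyGraph.Labelled]
  constructor
  · rintro ⟨_, ⟨n, hn, hl, rfl, hx⟩, h⟩
    obtain ⟨e, h⟩ := seg_single.1 h
    exact ⟨e, ⟨n, hn, h⟩, fun k hk => ⟨_, hl k hk, h⟩, fun y hy => (hx y hy).trans h.symm⟩
  · rintro ⟨e, ⟨n, hn, h⟩, hl, hx⟩
    refine ⟨_, ⟨n, hn, fun k hk => ?_, rfl, fun y hy => (hx y hy).trans h⟩, seg_single.2 ⟨e, h⟩⟩
    obtain ⟨a, ha, h'⟩ := hl k hk
    obtain rfl : a = .node n := by simpa using h'.symm.trans h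
    exact ha

theorem below_step (P : Pres K 𝒢 dec M) (hν : FnIn ν) (hE : FnIn E) (g : Fin m)
    {x : Option Var} (hx : ∀ y ∈ x, y ≤ K) (l : Option Name) (C : β → Edge → Name → Name → Prop)
    (hC : FO fun p : Ext (Ext β) => ∃ e n n', C p.a.a e n n' ∧
      dec p.a.a (F p.a.a p.a.i) = .elem (.node n) ∧ dec p.a.a (E p.a.a p.a.i) = .elem (.edge e) ∧
      dec p.a.a (F p.a.a p.i) = .elem (.node n')) :
    Below full fun b => At (dec b) (F b) (E b) {p | ∃ e n n', C b e n n' ∧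
      (𝒢 b g).Labelled (.edge e) l ∧ (p, assign (dec b) x.toFinset (ν b)) =
        (⟨n, [(e, n')]⟩, Assignment.bind x (.elem (.edge e)))} := by
  have hEi : Num fun p : Ext (Ext β) => E p.a.a p.a.i := Num.app hE.w.w Num.v0.w
  have r : Ren fun p : Ext (Ext β) => p.a.a := Ren.a.comp Ren.a
  refine Below.of_fo (((FO.eq (Num.v0.w.term.add .one) Num.v0).and (hC.and
    ((FO.at₁ (fo_labelled P g l) r hEi).and (FO.at₁ (fo_bound P hν hx) r hEi)))).congr fun p => ?_)
  simp only [At, Set.mem_ofPred_eq, Prod.mk.injEq, assign_eq_bind, PropertyGraph.Labelled]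
  constructor
  · rintro ⟨_, ⟨e, n, n', hC, hl, rfl, hx⟩, h⟩
    obtain ⟨e1, h1, h2, h3⟩ := seg_step.1 h
    exact ⟨e1.symm, ⟨e, n, n', hC, h1, h2, h3⟩, fun k hk => ⟨_, hl k hk, h2⟩,
      fun y hy => (hx y hy).trans h2.symm⟩
  · rintro ⟨e1, ⟨e, n, n', hC, h1, h2, h3⟩, hl, hx⟩
    refine ⟨_, ⟨e, n, n', hC, fun k hk => ?_, rfl, fun y hy => (hx y hy).trans h2⟩,
      seg_step.2 ⟨e1.symm, h1, h2, h3⟩⟩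
    obtain ⟨a, ha, h'⟩ := hl k hk
    obtain rfl : a = .edge e := by simpa using h'.symm.trans h2
    exact ha

section steps
variable (P : Pres K 𝒢 dec M) (hF : FnIn F) (hE : FnIn E) (g : Fin m)
include P hF hE

theorem Pat.below_fwd (hν : FnIn ν) {x : Option Var} (hx : ∀ y ∈ x, y ≤ K) (l : Option Name) :
    Below full ((Pat.fwd x l).at g 𝒢 dec ν F E) := by
  have hEi : Num fun p : Ext (Ext β) => E p.a.a p.a.i := Num.app hE.w.w Num.v0.w
  have hFi : Num fun p : Ext (Ext β) => F p.a.a p.a.i := Num.app hF.w.w Num.v0.w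
  have hFj : Num fun p : Ext (Ext β) => F p.a.a p.i := Num.app hF.w.w Num.v0
  have r : Ren fun p : Ext (Ext β) => p.a.a := Ren.a.comp Ren.a
  refine (below_step (full := full) (F := F) P hν hE g hx l (fun b e n n' => ∃ e',
    e = .directed e' ∧ e' ∈ (𝒢 b g).dirEdges ∧ (e, n) ∈ (𝒢 b g).src ∧ (e, n') ∈ (𝒢 b g).tgt)
    (((FO.at₁ (P.dir g) r hEi).and ((FO.at₂ (P.src g) r hEi hFi).and (FO.at₂ (P.tgt g) r hEi hFj))).congr fun p => ?_)).congr fun b i _ j _ => ?_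
  · constructor
    · rintro ⟨e, n, n', ⟨e', rfl, h1, h2, h3⟩, h4, h5, h6⟩
      exact ⟨⟨e', h1, h5⟩, ⟨_, h2, h5, h4⟩, ⟨_, h3, h5, h6⟩⟩
    · rintro ⟨⟨e', h1, h5⟩, ⟨⟨e, n⟩, h2, h5', h4⟩, ⟨⟨e'', n'⟩, h3, h5'', h6⟩⟩
      obtain rfl : e = .directed e' := by simpa using h5'.symm.trans h5
      obtain rfl : e'' = .directed e' := by simpa using h5''.symm.trans h5
      exact ⟨_, n, n', ⟨e', rfl, h1, h2, h3⟩, h4, h5, h6⟩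
  · simp only [Pat.at, Pat.sem, Pat.sch, At, Set.mem_ofPred_eq]
    refine exists_congr fun p => and_congr_left fun _ => ?_
    constructor
    · rintro ⟨e, n, n', h1, h2, h3, h4⟩
      exact ⟨_, n, n', ⟨e, rfl, h1, h2, h3⟩, h4⟩
    · rintro ⟨_, n, n', ⟨e, rfl, h1, h2, h3⟩, h4⟩
      exact ⟨e, n, n', h1, h2, h3, h4⟩

theorem Pat.below_bwd (hν : FnIn ν) {x : Option Var} (hx : ∀ y ∈ x, y ≤ K) (l : Option Name) :
    Below full ((Pat.bwd x l).at g 𝒢 dec ν F E) := by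
  have hEi : Num fun p : Ext (Ext β) => E p.a.a p.a.i := Num.app hE.w.w Num.v0.w
  have hFi : Num fun p : Ext (Ext β) => F p.a.a p.a.i := Num.app hF.w.w Num.v0.w
  have hFj : Num fun p : Ext (Ext β) => F p.a.a p.i := Num.app hF.w.w Num.v0
  have r : Ren fun p : Ext (Ext β) => p.a.a := Ren.a.comp Ren.a
  refine (below_step (full := full) (F := F) P hν hE g hx l (fun b e n n' => ∃ e',
    e = .directed e' ∧ e' ∈ (𝒢 b g).dirEdges ∧ (e, n') ∈ (𝒢 b g).src ∧ (e, n) ∈ (𝒢 b g).tgt)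
    (((FO.at₁ (P.dir g) r hEi).and ((FO.at₂ (P.src g) r hEi hFj).and (FO.at₂ (P.tgt g) r hEi hFi))).congr fun p => ?_)).congr fun b i _ j _ => ?_
  · constructor
    · rintro ⟨e, n, n', ⟨e', rfl, h1, h2, h3⟩, h4, h5, h6⟩
      exact ⟨⟨e', h1, h5⟩, ⟨_, h2, h5, h6⟩, ⟨_, h3, h5, h4⟩⟩
    · rintro ⟨⟨e', h1, h5⟩, ⟨⟨e, n⟩, h2, h5', h4⟩, ⟨⟨e'', n'⟩, h3, h5'', h6⟩⟩
      obtain rfl : e = .directed e' := by simpa using h5'.symm.trans h5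
      obtain rfl : e'' = .directed e' := by simpa using h5''.symm.trans h5
      exact ⟨_, n', n, ⟨e', rfl, h1, h2, h3⟩, h6, h5, h4⟩
  · simp only [Pat.at, Pat.sem, Pat.sch, At, Set.mem_ofPred_eq]
    refine exists_congr fun p => and_congr_left fun _ => ?_
    constructor
    · rintro ⟨e, n, n', h1, h2, h3, h4⟩
      exact ⟨_, n, n', ⟨e, rfl, h1, h2, h3⟩, h4⟩
    · rintro ⟨_, n, n', ⟨e, rfl, h1, h2, h3⟩, h4⟩
      exact ⟨e, n, n', h1, h2, h3, h4⟩

theorem Pat.below_undir (hν : FnIn ν) {x : Option Var} (hx : ∀ y ∈ x, y ≤ K) (l : Option Name) :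
    Below full ((Pat.undir x l).at g 𝒢 dec ν F E) := by
  have hEi : Num fun p : Ext (Ext β) => E p.a.a p.a.i := Num.app hE.w.w Num.v0.w
  have hFi : Num fun p : Ext (Ext β) => F p.a.a p.a.i := Num.app hF.w.w Num.v0.w
  have hFj : Num fun p : Ext (Ext β) => F p.a.a p.i := Num.app hF.w.w Num.v0
  have r : Ren fun p : Ext (Ext β) => p.a.a := Ren.a.comp Ren.a
  refine (below_step (full := full) (F := F) P hν hE g hx l (fun b e n n' => ∃ e',
    e = .undirected e' ∧ e' ∈ (𝒢 b g).undirEdges ∧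
      (((e, n) ∈ (𝒢 b g).src ∧ (e, n') ∈ (𝒢 b g).tgt) ∨
        ((e, n') ∈ (𝒢 b g).src ∧ (e, n) ∈ (𝒢 b g).tgt)))
    (((FO.at₁ (P.undir g) r hEi).and
      (((FO.at₂ (P.src g) r hEi hFi).and (FO.at₂ (P.tgt g) r hEi hFj)).or
        ((FO.at₂ (P.src g) r hEi hFj).and (FO.at₂ (P.tgt g) r hEi hFi)))).congr fun p => ?_)).congr
    fun b i _ j _ => ?_
  · constructor
    · rintro ⟨e, n, n', ⟨e', rfl, h1, ⟨h2, h3⟩ | ⟨h2, h3⟩⟩, h4, h5, h6⟩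
      · exact ⟨⟨e', h1, h5⟩, Or.inl ⟨⟨_, h2, h5, h4⟩, ⟨_, h3, h5, h6⟩⟩⟩
      · exact ⟨⟨e', h1, h5⟩, Or.inr ⟨⟨_, h2, h5, h6⟩, ⟨_, h3, h5, h4⟩⟩⟩
    · rintro ⟨⟨e', h1, h5⟩, ⟨⟨⟨e, n⟩, h2, h5', h4⟩, ⟨⟨e'', n'⟩, h3, h5'', h6⟩⟩ |
        ⟨⟨⟨e, n⟩, h2, h5', h4⟩, ⟨⟨e'', n'⟩, h3, h5'', h6⟩⟩⟩
      all_goals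
        obtain rfl : e = .undirected e' := by simpa using h5'.symm.trans h5
        obtain rfl : e'' = .undirected e' := by simpa using h5''.symm.trans h5
      · exact ⟨_, n, n', ⟨e', rfl, h1, Or.inl ⟨h2, h3⟩⟩, h4, h5, h6⟩
      · exact ⟨_, n', n, ⟨e', rfl, h1, Or.inr ⟨h2, h3⟩⟩, h6, h5, h4⟩
  · simp only [Pat.at, Pat.sem, Pat.sch, At, Set.mem_ofPred_eq]
    refine exists_congr fun p => and_congr_left fun _ => ?_
    constructor
    · rintro ⟨e, n, n', h1, h2, h4⟩
      exact ⟨_, n, n', ⟨e, rfl, h1, h2⟩, h4⟩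
    · rintro ⟨_, n, n', ⟨e, rfl, h1, h2⟩, h4⟩
      exact ⟨e, n, n', h1, h2, h4⟩

end steps

theorem covers_true (𝒢 : Database m) : Covers (fun _ => True) 𝒢 :=
  ⟨fun _ _ _ => trivial, fun _ _ _ => trivial, fun _ _ _ => trivial, fun _ _ _ => trivial,
    fun _ _ _ => trivial⟩

omit [Ctx β] in
theorem Pat.at_concat {π₁ π₂ : Pat m} (hb : (Pat.concat π₁ π₂).Basic)
    (hw : (Pat.concat π₁ π₂).WellFormed) (g : Fin m) (b : β) (i j : ℕ) :
    (Pat.concat π₁ π₂).at g 𝒢 dec ν F E b i j ↔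
      relComp (π₁.at g 𝒢 dec ν F E b) (π₂.at g 𝒢 dec ν F E b) i j := by
  unfold Pat.at
  rw [← at_comp]
  refine exists_congr fun p => and_congr_left fun _ => ?_
  simp only [Pat.sem, Set.mem_ofPred_eq, Prod.mk.injEq]
  constructor
  · rintro ⟨p₁, μ₁, p₂, μ₂, h1, h2, e, hc, rfl, hμ⟩
    obtain ⟨rfl, rfl⟩ := assign_eq_join (sem_over (covers_true _) π₁ g hb.2.1 hw.1 _ _ h1).2
      (sem_over (covers_true _) π₂ g hb.2.2 hw.2 _ _ h2).2 hc hμ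
    exact ⟨p₁, h1, p₂, h2, e, rfl⟩
  · rintro ⟨p₁, h1, p₂, h2, e, rfl⟩
    exact ⟨p₁, _, p₂, _, h1, h2, e, compatible_assign, rfl, join_assign.symm⟩

omit [Ctx β] in
theorem Pat.at_rep {π : Pat m} {i₀ : ℕ} {j₀ : ℕ∞} (hb : (Pat.rep π i₀ j₀).Basic)
    (hw : (Pat.rep π i₀ j₀).WellFormed) (g : Fin m) (b : β) (i j : ℕ) :
    (Pat.rep π i₀ j₀).at g 𝒢 dec ν F E b i j ↔
      ((Pat.node none none).at g 𝒢 dec ν F E b i j ∧ i₀ = 0) ∨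
      ∃ k : ℕ, i₀ ≤ k + 1 ∧ ((k + 1 : ℕ) : ℕ∞) ≤ j₀ ∧ relPow (π.at g 𝒢 dec ν F E b) k i j := by
  have hs : π.sch = ∅ := hb.1
  have he : assign (dec b) ∅ (ν b) = Assignment.empty := rfl
  have hR : {p | ∃ μ, (p, μ) ∈ π.sem (𝒢 b) g} =
      {p | (p, assign (dec b) π.sch (ν b)) ∈ π.sem (𝒢 b) g} := by
    ext p
    constructor
    · rintro ⟨μ, h⟩
      have := (sem_over (covers_true _) π g hb.2 hw.2 _ _ h).2
      rw [hs] at this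
      obtain rfl : μ = Assignment.empty := funext fun x => this.2 x (by simp)
      rw [Set.mem_ofPred_eq, hs]
      exact h
    · exact fun h => ⟨_, h⟩
  simp only [Pat.at, ← at_pathPow]
  rw [← hR]
  simp only [At, Pat.sem, Pat.sch, Set.mem_ofPred_eq, hs, he]
  constructor
  · rintro ⟨p, ⟨k, h1, h2, h3⟩, h⟩
    rcases k with _ | k
    · obtain ⟨n, hn, e⟩ := h3
      exact Or.inl ⟨⟨p, ⟨n, hn, by simp [PropertyGraph.Labelled], e⟩, h⟩, by omega⟩
    · exact Or.inr ⟨k, h1, h2, p, (mem_iterate_succ.1 h3).2, h⟩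
  · rintro (⟨⟨p, ⟨n, hn, -, e⟩, h⟩, rfl⟩ | ⟨k, h1, h2, p, hp, h⟩)
    · exact ⟨p, ⟨0, le_rfl, zero_le, n, hn, e⟩, h⟩
    · exact ⟨p, ⟨k + 1, h1, h2, mem_iterate_succ.2 ⟨rfl, hp⟩⟩, h⟩

theorem Pat.below_rep (P : Pres K 𝒢 dec M) (hν : FnIn ν) (hF : FnIn F) {π : Pat m} {i₀ : ℕ}
    {j₀ : ℕ∞} (hb : (Pat.rep π i₀ j₀).Basic) (hw : (Pat.rep π i₀ j₀).WellFormed) (g : Fin m)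
    (h : Below full (π.at g 𝒢 dec ν F E)) :
    Below full ((Pat.rep π i₀ j₀).at g 𝒢 dec ν F E) := by
  have hle : ∀ b i j, π.at g 𝒢 dec ν F E b i j → i ≤ j := fun _ _ _ h => At.le h
  refine (((Pat.below_node P hν hF g (x := none) (by simp) none).and (.const (i₀ = 0))).or
    (B := fun b i j => ∃ k : ℕ, i₀ ≤ k + 1 ∧ ((k + 1 : ℕ) : ℕ∞) ≤ j₀ ∧
      relPow (π.at g 𝒢 dec ν F E b) k i j) ?_).congr fun b i _ j _ => Pat.at_rep hb hw g b i j
  induction j₀ using ENat.recTopCoe with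
  | top =>
    have hst : ∀ b i j, Relation.ReflTransGen (π.at g 𝒢 dec ν F E b) i j → i ≤ j := by
      intro b i j h
      induction h with
      | refl => exact le_rfl
      | tail _ h ih => exact ih.trans (hle _ _ _ h)
    refine ((h.relPow hle (i₀ - 1)).1.comp (h.star hle) hst).congr fun b i _ j _ => ?_
    rw [← exists_relPow_iff]
    refine exists_congr fun k => ?_
    simp
  | coe n =>
    refine (Below.exists_lt n fun k => (h.relPow hle k).1.and
      (SO.const (i₀ ≤ k + 1))).congr fun b i _ j _ => exists_congr fun k => ?_
    rw [Nat.cast_le, Nat.succ_le_iff]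
    tauto

end

end GQL

namespace GQL

open Definability

/-! #### Tables -/

section
variable {β γ : Type} [Ctx β] [Ctx γ] {m K : ℕ} {𝒢 : β → Database m} {dec : β → ℕ → Value}
  {M : β → ℕ} {full : Bool} {S S' : Finset Var} {T T' : β → Table}

theorem DefTable.congr (h : DefTable full K dec S T) (e : ∀ b, T' b = T b) :
    DefTable full K dec S T' := by
  rwa [show T' = T from funext e]

theorem DefTable.ren (h : DefTable full K dec S T) {t : γ → β} (ht : Ren t) :
    DefTable full K (fun c => dec (t c)) S fun c => T (t c) where
  vars := h.vars
  dom c := ht.N_eq c ▸ h.dom (t c)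
  mem s hs ν hν := h.mem (fun c => t (s c)) (ht.comp hs) ν hν

theorem DefTable.empty (hS : ∀ x ∈ S, x ≤ K) : DefTable full K dec S fun _ => ∅ where
  vars := hS
  dom := by simp
  mem _ _ _ _ := (SO.const False).congr fun _ => by simp

theorem DefTable.inter (h : DefTable full K dec S T) (h' : DefTable full K dec S T') :
    DefTable full K dec S fun b => T b ∩ T' b where
  vars := h.vars
  dom b μ hμ := h.dom b μ hμ.1
  mem t ht ν hν := (h.mem t ht ν hν).and (h'.mem t ht ν hν)

theorem DefTable.union (h : DefTable full K dec S T) (h' : DefTable full K dec S T') :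
    DefTable full K dec S fun b => T b ∪ T' b where
  vars := h.vars
  dom b μ hμ := hμ.elim (h.dom b μ) (h'.dom b μ)
  mem t ht ν hν := (h.mem t ht ν hν).or (h'.mem t ht ν hν)

theorem DefTable.diff (hf : full = true) (h : DefTable full K dec S T)
    (h' : DefTable full K dec S T') : DefTable full K dec S fun b => T b \ T' b where
  vars := h.vars
  dom b μ hμ := h.dom b μ hμ.1
  mem t ht ν hν := (h.mem t ht ν hν).and ((h'.mem t ht ν hν).not hf)

theorem DefTable.filter (h : DefTable full K dec S T) {φ : β → Assignment → Prop}
    (hφ : ∀ {γ : Type} [Ctx γ] (t : γ → β), Ren t → ∀ ν : γ → ℕ → ℕ, FnIn ν →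
      SO full fun c => φ (t c) (assign (dec (t c)) S (ν c))) :
    DefTable full K dec S fun b => {μ ∈ T b | φ b μ} where
  vars := h.vars
  dom b μ hμ := h.dom b μ hμ.1
  mem t ht ν hν := (h.mem t ht ν hν).and (hφ t ht ν hν)

theorem DefTable.single (P : Pres K 𝒢 dec M) (hS : ∀ x ∈ S, x ≤ K) {ν : β → ℕ → ℕ}
    (hν : FnIn ν) : DefTable full K dec S fun b => {assign (dec b) S (ν b)} where
  vars := hS
  dom := by
    rintro b _ rfl
    exact over_assign (hν.le b)
  mem {γ} _ t ht ν' hν' := by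
    have : ∀ x ∈ S.toList, SO full fun c => dec (t c) (ν' c x) = dec (t c) (ν (t c) x) := by
      intro x hx
      have hn : Num fun _ : γ => x := (P.ren ht).num (hS x (Finset.mem_toList.1 hx))
      exact .fo (FO.at₂ P.eqV ht (Num.app hν' hn) (Num.app (hν.ren ht) hn))
    refine (SO.forall_list _ this).congr fun c => ?_
    simp only [Set.mem_singleton_iff, Finset.mem_toList]
    constructor
    · intro h x hx
      have := congrFun h x
      simpa [assign, hx] using this
    · intro h
      funext x
      by_cases hx : x ∈ S <;> simp [assign, hx]
      exact h x hx

theorem DefTable.nonempty (h : DefTable full K dec S T) : SO full fun b => (T b).Nonempty :=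
  (h.exists (φ := fun _ _ => True) fun _ _ _ _ => SO.const True).congr fun b => by
    simp [Set.Nonempty]

theorem DefTable.letEq (P : Pres K 𝒢 dec M) (g : Fin m) (h : DefTable full K dec S T) {x : Var}
    (hx : x ∉ S) (hxK : x ≤ K) {χ : Trm} (hχ : χ.vars ⊆ S) (hK : sizeOf χ ≤ K) :
    DefTable full K dec (insert x S) fun b =>
      {ν | ∃ μ ∈ T b, ∃ v ∈ χ.sem (𝒢 b g) μ, ν = Function.update μ x (some v)} where
  vars y hy := by
    rcases Finset.mem_insert.1 hy with rfl | hy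
    · exact hxK
    · exact h.vars y hy
  dom := by
    rintro b _ ⟨μ, hμ, v, hv, rfl⟩
    have hd := h.dom b μ hμ
    constructor
    · intro y hy
      by_cases hyx : y = x
      · subst hyx
        exact ⟨v, Trm.exists_code P g b hd χ hχ hK hv, by simp⟩
      · obtain ⟨v', h1, h2⟩ := hd.1 y (by simpa [hyx] using hy)
        exact ⟨v', h1, by simp [hyx, h2]⟩
    · intro y hy
      simp only [Finset.mem_insert, not_or] at hy
      simp [hy.1, hd.2 y hy.2]
  mem {γ} _ t ht ν hν := by
    have hn : Num fun _ : γ => x := (P.ren ht).num hxK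
    refine ((h.mem t ht ν hν).and (.fo (FO.at₁ (Trm.fo_mem (P.ren ht) g hν h.vars χ hχ) Ren.id
      (Num.app hν hn)))).congr fun c => ?_
    constructor
    · rintro ⟨μ, hμ, v, hv, e⟩
      have e1 : μ = assign (dec (t c)) S (ν c) := by
        funext y
        by_cases hyx : y = x
        · subst hyx
          simp [assign, hx, (h.dom _ μ hμ).2 y hx]
        · have := congrFun e y
          simpa [assign, hyx, eq_comm] using this
      have e2 : dec (t c) (ν c x) = v := by
        have := congrFun e x
        simpa [assign] using this
      subst e1 e2
      exact ⟨hμ, hv⟩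
    · rintro ⟨h1, h2⟩
      refine ⟨_, h1, _, h2, funext fun y => ?_⟩
      by_cases hyx : y = x
      · subst hyx
        simp [assign]
      · simp [assign, hyx]

theorem DefTable.ret (P : Pres K 𝒢 dec M) (g : Fin m) (h : DefTable full K dec S T)
    {items : List (Trm × Var)} (hi : ∀ i ∈ items, i.1.vars ⊆ S) (hK : sizeOf items ≤ K) :
    DefTable full K dec (items.map Prod.snd).toFinset fun b => {ν | ∃ μ ∈ T b,
      (∀ i ∈ items, ∃ v ∈ i.1.sem (𝒢 b g) μ, ν i.2 = some v) ∧
      (∀ x ∉ items.map Prod.snd, ν x = none)} := by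
  have hs : ∀ i ∈ items, sizeOf i.1 ≤ K ∧ @LE.le ℕ _ i.2 K := by
    rintro ⟨χ, x⟩ hi
    have := List.sizeOf_lt_of_mem hi
    rw [Prod.mk.sizeOf_spec] at this
    have hx : sizeOf x = x := rfl
    constructor <;> simp only <;> omega
  refine ⟨?_, ?_, ?_⟩
  · intro x hx
    obtain ⟨i, h1, rfl⟩ := List.mem_map.1 (List.mem_toFinset.1 hx)
    exact (hs i h1).2
  · rintro b ν ⟨μ, hμ, h1, h2⟩
    constructor
    · intro x hx
      obtain ⟨i, h3, rfl⟩ := List.mem_map.1 (List.mem_toFinset.1 hx)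
      obtain ⟨v, h4, h5⟩ := h1 i h3
      exact ⟨v, Trm.exists_code P g b (h.dom b μ hμ) i.1 (hi i h3) (hs i h3).1 h4, h5⟩
    · intro x hx
      exact h2 x (by simpa using hx)
  · intro γ _ t ht ν hν
    refine ((h.ren ht).exists (φ := fun c μ => ∀ i ∈ items,
      dec (t c) (ν c i.2) ∈ i.1.sem (𝒢 (t c) g) μ) ?_).congr fun c => ?_
    · intro δ _ s hs' ν' hν'
      refine SO.forall_list _ fun i hi' => .fo ?_
      have hn : Num fun _ : δ => i.2 := ((P.ren ht).ren hs').num (hs i hi').2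
      exact FO.at₁ (Trm.fo_mem ((P.ren ht).ren hs') g hν' h.vars i.1 (hi i hi')) Ren.id
        (Num.app (hν.ren hs') hn)
    · refine exists_congr fun μ => and_congr_right fun _ => ?_
      have hd : ∀ i ∈ items, i.2 ∈ (items.map Prod.snd).toFinset := fun i hi =>
        List.mem_toFinset.2 (List.mem_map_of_mem hi)
      constructor
      · rintro ⟨h1, -⟩ i hi
        obtain ⟨v, hv, e⟩ := h1 i hi
        simp only [assign, hd i hi, if_true, Option.some.injEq] at e
        exact e ▸ hv
      · intro h1
        refine ⟨fun i hi => ⟨_, h1 i hi, by simp only [assign, hd i hi, if_true]⟩, fun x hx => ?_⟩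
        have : x ∉ (items.map Prod.snd).toFinset := by rwa [List.mem_toFinset]
        simp only [assign, this, if_false]

/-! #### Graph patterns -/

/-- The condition on traces of a restrictor. -/
def modeCond (mode : Option PathMode) (dec : ℕ → Value) (F E : ℕ → ℕ) (L : ℕ) : Prop :=
  match mode with
  | none => True
  | some .trail => ∀ l < L, ∀ k < l, dec (E k) ≠ dec (E l)
  | some .acyclic => ∀ l ≤ L, ∀ k < l, dec (F k) ≠ dec (F l)

theorem Seg.mem_restrict {dec : ℕ → Value} {F E : ℕ → ℕ} {L : ℕ} {p : GPath}
    (h : Seg dec F E 0 L p) (mode : Option PathMode) (R : Set (GPath × Assignment))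
    (μ : Assignment) : (p, μ) ∈ restrict mode R ↔ (p, μ) ∈ R ∧ modeCond mode dec F E L := by
  rcases mode with _ | _ | _
  · simp [restrict, modeCond]
  · exact and_congr_right fun _ => h.nodup_edges
  · exact and_congr_right fun _ => h.nodup_nodes

theorem nodup_length_le {X : Type} {l : List X} (hn : l.Nodup) {M : ℕ} {dec : ℕ → Value}
    {f : X → Value} (hf : Function.Injective f) (h : ∀ x ∈ l, ∃ c < M, dec c = f x) :
    l.length ≤ M := by
  classical
  choose! c hc using h
  rw [← List.toFinset_card_of_nodup hn, ← Finset.card_range M]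
  refine Finset.card_le_card_of_injOn c (fun x hx => ?_) fun x hx y hy e => hf ?_
  · simpa using (hc x (by simpa using hx)).1
  · rw [← (hc x (by simpa using hx)).2, e, (hc y (by simpa using hy)).2]

theorem exists_short_restrict (P : Pres K 𝒢 dec M) (g : Fin m) {π : Pat m} (hb : π.Basic)
    (hw : π.WellFormed) (hK : sizeOf π ≤ K) (mode : Option PathMode) (b : β) {p : GPath}
    {μ : Assignment} (h : (p, μ) ∈ restrict mode (π.sem (𝒢 b) g)) :
    ∃ p', (p', μ) ∈ restrict mode (π.sem (𝒢 b) g) ∧ p'.len ≤ N b := by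
  have hN := P.le_N b
  rcases mode with _ | _ | _
  · obtain ⟨q, hq, -, -, hl⟩ := Pat.exists_short (P.covers b) (B := M b + K + 3) (by omega) π g hb hw
      (by omega) p μ h
    exact ⟨q, hq, hl.trans ((Nat.pow_le_pow_right (by omega) hK).trans (P.M_le b))⟩
  · refine ⟨p, h, ?_⟩
    have := nodup_length_le (dec := dec b) (M := M b) h.2 (f := fun e => .elem (.edge e))
      (fun _ _ e => by simpa using e) fun e he => by
        obtain ⟨s, hs, rfl⟩ := List.mem_map.1 he
        exact ((Pat.sem_over (P.covers b) π g hb hw p μ h.1).1.2 s hs).1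
    simp only [GPath.edges, List.length_map] at this
    simp only [GPath.len]
    omega
  · refine ⟨p, h, ?_⟩
    have := nodup_length_le (dec := dec b) (M := M b) h.2 (f := fun n => .elem (.node n))
      (fun _ _ e => by simpa using e) fun n hn => by
        have hc := (Pat.sem_over (P.covers b) π g hb hw p μ h.1).1
        rcases List.mem_cons.1 hn with rfl | hn
        · exact hc.1
        · obtain ⟨s, hs, rfl⟩ := List.mem_map.1 hn
          exact (hc.2 s hs).2
    simp only [GPath.nodes, List.length_cons, List.length_map] at this
    simp only [GPath.len]
    omega

theorem exists_shortest {R : Set (GPath × Assignment)} {p : GPath} {μ : Assignment}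
    (h : (p, μ) ∈ R) (shortest : Bool) : ∃ p', (p', μ) ∈ restrictShortest shortest R := by
  classical
  have hex : ∃ n, ∃ p', (p', μ) ∈ R ∧ p'.first = p.first ∧ p'.last = p.last ∧ p'.len = n :=
    ⟨_, p, h, rfl, rfl, rfl⟩
  obtain ⟨p', h1, h2, h3, h4⟩ := Nat.find_spec hex
  refine ⟨p', h1, fun _ q hq hf hl => ?_⟩
  rw [h4]
  exact Nat.find_min' hex ⟨q, hq, hf.trans h2, hl.trans h3, rfl⟩

theorem fo_modeCond (P : Pres K 𝒢 dec M) {F E : β → ℕ → ℕ} (hF : FnIn F) (hE : FnIn E)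
    {L : β → ℕ} (hL : Num L) (mode : Option PathMode) :
    FO fun b => modeCond mode (dec b) (F b) (E b) (L b) := by
  have r : Ren fun p : Ext (Ext β) => p.a.a := Ren.a.comp Ren.a
  rcases mode with _ | _ | _
  · exact FO.top
  · refine (FO.forall_le (φ := fun b l => l < L b → ∀ k ≤ N b, k < l → ¬ dec b (E b k) = dec b (E b l))
      ((FO.lt Num.v0.term hL.w).imp (FO.forall_le ((FO.lt Num.v0.term Num.v0.w).imp
      (FO.at₂ P.eqV r (Num.app hE.w.w Num.v0) (Num.app hE.w.w Num.v0.w)).not)))).congr fun b => ?_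
    have := hL.le b
    exact ⟨fun h l _ hl k _ hk => h l hl k hk, fun h l hl k hk => h l (by omega) hl k (by omega) hk⟩
  · refine (FO.forall_le (φ := fun b l => l ≤ L b → ∀ k ≤ N b, k < l → ¬ dec b (F b k) = dec b (F b l))
      ((FO.le Num.v0 hL.w.term).imp (FO.forall_le ((FO.lt Num.v0.term Num.v0.w).imp
      (FO.at₂ P.eqV r (Num.app hF.w.w Num.v0) (Num.app hF.w.w Num.v0.w)).not)))).congr fun b => ?_
    have := hL.le b
    exact ⟨fun h l _ hl k _ hk => h l hl k hk, fun h l hl k hk => h l (by omega) hl k (by omega) hk⟩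

theorem Pat.sch_le : ∀ (π : Pat m) (x : ℕ), x ∈ π.sch → x ≤ sizeOf π
  | .node y l, x, h | .fwd y l, x, h | .bwd y l, x, h | .undir y l, x, h => by
    obtain rfl : y = some x := by simpa [Pat.sch] using h
    have : sizeOf x = x := rfl
    simp only [Pat.node.sizeOf_spec, Pat.fwd.sizeOf_spec, Pat.bwd.sizeOf_spec,
      Pat.undir.sizeOf_spec, Option.some.sizeOf_spec]
    omega
  | .concat π₁ π₂, x, h => by
    rw [Pat.concat.sizeOf_spec]
    rcases Finset.mem_union.1 h with h | h
    · have := sch_le π₁ x h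
      omega
    · have := sch_le π₂ x h
      omega
  | .union π₁ π₂, x, h => by
    have := sch_le π₁ x h
    rw [Pat.union.sizeOf_spec]
    omega
  | .rep π i j, x, h => by
    have := sch_le π x h
    rw [Pat.rep.sizeOf_spec]
    omega
  | .filter π θ, x, h => by
    have := sch_le π x h
    rw [Pat.filter.sizeOf_spec]
    omega

theorem DefTable.pat (P : Pres K 𝒢 dec M) (g : Fin m) {π : Pat m} (hb : π.Basic)
    (hw : π.WellFormed) (hK : sizeOf π ≤ K) (hπ : ∀ {γ : Type} [Ctx γ] (t : γ → β), Ren t →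
      ∀ ν F E : γ → ℕ → ℕ, FnIn ν → FnIn F → FnIn E →
      Below full (π.at g (fun c => 𝒢 (t c)) (fun c => dec (t c)) ν F E))
    (shortest : Bool) (mode : Option PathMode) :
    DefTable full K dec π.sch fun b =>
      {μ | ∃ p, (p, μ) ∈ restrictShortest shortest (restrict mode (π.sem (𝒢 b) g))} where
  vars x hx := (Pat.sch_le π x hx).trans hK
  dom := by
    rintro b μ ⟨p, h, -⟩
    have h' : (p, μ) ∈ π.sem (𝒢 b) g := by
      rcases mode with _ | _ | _
      exacts [h, h.1, h.1]
    obtain ⟨h1, h2⟩ := (Pat.sem_over (P.covers b) π g hb hw p μ h').2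
    refine ⟨fun x hx => ?_, h2⟩
    obtain ⟨v, ⟨c, hc, e⟩, hv⟩ := h1 x hx
    have := P.le_N b
    exact ⟨v, ⟨c, by omega, e⟩, hv⟩
  mem {γ} _ t ht ν hν := by
    have r₁ : Ren fun p : γ × Rel => t p.1 := ht.comp Ren.fst
    have r₂ : Ren fun p : (γ × Rel) × Rel => t p.1.1 := r₁.comp Ren.fst
    have r₃ : Ren fun p : ((γ × Rel) × Rel) × Rel => t p.1.1.1 := r₂.comp Ren.fst
    have hF : FnIn fun p : ((γ × Rel) × Rel) × Rel => fnOf p.1.1.2 (N p.1.1.1) :=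
      FnIn.of_rel.r.r
    have hE : FnIn fun p : ((γ × Rel) × Rel) × Rel => fnOf p.1.2 (N p.1.1) := FnIn.of_rel.r
    have hL : Num fun p : ((γ × Rel) × Rel) × Rel => fnOf p.2 (N p.1) 0 :=
      Num.app FnIn.of_rel Definability.Num.zero
    refine (SO.exists_fn (φ := fun c F => ∃ E : ℕ → ℕ, (∀ i, E i ≤ N c) ∧ ∃ L : ℕ → ℕ,
      (∀ i, L i ≤ N c) ∧ (π.at g (fun c => 𝒢 (t c)) (fun c => dec (t c)) ν (fun _ => F)
        (fun _ => E) c 0 (L 0) ∧ modeCond mode (dec (t c)) F E (L 0)))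
      (SO.exists_fn (α := γ × Rel) (φ := fun c E => ∃ L : ℕ → ℕ, (∀ i, L i ≤ N c) ∧
        (π.at g (fun c => 𝒢 (t c)) (fun c => dec (t c)) ν (fun _ => fnOf c.2 (N c.1))
        (fun _ => E) c.1 0 (L 0) ∧ modeCond mode (dec (t c.1)) (fnOf c.2 (N c.1)) E (L 0)))
      (SO.exists_fn (α := (γ × Rel) × Rel) (φ := fun c L =>
        π.at g (fun c => 𝒢 (t c)) (fun c => dec (t c)) ν (fun _ => fnOf c.1.2 (N c.1.1))
        (fun _ => fnOf c.2 (N c.1)) c.1.1 0 (L 0) ∧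
        modeCond mode (dec (t c.1.1)) (fnOf c.1.2 (N c.1.1)) (fnOf c.2 (N c.1)) (L 0))
      (((hπ _ r₃ _ _ _ hν.r.r.r hF hE).apply Definability.Num.zero hL).and
        (.fo (fo_modeCond (P.ren r₃) hF hE hL mode)))))).congr fun c => ?_
    constructor
    · rintro ⟨p, h, -⟩
      obtain ⟨q, hq, hl⟩ := exists_short_restrict P g hb hw hK mode (t c) h
      have hq' : (q, assign (dec (t c)) π.sch (ν c)) ∈ π.sem (𝒢 (t c)) g := by
        rcases mode with _ | _ | _
        exacts [hq, hq.1, hq.1]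
      obtain ⟨F, E, h1, h2, h3⟩ := exists_seg (Pat.sem_over (P.covers (t c)) π g hb hw _ _ hq').1
      have hN := P.le_N (t c)
      rw [ht.N_eq] at hN hl
      refine ⟨F, fun i => ?_, E, fun i => ?_, fun _ => q.len, fun _ => hl, ⟨q, hq', h3⟩,
        ((h3.mem_restrict mode _ _).1 hq).2⟩
      · have := h1 i
        omega
      · have := h2 i
        omega
    · rintro ⟨F, -, E, -, L, -, ⟨p, hp, h⟩, hm⟩
      exact exists_shortest ((h.mem_restrict mode _ _).2 ⟨hp, hm⟩) shortest

end

/-! #### Queries -/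

section
variable {m K : ℕ} {full : Bool}

mutual

theorem Pat.below_at {β : Type} [Ctx β] {𝒢 : β → Database m} {dec : β → ℕ → Value} {M : β → ℕ}
    (P : Pres K 𝒢 dec M) {ν F E : β → ℕ → ℕ} (hν : FnIn ν) (hF : FnIn F) (hE : FnIn E) :
    ∀ (π : Pat m) (g : Fin m), π.Basic → π.WellFormed → (full = true ∨ π.Positive) →
      sizeOf π ≤ K → Below full (π.at g 𝒢 dec ν F E)
  | .node x l, g, _, _, _, hK =>
    Pat.below_node P hν hF g (fun y hy => (Pat.sch_le (.node x l) y (by simpa [Pat.sch] using hy)).trans hK) l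
  | .fwd x l, g, _, _, _, hK =>
    Pat.below_fwd P hF hE g hν (fun y hy => (Pat.sch_le (.fwd x l) y (by simpa [Pat.sch] using hy)).trans hK) l
  | .bwd x l, g, _, _, _, hK =>
    Pat.below_bwd P hF hE g hν (fun y hy => (Pat.sch_le (.bwd x l) y (by simpa [Pat.sch] using hy)).trans hK) l
  | .undir x l, g, _, _, _, hK =>
    Pat.below_undir P hF hE g hν (fun y hy => (Pat.sch_le (.undir x l) y (by simpa [Pat.sch] using hy)).trans hK) l
  | .concat π₁ π₂, g, hb, hw, hp, hK => by
    rw [Pat.concat.sizeOf_spec] at hK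
    exact ((Pat.below_at P hν hF hE π₁ g hb.2.1 hw.1 (hp.imp_right And.left) (by omega)).comp
      (Pat.below_at P hν hF hE π₂ g hb.2.2 hw.2 (hp.imp_right And.right) (by omega))
      fun _ _ _ h => At.le h).congr fun b i _ j _ => Pat.at_concat hb hw g b i j
  | .union π₁ π₂, g, hb, hw, hp, hK => by
    rw [Pat.union.sizeOf_spec] at hK
    refine ((Pat.below_at P hν hF hE π₁ g hb.1 hw.2.1 (hp.imp_right And.left) (by omega)).or
      (Pat.below_at P hν hF hE π₂ g hb.2 hw.2.2 (hp.imp_right And.right) (by omega))).congr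
      fun b i _ j _ => ?_
    simp only [Pat.at, At, Pat.sem, Pat.sch, ← hw.1, Set.mem_ofPred_eq, Set.mem_union, or_and_right,
      exists_or]
  | .rep π i j, g, hb, hw, hp, hK => by
    rw [Pat.rep.sizeOf_spec] at hK
    exact Pat.below_rep P hν hF hb hw g (Pat.below_at P hν hF hE π g hb.2 hw.2 hp (by omega))
  | .filter π θ, g, hb, hw, hp, hK => by
    rw [Pat.filter.sizeOf_spec] at hK
    refine ((Pat.below_at P hν hF hE π g hb.1 hw.1 (hp.imp_right And.left) (by omega)).and
      (Cond.so P hν θ g hb.2 hw.2 (hp.imp_right And.right) (by omega)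
        fun x hx => (Pat.sch_le π x hx).trans (by omega))).congr fun b i _ j _ => ?_
    simp only [Pat.at, At, Pat.sem, Pat.sch, Set.mem_ofPred_eq, and_right_comm (c := Seg _ _ _ _ _ _),
      exists_and_right]

theorem Cond.so {β : Type} [Ctx β] {𝒢 : β → Database m} {dec : β → ℕ → Value} {M : β → ℕ}
    (P : Pres K 𝒢 dec M) {ν : β → ℕ → ℕ} (hν : FnIn ν) {S : Finset Var} :
    ∀ (θ : Cond m) (g : Fin m), θ.Basic → θ.WellFormed S → (full = true ∨ θ.Positive) →
      sizeOf θ ≤ K → (∀ x ∈ S, x ≤ K) →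
      SO full fun b => θ.sem (𝒢 b) g (assign (dec b) S (ν b))
  | .eq χ₁ χ₂, g, _, hw, _, hK, hS => by
    rw [Cond.eq.sizeOf_spec] at hK
    refine .fo ((FO.exists_le (φ := fun b i => dec b i ∈ χ₁.sem (𝒢 b g) (assign (dec b) S (ν b)) ∧
      dec b i ∈ χ₂.sem (𝒢 b g) (assign (dec b) S (ν b))) ((Trm.fo_mem P g hν hS χ₁ hw.1).and
      (Trm.fo_mem P g hν hS χ₂ hw.2))).congr fun b => ?_)
    simp only [Cond.sem]
    constructor
    · rintro ⟨v, h1, h2⟩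
      obtain ⟨i, hi, rfl⟩ := Trm.exists_code P g b (over_assign (hν.le b)) χ₁ hw.1 (by omega) h1
      exact ⟨i, hi, h1, h2⟩
    · rintro ⟨i, -, h1, h2⟩
      exact ⟨_, h1, h2⟩
  | .hasLabel x l, g, _, hw, _, hK, hS => by
    have hw : x ∈ S := hw
    refine .fo ((FO.at₁ (P.label g l) Ren.id (Num.app hν (P.num (hS x hw)))).congr fun b => ?_)
    simp only [Cond.sem, assign, hw, if_true, Option.some.injEq]
    exact exists_congr fun a => and_comm
  | .or θ₁ θ₂, g, hb, hw, hp, hK, hS => by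
    rw [Cond.or.sizeOf_spec] at hK
    exact ((Cond.so P hν θ₁ g hb.1 hw.1 (hp.imp_right And.left) (by omega) hS).or
      (Cond.so P hν θ₂ g hb.2 hw.2 (hp.imp_right And.right) (by omega) hS)).congr
      fun b => by simp only [Cond.sem]
  | .and θ₁ θ₂, g, hb, hw, hp, hK, hS => by
    rw [Cond.and.sizeOf_spec] at hK
    exact ((Cond.so P hν θ₁ g hb.1 hw.1 (hp.imp_right And.left) (by omega) hS).and
      (Cond.so P hν θ₂ g hb.2 hw.2 (hp.imp_right And.right) (by omega) hS)).congr
      fun b => by simp only [Cond.sem]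
  | .not θ, g, hb, hw, hp, hK, hS => by
    rw [Cond.not.sizeOf_spec] at hK
    have hf : full = true := hp.elim id fun h => h.elim
    exact ((Cond.so P hν θ g hb hw (Or.inl hf) (by omega) hS).not hf).congr
      fun b => by simp only [Cond.sem]
  | .exist Q, g, hb, hw, hp, hK, hS => by
    rw [Cond.exist.sizeOf_spec] at hK
    exact (Query.table P Q g hb hw hp (by omega) (DefTable.single P hS hν)).nonempty.congr
      fun b => by simp only [Cond.sem]

theorem GPat.table {β : Type} [Ctx β] {𝒢 : β → Database m} {dec : β → ℕ → Value} {M : β → ℕ}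
    (P : Pres K 𝒢 dec M) :
    ∀ (ψ : GPat m) (g : Fin m), ψ.Basic → ψ.WellFormed → (full = true ∨ ψ.Positive) →
      sizeOf ψ ≤ K → DefTable full K dec ψ.sch fun b => {μ | ∃ p, (p, μ) ∈ ψ.sem (𝒢 b) g}
  | .pat shortest mode X π, g, hb, hw, hp, hK => by
    rw [GPat.pat.sizeOf_spec] at hK
    obtain ⟨rfl, hb⟩ := hb
    have h := DefTable.pat P g hb hw.2 (by omega) (fun t ht ν F E hν hF hE =>
      Pat.below_at (P.ren ht) hν hF hE π g hb hw.2 hp (by omega)) shortest mode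
    rw [show (GPat.pat shortest mode none π).sch = π.sch by simp [GPat.sch]]
    refine h.congr fun b => Set.ext fun μ => ?_
    have hj : ∀ (p : GPath) (μ : Assignment), μ.join (Assignment.bind none (.path p)) = μ := by
      intro p μ
      funext x
      simp [Assignment.join, Assignment.bind]
    simp only [GPat.sem, Set.mem_ofPred_eq, Prod.mk.injEq, hj]
    constructor
    · rintro ⟨_, p, μ', h, -, rfl⟩
      exact ⟨p, h⟩
    · rintro ⟨p, h⟩
      exact ⟨_, p, μ, h, rfl, rfl⟩
  | .join ψ₁ ψ₂, g, hb, hw, hp, hK => by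
    rw [GPat.join.sizeOf_spec] at hK
    refine ((GPat.table P ψ₁ g hb.1 hw.1 (hp.imp_right And.left) (by omega)).join
      (GPat.table P ψ₂ g hb.2 hw.2 (hp.imp_right And.right) (by omega))).congr
      fun b => Set.ext fun μ => ?_
    simp only [GPat.sem, Set.mem_ofPred_eq, Prod.mk.injEq]
    constructor
    · rintro ⟨_, p₁, μ₁, p₂, μ₂, h1, h2, hc, -, rfl⟩
      exact ⟨μ₁, ⟨p₁, h1⟩, μ₂, ⟨p₂, h2⟩, hc, rfl⟩
    · rintro ⟨μ₁, ⟨p₁, h1⟩, μ₂, ⟨p₂, h2⟩, hc, rfl⟩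
      exact ⟨_, p₁, μ₁, p₂, μ₂, h1, h2, hc, rfl, rfl⟩

theorem Clause.table {β : Type} [Ctx β] {𝒢 : β → Database m} {dec : β → ℕ → Value} {M : β → ℕ}
    (P : Pres K 𝒢 dec M) {S : Finset Var} {T : β → Table} :
    ∀ (C : Clause m) (g : Fin m), C.Basic → C.WellFormed S → (full = true ∨ C.Positive) →
      sizeOf C ≤ K → DefTable full K dec S T →
      DefTable full K dec (C.out S) fun b => C.sem (𝒢 b) g (T b)
  | .matching ψ, g, hb, hw, hp, hK, hT => by
    rw [Clause.matching.sizeOf_spec] at hK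
    refine (hT.join (GPat.table P ψ g hb hw hp (by omega))).congr fun b => Set.ext fun μ => ?_
    simp only [Clause.sem, Set.mem_ofPred_eq]
    constructor
    · rintro ⟨μ, hμ, p, μ', h⟩
      exact ⟨μ, hμ, μ', ⟨p, h.1⟩, h.2⟩
    · rintro ⟨μ, hμ, μ', ⟨p, h⟩, h'⟩
      exact ⟨μ, hμ, p, μ', h, h'⟩
  | .letEq x χ, g, _, hw, _, hK, hT => by
    rw [Clause.letEq.sizeOf_spec] at hK
    have hx : @LE.le ℕ _ x K := by
      have : sizeOf x = x := rfl
      omega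
    exact (hT.letEq P g hw.1 hx hw.2 (by omega)).congr fun b => by
      simp only [Clause.sem]
  | .forIn x y, g, _, hw, _, hK, hT => by
    rw [Clause.forIn.sizeOf_spec] at hK
    have hx : @LE.le ℕ _ x K := by
      have : sizeOf x = x := rfl
      omega
    refine (DefTable.empty (S := (Clause.forIn x y : Clause m).out S) fun z hz => ?_).congr
      fun b => Set.ext fun μ => ?_
    · rcases Finset.mem_insert.1 hz with rfl | hz
      · exact hx
      · exact hT.vars z hz
    · simp only [Clause.sem, Set.mem_ofPred_eq, Set.mem_empty_iff_false, iff_false]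
      rintro ⟨μ, hμ, v, -, h⟩
      obtain ⟨v', ⟨c, -, rfl⟩, e⟩ := (hT.dom b μ hμ).1 y hw.2
      rw [e] at h
      rcases P.simple b c with ⟨a, ha⟩ | ⟨a, ha⟩ <;> simp [ha] at h
  | .filter θ, g, hb, hw, hp, hK, hT => by
    rw [Clause.filter.sizeOf_spec] at hK
    exact (hT.filter (φ := fun b μ => θ.sem (𝒢 b) g μ) fun t ht ν hν =>
      Cond.so (P.ren ht) hν θ g hb hw hp (by omega) hT.vars).congr fun b => by
        simp only [Clause.sem]

theorem LinQuery.table {β : Type} [Ctx β] {𝒢 : β → Database m} {dec : β → ℕ → Value} {M : β → ℕ}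
    (P : Pres K 𝒢 dec M) {S : Finset Var} {T : β → Table} :
    ∀ (L : LinQuery m) (g : Fin m), L.Basic → L.WellFormed S → (full = true ∨ L.Positive) →
      sizeOf L ≤ K → DefTable full K dec S T →
      DefTable full K dec L.out fun b => L.sem (𝒢 b) g (T b)
  | .use g' L, g, hb, hw, hp, hK, hT => by
    rw [LinQuery.use.sizeOf_spec] at hK
    exact (LinQuery.table P L g' hb hw hp (by omega) hT).congr fun b => by simp only [LinQuery.sem]
  | .clause C L, g, hb, hw, hp, hK, hT => by
    rw [LinQuery.clause.sizeOf_spec] at hK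
    exact (LinQuery.table P L g hb.2 hw.2 (hp.imp_right And.right) (by omega)
      (Clause.table P C g hb.1 hw.1 (hp.imp_right And.left) (by omega) hT)).congr
      fun b => by simp only [LinQuery.sem]
  | .ret items, g, _, hw, _, hK, hT => by
    rw [LinQuery.ret.sizeOf_spec] at hK
    exact (hT.ret P g hw.2 (by omega)).congr fun b => by simp only [LinQuery.sem]

theorem Query.table {β : Type} [Ctx β] {𝒢 : β → Database m} {dec : β → ℕ → Value} {M : β → ℕ}
    (P : Pres K 𝒢 dec M) {S : Finset Var} {T : β → Table} :
    ∀ (Q : Query m) (g : Fin m), Q.Basic → Q.WellFormed S → (full = true ∨ Q.Positive) →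
      sizeOf Q ≤ K → DefTable full K dec S T →
      DefTable full K dec Q.out fun b => Q.sem (𝒢 b) g (T b)
  | .lin L, g, hb, hw, hp, hK, hT => by
    rw [Query.lin.sizeOf_spec] at hK
    exact (LinQuery.table P L g hb hw hp (by omega) hT).congr fun b => by simp only [Query.sem]
  | .use g' s, g, hb, hw, hp, hK, hT => by
    rw [Query.use.sizeOf_spec] at hK
    exact (QuerySeq.table P s g' hb hw hp (by omega) hT).congr fun b => by simp only [Query.sem]
  | .intersect Q₁ Q₂, g, hb, hw, hp, hK, hT => by
    rw [Query.intersect.sizeOf_spec] at hK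
    have h₂ := Query.table P Q₂ g hb.2 hw.2.2 (hp.imp_right And.right) (by omega) hT
    rw [← hw.1] at h₂
    exact ((Query.table P Q₁ g hb.1 hw.2.1 (hp.imp_right And.left) (by omega) hT).inter h₂).congr
      fun b => by simp only [Query.sem]
  | .union Q₁ Q₂, g, hb, hw, hp, hK, hT => by
    rw [Query.union.sizeOf_spec] at hK
    have h₂ := Query.table P Q₂ g hb.2 hw.2.2 (hp.imp_right And.right) (by omega) hT
    rw [← hw.1] at h₂
    exact ((Query.table P Q₁ g hb.1 hw.2.1 (hp.imp_right And.left) (by omega) hT).union h₂).congr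
      fun b => by simp only [Query.sem]
  | .except Q₁ Q₂, g, hb, hw, hp, hK, hT => by
    rw [Query.except.sizeOf_spec] at hK
    have hf : full = true := hp.elim id fun h => h.elim
    have h₂ := Query.table P Q₂ g hb.2 hw.2.2 (Or.inl hf) (by omega) hT
    rw [← hw.1] at h₂
    exact ((Query.table P Q₁ g hb.1 hw.2.1 (Or.inl hf) (by omega) hT).diff hf h₂).congr
      fun b => by simp only [Query.sem]

theorem QuerySeq.table {β : Type} [Ctx β] {𝒢 : β → Database m} {dec : β → ℕ → Value} {M : β → ℕ}
    (P : Pres K 𝒢 dec M) {S : Finset Var} {T : β → Table} :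
    ∀ (s : QuerySeq m) (g : Fin m), s.Basic → s.WellFormed S → (full = true ∨ s.Positive) →
      sizeOf s ≤ K → DefTable full K dec S T →
      DefTable full K dec s.out fun b => s.sem (𝒢 b) g (T b)
  | .single Q, g, hb, hw, hp, hK, hT => by
    rw [QuerySeq.single.sizeOf_spec] at hK
    exact (Query.table P Q g hb hw hp (by omega) hT).congr fun b => by simp only [QuerySeq.sem]
  | .cons Q s, g, hb, hw, hp, hK, hT => by
    rw [QuerySeq.cons.sizeOf_spec] at hK
    exact (QuerySeq.table P s g hb.2 hw.2 (hp.imp_right And.right) (by omega)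
      (Query.table P Q g hb.1 hw.1 (hp.imp_right And.left) (by omega) hT)).congr
      fun b => by simp only [QuerySeq.sem]

end

theorem Query.so_nonempty {β : Type} [Ctx β] {𝒢 : β → Database m} {dec : β → ℕ → Value}
    {M : β → ℕ} (P : Pres K 𝒢 dec M) {Q : Query m} (g : Fin m) (hb : Q.Basic)
    (hw : Q.WellFormed ∅) (hp : full = true ∨ Q.Positive) (hK : sizeOf Q ≤ K) :
    SO full fun b => (Q.output (𝒢 b) g).Nonempty := by
  have h0 : FnIn fun (_ : β) (_ : ℕ) => 0 :=
    ⟨(FO.eq Num.v0.term Definability.Num.zero).congr fun p => eq_comm, fun _ _ => Nat.zero_le _⟩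
  exact (Query.table P Q g hb hw hp hK (DefTable.single P (by simp) h0)).nonempty

end

end GQL

/-! ### Reading encodings of databases -/

namespace GQL

open Definability
open Complexity (Word delimit)

/-- A self-delimiting code together with its decoder. -/
structure Reader (X : Type) where
  enc : X → Word
  read : Word → X
  len : Word → ℕ
  read_enc : ∀ x y, read (enc x ++ y) = x
  len_enc : ∀ x y, len (enc x ++ y) = (enc x).length
  eq : ∀ u, len u ≤ u.length → u = enc (read u) ++ u.drop (len u)

namespace Reader

/-- The reader of names. -/
def name : Reader Name where
  enc := delimit
  read := readName
  len u := 2 * (readName u).length + 1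
  read_enc := readName_delimit
  len_enc x y := by rw [readName_delimit, delimit_length]
  eq u := by
    fun_induction readName u with
    | case1 b r ih =>
      intro h
      have := ih (by simp at h ⊢; omega)
      simp only [List.length_cons, Nat.mul_add, delimit, List.flatMap_cons] at this ⊢
      simpa using this
    | case2 => simp
    | case3 W h1 h2 =>
      intro h
      match W, h1, h2 with
      | [], _, _ => simp at h
      | false :: r, _, _ => simp [delimit]
      | [true], _, h2 => exact absurd rfl h2
      | true :: b :: r, h1, _ => exact absurd rfl (h1 b r)

/-- The reader of edges. -/
def edge : Reader Edge where
  enc := encodeEdge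
  read u := if u.getD 0 false then .directed (readName (u.drop 1))
    else .undirected (readName (u.drop 1))
  len u := 1 + name.len (u.drop 1)
  read_enc x y := by cases x <;> simp [encodeEdge, readName_delimit]
  len_enc x y := by
    cases x <;> simp [encodeEdge, name, readName_delimit, delimit_length] <;> omega
  eq u h := by
    rcases u with _ | ⟨b, u⟩
    · simp at h
    · have := name.eq u (by simp at h; omega)
      rw [add_comm 1, List.drop_succ_cons]
      cases b <;> exact congrArg (_ :: ·) this

/-- The reader of graph elements. -/
def elem : Reader Elem where
  enc := encodeElem
  read u := if u.getD 0 false then .node (readName (u.drop 1)) else .edge (edge.read (u.drop 1))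
  len u := if u.getD 0 false then 1 + name.len (u.drop 1) else 1 + edge.len (u.drop 1)
  read_enc x y := by
    cases x with
    | node n => simp [encodeElem, readName_delimit]
    | edge e => simpa [encodeElem] using! edge.read_enc e y
  len_enc x y := by
    cases x with
    | node n => simp [encodeElem, name, readName_delimit, delimit_length]; omega
    | edge e =>
      have : edge.len (encodeEdge e ++ y) = (encodeEdge e).length := edge.len_enc e y
      simp [encodeElem, this]
      omega
  eq u h := by
    rcases u with _ | ⟨b, u⟩
    · simp [edge] at h
    · cases b
      · simp only [List.getD_cons_zero, Bool.false_eq_true, if_false, List.drop_succ_cons,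
          List.drop_zero, List.length_cons] at h ⊢
        have := edge.eq u (by omega)
        rw [add_comm 1, List.drop_succ_cons]
        exact congrArg (_ :: ·) this
      · simp only [List.getD_cons_zero, if_true, List.drop_succ_cons,
          List.drop_zero, List.length_cons] at h ⊢
        have := name.eq u (by omega)
        rw [add_comm 1, List.drop_succ_cons]
        exact congrArg (_ :: ·) this

/-- The reader of pairs. -/
def seq {X Y : Type} (r : Reader X) (s : Reader Y) : Reader (X × Y) where
  enc x := r.enc x.1 ++ s.enc x.2
  read u := (r.read u, s.read (u.drop (r.len u)))
  len u := r.len u + s.len (u.drop (r.len u))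
  read_enc x y := by
    rw [List.append_assoc, r.read_enc, r.len_enc, List.drop_left, s.read_enc]
  len_enc x y := by
    rw [List.append_assoc, r.len_enc, List.drop_left, s.len_enc, List.length_append]
  eq u h := by
    have h1 := r.eq u (by omega)
    have h2 := s.eq (u.drop (r.len u)) (by rw [List.length_drop]; omega)
    rw [List.drop_drop] at h2
    rw [List.append_assoc, ← h2]
    exact h1

theorem take {X : Type} (r : Reader X) {u : Word} (h : r.len u ≤ u.length) :
    u.take (r.len u) = r.enc (r.read u) := by
  have h1 := r.eq u h
  have h2 := r.len_enc (r.read u) (u.drop (r.len u))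
  rw [← h1] at h2
  generalize r.read u = x at *
  generalize u.drop (r.len u) = y at h1
  rw [h2, h1, List.take_left]

/-- The length of a reader is a definable function of definable bit strings. -/
def DefLen {X : Type} (r : Reader X) : Prop :=
  ∀ {β : Type} [Ctx β] {u : β → Word}, WordIn u → Term fun b => r.len (u b)

end Reader

/-- The length of the item at the beginning of a bit string, in a section of kind `k`. -/
def itemLen (k : ℕ) : Word → ℕ :=
  if k < 3 then Reader.name.len
  else if k < 5 then (Reader.edge.seq .name).len
  else if k < 6 then (Reader.elem.seq (.seq .name .name)).len
  else (Reader.elem.seq .name).len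

/-! #### Division of a bit string into items -/

/-- A division of the beginning of `V` into tokens: the items of the sections `0, …, S - 1`, and the
ends of the sections. Token number `i` starts at `pos i` and belongs to section `sec i`. -/
structure Division (V : Word) (e S : ℕ) (pos sec : ℕ → ℕ) (n : ℕ) : Prop where
  pos_zero : pos 0 = 0
  sec_zero : sec 0 = 0
  pos_end : pos n = e
  sec_end : sec n = S
  step : ∀ i < n, pos i < e ∧ pos (i + 1) ≤ e ∧ sec i < S ∧
    ((V.getD (pos i) false = true ∧ sec (i + 1) = sec i ∧ ∀ k < 7, ∀ g, sec i = 7 * g + k →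
      pos (i + 1) = pos i + 1 + itemLen k (V.drop (pos i + 1))) ∨
    (¬ V.getD (pos i) false = true ∧ sec (i + 1) = sec i + 1 ∧ pos (i + 1) = pos i + 1))

/-- Token number `i` is an item of section `s`. -/
def IsItem (V : Word) (pos sec : ℕ → ℕ) (n s i : ℕ) : Prop :=
  i < n ∧ sec i = s ∧ V.getD (pos i) false = true

open Classical in
/-- The items of section `s`. -/
noncomputable def section' {X : Type} (r : Reader X) (V : Word) (pos sec : ℕ → ℕ) (n s : ℕ) :
    Finset X :=
  ((Finset.range n).filter (IsItem V pos sec n s)).image fun i => r.read (V.drop (pos i + 1))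

theorem mem_section' {X : Type} {r : Reader X} {V : Word} {pos sec : ℕ → ℕ} {n s : ℕ} {x : X} :
    x ∈ section' r V pos sec n s ↔ ∃ i, IsItem V pos sec n s i ∧ r.read (V.drop (pos i + 1)) = x := by
  classical
  simp only [section', Finset.mem_image, Finset.mem_filter, Finset.mem_range]
  exact exists_congr fun i => ⟨fun ⟨⟨_, h⟩, e⟩ => ⟨h, e⟩, fun ⟨h, e⟩ => ⟨⟨h.1, h⟩, e⟩⟩

/-- The database that a division into items describes. -/
noncomputable def readDatabase (m : ℕ) (V : Word) (pos sec : ℕ → ℕ) (n : ℕ) : Database m := fun g =>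
  { nodes := section' .name V pos sec n (7 * g)
    dirEdges := section' .name V pos sec n (7 * g + 1)
    undirEdges := section' .name V pos sec n (7 * g + 2)
    src := section' (Reader.edge.seq .name) V pos sec n (7 * g + 3)
    tgt := section' (Reader.edge.seq .name) V pos sec n (7 * g + 4)
    property := section' (Reader.elem.seq (.seq .name .name)) V pos sec n (7 * g + 5)
    label := section' (Reader.elem.seq .name) V pos sec n (7 * g + 6) }

theorem drop_take_eq_cons {V : Word} {p q e : ℕ} (h : p < q) (hq : q ≤ e) (he : e ≤ V.length) :
    (V.take e).drop p = V.getD p false :: ((V.drop (p + 1)).take (q - (p + 1)) ++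
      (V.take e).drop q) := by
  have h1 : p < V.length := by omega
  rw [List.drop_take, List.drop_eq_getElem_cons h1, show e - p = e - p - 1 + 1 by omega,
    List.take_succ_cons, List.getD_eq_getElem _ _ h1, List.drop_take,
    show e - p - 1 = (q - (p + 1)) + (e - q) by omega, List.take_add, List.drop_drop,
    show p + 1 + (q - (p + 1)) = q by omega]

theorem Division.exists_lists {V : Word} {e S : ℕ} {pos sec : ℕ → ℕ} {n : ℕ}
    (h : Division V e S pos sec n) (he : e ≤ V.length) : ∃ I : ℕ → List ℕ,
      (∀ s i, i ∈ I s ↔ IsItem V pos sec n s i) ∧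
      V.take e = (List.range S).flatMap fun s => encodeList (fun i =>
        (V.drop (pos i + 1)).take (pos (i + 1) - (pos i + 1))) (I s) := by
  have key : ∀ d i, i + d = n → sec i ≤ S ∧ ∃ I : ℕ → List ℕ,
      (∀ s j, j ∈ I s ↔ i ≤ j ∧ IsItem V pos sec n s j) ∧ (∀ s < sec i, I s = []) ∧
      (V.take e).drop (pos i) = (List.range' (sec i) (S - sec i)).flatMap fun s =>
        encodeList (fun i => (V.drop (pos i + 1)).take (pos (i + 1) - (pos i + 1))) (I s) := by
    intro d
    induction d with
    | zero =>
      rintro i rfl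
      have h1 := h.pos_end
      have h2 := h.sec_end
      simp only [Nat.add_zero] at h1 h2
      refine ⟨h2.le, fun _ => [], fun s j => ?_, fun _ _ => rfl, ?_⟩
      · simp only [List.not_mem_nil, false_iff, not_and]
        intro h1 h2
        exact absurd h2.1 (by omega)
      · simp [h1, h2]
    | succ d ih =>
      intro i hi
      obtain ⟨hS, I, hI, hI', hd⟩ := ih (i + 1) (by omega)
      obtain ⟨h1, h2, h6, ⟨h3, h4, h5⟩ | ⟨h3, h4, h5⟩⟩ := h.step i (by omega)
      · have hlt : pos i < pos (i + 1) := by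
          have := h5 (sec i % 7) (Nat.mod_lt _ (by omega)) (sec i / 7) (by omega)
          omega
        rw [h4] at hS hd hI'
        refine ⟨hS, Function.update I (sec i) (i :: I (sec i)), fun s j => ?_, fun s hs => ?_, ?_⟩
        · by_cases hs : s = sec i
          · subst hs
            simp only [Function.update_self, List.mem_cons, hI]
            constructor
            · rintro (rfl | ⟨h6, h7⟩)
              · exact ⟨le_rfl, by omega, rfl, h3⟩
              · exact ⟨by omega, h7⟩
            · rintro ⟨h6, h7⟩
              rcases h6.eq_or_lt with rfl | h6
              · exact Or.inl rfl
              · exact Or.inr ⟨h6, h7⟩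
          · rw [Function.update_of_ne hs, hI]
            refine and_congr_left fun h7 => ?_
            have : j ≠ i := by
              rintro rfl
              exact hs h7.2.1.symm
            omega
        · rw [Function.update_of_ne (by omega)]
          exact hI' s hs
        · rw [drop_take_eq_cons hlt h2 he, hd, h3, show S - sec i = S - sec i - 1 + 1 by omega,
            List.range'_succ, List.flatMap_cons, List.flatMap_cons, Function.update_self]
          simp only [encodeList, List.flatMap_cons, List.cons_append, List.append_assoc]
          congr 4
          refine List.flatMap_congr fun s hs => ?_
          rw [Function.update_of_ne (by simp at hs; omega)]
      · rw [h4] at hS hd hI'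
        refine ⟨by omega, I, fun s j => ?_, fun s hs => hI' s (by omega), ?_⟩
        · rw [hI]
          refine and_congr_left fun h7 => ?_
          have : j ≠ i := by
            rintro rfl
            exact h3 h7.2.2
          omega
        · rw [drop_take_eq_cons (q := pos (i + 1)) (by omega) h2 he, hd, Bool.eq_false_iff.2 h3,
            show S - sec i = S - (sec i + 1) + 1 by omega, List.range'_succ, List.flatMap_cons,
            hI' (sec i) (by omega), h5]
          simp [encodeList]
  obtain ⟨-, I, h1, -, h2⟩ := key n 0 (by omega)
  refine ⟨I, fun s i => by simpa using h1 s i, ?_⟩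
  rw [h.pos_zero, h.sec_zero] at h2
  simpa [List.range_eq_range'] using h2

theorem flatMap_range_mul {α : Type} (a m : ℕ) (f : ℕ → List α) :
    (List.range (a * m)).flatMap f =
      (List.range m).flatMap fun g => (List.range a).flatMap fun k => f (a * g + k) := by
  induction m with
  | zero => simp
  | succ m ih =>
    rw [Nat.mul_succ, List.range_add, List.flatMap_append, ih, List.range_succ,
      List.flatMap_append, List.flatMap_map]
    simp

theorem encodeList_map {α β : Type} (enc : β → Word) (f : α → β) (l : List α) :
    encodeList enc (l.map f) = encodeList (fun a => enc (f a)) l := by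
  simp [encodeList, List.flatMap_map]

/-- A division describes a database that the divided bit string encodes. -/
theorem Division.isEncoding {V : Word} {e m : ℕ} {pos sec : ℕ → ℕ} {n : ℕ}
    (h : Division V e (7 * m) pos sec n) (he : e ≤ V.length) :
    (readDatabase m V pos sec n).IsEncoding (V.take e) := by
  obtain ⟨I, hI, hV⟩ := h.exists_lists he
  have aux : ∀ {X : Type} (r : Reader X) (k g : ℕ), k < 7 → itemLen k = r.len →
      encodeList (fun i => (V.drop (pos i + 1)).take (pos (i + 1) - (pos i + 1))) (I (7 * g + k)) =
      encodeList r.enc ((I (7 * g + k)).map fun i => r.read (V.drop (pos i + 1))) := by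
    intro X r k g hk hr
    rw [encodeList_map, encodeList, encodeList]
    congr 1
    refine List.flatMap_congr fun i hi => ?_
    obtain ⟨h1, h2, h3⟩ := (hI _ _).1 hi
    obtain ⟨h4, h5, -, ⟨-, -, h6⟩ | ⟨h6, -⟩⟩ := h.step i h1
    · have h7 := h6 k hk g h2
      rw [hr] at h7
      rw [← r.take (by rw [List.length_drop]; omega), h7]
      simp
    · exact absurd h3 h6
  have mem : ∀ {X : Type} (r : Reader X) (s : ℕ) (a : X),
      a ∈ (I s).map (fun i => r.read (V.drop (pos i + 1))) ↔ a ∈ section' r V pos sec n s := by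
    intro X r s a
    simp [mem_section', hI]
  refine ⟨fun g => (List.range 7).flatMap fun k => encodeList (fun i =>
    (V.drop (pos i + 1)).take (pos (i + 1) - (pos i + 1))) (I (7 * g + k)), fun g => ?_, ?_⟩
  · refine ⟨_, _, _, _, _, _, _, mem .name _, mem .name _, mem .name _, mem (Reader.edge.seq .name) _,
      mem (Reader.edge.seq .name) _, mem (Reader.elem.seq (.seq .name .name)) _,
      mem (Reader.elem.seq .name) _, ?_⟩
    have h0 := aux .name 0 g (by omega) rfl
    have h1 := aux .name 1 g (by omega) rfl
    have h2 := aux .name 2 g (by omega) rfl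
    have h3 := aux (Reader.edge.seq .name) 3 g (by omega) rfl
    have h4 := aux (Reader.edge.seq .name) 4 g (by omega) rfl
    have h5 := aux (Reader.elem.seq (.seq .name .name)) 5 g (by omega) rfl
    have h6 := aux (Reader.elem.seq .name) 6 g (by omega) rfl
    simp only [List.range_succ, List.range_zero, List.nil_append, List.flatMap_append,
      List.flatMap_cons, List.flatMap_nil, List.append_nil, h0, h1, h2, h3, h4, h5, h6]
    simp only [Reader.seq, Reader.name, Reader.edge, Reader.elem, List.append_assoc, Nat.add_zero]
  · rw [hV, flatMap_range_mul, List.flatMap_def]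
    congr 1
    apply List.ext_getElem <;> simp

end GQL

namespace GQL

open Definability
open Complexity (Word delimit)

/-! #### Divisions of encodings -/

/-- The tokens of the first `S` sections with the items `Ls`. -/
def tokens (Ls : ℕ → List Word) (S : ℕ) : List (Option Word) :=
  (List.range S).flatMap fun s => (Ls s).map some ++ [none]

/-- The code of a token. -/
def tokenCode : Option Word → Word
  | some c => true :: c
  | none => [false]

theorem tokens_succ (Ls : ℕ → List Word) (S : ℕ) :
    tokens Ls (S + 1) = tokens Ls S ++ ((Ls S).map some ++ [none]) := by
  simp [tokens, List.range_succ]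

theorem count_map_some (l : List Word) : (l.map some).count none = 0 := by
  simp [List.count_eq_zero]

theorem count_tokens (Ls : ℕ → List Word) (S : ℕ) : (tokens Ls S).count none = S := by
  induction S with
  | zero => rfl
  | succ S ih => rw [tokens_succ, List.count_append, List.count_append, ih, count_map_some]; rfl

theorem tokens_flatMap (Ls : ℕ → List Word) (S : ℕ) :
    (tokens Ls S).flatMap tokenCode = (List.range S).flatMap fun s => encodeList id (Ls s) := by
  simp only [tokens, List.flatMap_assoc]
  refine List.flatMap_congr fun s _ => ?_
  simp [encodeList, tokenCode, List.flatMap_map]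

theorem of_tokens_eq {Ls : ℕ → List Word} {S : ℕ} {a b : List (Option Word)} {t : Option Word}
    (h : tokens Ls S = a ++ t :: b) : a.count none < S ∧ ∀ c, t = some c → c ∈ Ls (a.count none) := by
  induction S generalizing b with
  | zero => simp [tokens] at h
  | succ S ih =>
    rw [tokens_succ] at h
    have last : ∀ a', a = tokens Ls S ++ a' → (Ls S).map some ++ [none] = a' ++ t :: b →
        a.count none < S + 1 ∧ ∀ c, t = some c → c ∈ Ls (a.count none) := by
      rintro a' rfl h'
      have h0 : a'.count none = 0 := by
        rcases List.append_eq_append_iff.1 h' with ⟨d, h1, h2⟩ | ⟨d, h1, h2⟩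
        · rcases d with _ | ⟨x, d⟩
          · rw [h1, List.append_nil, count_map_some]
          · simp at h2
        · have := count_map_some (Ls S)
          rw [h1, List.count_append] at this
          omega
      rw [List.count_append, count_tokens, h0]
      refine ⟨by omega, ?_⟩
      rintro c rfl
      have : some c ∈ (Ls S).map some ++ [none] := by rw [h']; simp
      simpa using this
    rcases List.append_eq_append_iff.1 h with ⟨d, h1, h2⟩ | ⟨d, h1, h2⟩
    · exact last d h1 h2
    · rcases d with _ | ⟨x, d⟩
      · exact last [] (by simpa using h1.symm) (by simpa using h2.symm)
      · rw [List.cons_append, List.cons.injEq] at h2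
        obtain ⟨h3, h4⟩ := ih (b := d) (by rw [h1, h2.1])
        exact ⟨by omega, h4⟩

theorem exists_tokens_eq {Ls : ℕ → List Word} {S s : ℕ} (hs : s < S) {c : Word} (hc : c ∈ Ls s) :
    ∃ a b, tokens Ls S = a ++ some c :: b ∧ a.count none = s := by
  induction S with
  | zero => omega
  | succ S ih =>
    rw [tokens_succ]
    rcases (Nat.lt_succ_iff.1 hs).lt_or_eq with h | rfl
    · obtain ⟨a, b, h1, h2⟩ := ih h
      exact ⟨a, b ++ ((Ls S).map some ++ [none]), by simp [h1], h2⟩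
    · obtain ⟨l, l', e⟩ := List.append_of_mem hc
      refine ⟨tokens Ls s ++ l.map some, l'.map some ++ [none], by simp [e], ?_⟩
      rw [List.count_append, count_tokens, count_map_some, Nat.add_zero]

/-- The concatenation of the codes of sections can be divided. -/
theorem exists_division (Ls : ℕ → List Word) (S : ℕ) {w : Word}
    (hw : w = (List.range S).flatMap fun s => encodeList id (Ls s)) (τ : Word)
    (hlen : ∀ k < 7, ∀ g, ∀ c ∈ Ls (7 * g + k), ∀ y, itemLen k (c ++ y) = c.length) :
    ∃ (pos sec : ℕ → ℕ) (n : ℕ), Division (w ++ τ) w.length S pos sec n ∧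
      (∀ i, pos i ≤ w.length) ∧ (∀ i, sec i ≤ S) ∧ n ≤ w.length ∧
      (∀ s i, IsItem (w ++ τ) pos sec n s i → s < S ∧ ∃ c ∈ Ls s, ∃ y,
        (w ++ τ).drop (pos i + 1) = c ++ y) ∧
      ∀ s < S, ∀ c ∈ Ls s, ∃ i, IsItem (w ++ τ) pos sec n s i ∧ ∃ y,
        (w ++ τ).drop (pos i + 1) = c ++ y := by
  rw [← tokens_flatMap] at hw
  set pos : ℕ → ℕ := fun i => (((tokens Ls S).take i).flatMap tokenCode).length with hpos
  set sec : ℕ → ℕ := fun i => ((tokens Ls S).take i).count none with hsec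
  have split : ∀ i < (tokens Ls S).length, ∃ t b, tokens Ls S = (tokens Ls S).take i ++ t :: b ∧
      pos (i + 1) = pos i + (tokenCode t).length ∧ sec (i + 1) = sec i + [t].count none ∧
      (w ++ τ).drop (pos i) = tokenCode t ++ (b.flatMap tokenCode ++ τ) ∧
      pos (i + 1) ≤ w.length := by
    intro i hi
    have e : tokens Ls S = (tokens Ls S).take i ++ (tokens Ls S)[i] :: (tokens Ls S).drop (i + 1) := by
      rw [← List.drop_eq_getElem_cons hi, List.take_append_drop]
    have e1 : (tokens Ls S).take (i + 1) = (tokens Ls S).take i ++ [(tokens Ls S)[i]] := by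
      rw [List.take_concat_get' _ _ hi]
    have e2 : w = ((tokens Ls S).take i).flatMap tokenCode ++ (tokenCode (tokens Ls S)[i] ++
        ((tokens Ls S).drop (i + 1)).flatMap tokenCode) := by
      rw [hw]
      conv_lhs => rw [e]
      rw [List.flatMap_append, List.flatMap_cons]
    refine ⟨_, _, e, ?_, ?_, ?_, ?_⟩
    · simp only [hpos, e1, List.flatMap_append, List.length_append, List.flatMap_cons,
        List.flatMap_nil, List.append_nil]
    · simp only [hsec, e1, List.count_append]
    · rw [e2, List.append_assoc, List.drop_left, List.append_assoc]
    · simp only [hpos, e1, List.flatMap_append, List.flatMap_cons, List.flatMap_nil,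
        List.append_nil]
      rw [e2]
      simp only [List.length_append]
      omega
  have get : ∀ {p : ℕ} {b : Bool} {u : Word}, (w ++ τ).drop p = b :: u →
      (w ++ τ).getD p false = b ∧ (w ++ τ).drop (p + 1) = u := by
    intro p b u h
    constructor
    · rw [← Nat.add_zero p, ← getD_drop, h]; rfl
    · rw [← List.drop_drop, h]; rfl
  have item : ∀ s i, IsItem (w ++ τ) pos sec (tokens Ls S).length s i → s < S ∧ ∃ c ∈ Ls s, ∃ y,
        (w ++ τ).drop (pos i + 1) = c ++ y ∧ pos (i + 1) = pos i + 1 + c.length := by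
    rintro s i ⟨h1, rfl, h2⟩
    obtain ⟨t, b, h3, h4, h5, h6, h7⟩ := split i h1
    obtain ⟨h8, h9⟩ := of_tokens_eq h3
    refine ⟨h8, ?_⟩
    rcases t with _ | c
    · exact absurd ((get h6).1.symm.trans h2) (by simp)
    · refine ⟨c, h9 c rfl, _, (get h6).2, ?_⟩
      rw [h4]
      simp [tokenCode]
      omega
  refine ⟨pos, sec, (tokens Ls S).length, ⟨rfl, rfl, ?_, ?_, fun i hi => ?_⟩, fun i => ?_,
    fun i => ?_, ?_, fun s i hi => ?_, fun s hs c hc => ?_⟩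
  · simp only [hpos, List.take_length]
    rw [hw]
  · simp only [hsec, List.take_length]
    exact count_tokens _ _
  · obtain ⟨t, b, h3, h4, h5, h6, h7⟩ := split i hi
    have hlt : sec i < S := (of_tokens_eq h3).1
    have hpl : pos i < w.length := by
      refine lt_of_lt_of_le ?_ h7
      rw [h4]
      cases t <;> simp [tokenCode]
    refine ⟨hpl, h7, hlt, ?_⟩
    rcases t with _ | c
    · exact Or.inr ⟨by rw [(get h6).1]; simp, by rw [h5]; simp, by rw [h4]; rfl⟩
    · refine Or.inl ⟨(get h6).1, by rw [h5]; simp, fun k hk g hg => ?_⟩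
      obtain ⟨_, c', hc', y, h8, h9⟩ := item _ i ⟨hi, rfl, (get h6).1⟩
      rw [h9, h8, hlen k hk g c' (hg ▸ hc')]
  · rw [hw]
    conv_rhs => rw [← List.take_append_drop i (tokens Ls S), List.flatMap_append,
      List.length_append]
    exact Nat.le_add_right _ _
  · rw [← count_tokens Ls S]
    exact (List.take_sublist _ _).count_le _
  · rw [hw]
    generalize tokens Ls S = l
    induction l with
    | nil => simp
    | cons t l ih =>
      rw [List.flatMap_cons, List.length_append, List.length_cons]
      cases t <;> simp only [tokenCode, List.length_cons] <;> omega
  · obtain ⟨h, c, h1, y, h2, -⟩ := item s i hi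
    exact ⟨h, c, h1, y, h2⟩
  · obtain ⟨a, b, h1, rfl⟩ := exists_tokens_eq hs hc
    have h2 : (tokens Ls S).take a.length = a := by rw [h1]; simp
    have h3 : a.length < (tokens Ls S).length := by rw [h1]; simp
    obtain ⟨t, b', h4, h5, h6, h7, h8⟩ := split _ h3
    rw [h2, h1, List.append_cancel_left_eq, List.cons.injEq] at h4
    obtain ⟨rfl, rfl⟩ := h4
    exact ⟨a.length, ⟨h3, by simp only [hsec, h2], (get h7).1⟩, _, (get h7).2⟩

/-- An encoding of a database has a division that describes the database. -/
theorem Database.IsEncoding.exists_division {m : ℕ} {𝒢 : Database m} {w : Word}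
    (h : 𝒢.IsEncoding w) (τ : Word) : ∃ (pos sec : ℕ → ℕ) (n : ℕ),
      Division (w ++ τ) w.length (7 * m) pos sec n ∧ readDatabase m (w ++ τ) pos sec n = 𝒢 ∧
      (∀ i, pos i ≤ w.length) ∧ (∀ i, sec i ≤ 7 * m) ∧ n ≤ w.length := by
  obtain ⟨ws, h, rfl⟩ := h
  choose ns ds us ss ts ps ls hns hds hus hss hts hps hls hws using h
  let L : Fin m → ℕ → List Word := fun g k => match k with
    | 0 => (ns g).map Reader.name.enc
    | 1 => (ds g).map Reader.name.enc
    | 2 => (us g).map Reader.name.enc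
    | 3 => (ss g).map (Reader.edge.seq .name).enc
    | 4 => (ts g).map (Reader.edge.seq .name).enc
    | 5 => (ps g).map (Reader.elem.seq (.seq .name .name)).enc
    | 6 => (ls g).map (Reader.elem.seq .name).enc
    | _ => []
  let Ls : ℕ → List Word := fun s => if h : s / 7 < m then L ⟨s / 7, h⟩ (s % 7) else []
  have Ls_eq : ∀ (g : Fin m) (k : ℕ), k < 7 → Ls (7 * g + k) = L g k := by
    intro g k hk
    have h1 : (7 * (g : ℕ) + k) / 7 = g := by omega
    have h2 : (7 * (g : ℕ) + k) % 7 = k := by omega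
    simp only [Ls, h1, h2, g.2, dif_pos]
  have hw : (List.ofFn ws).flatten =
      (List.range (7 * m)).flatMap fun s => encodeList id (Ls s) := by
    rw [flatMap_range_mul, List.flatMap_def]
    congr 1
    apply List.ext_getElem
    · simp
    · intro i h1 h2
      have hi : i < m := by simpa using h1
      simp only [List.getElem_ofFn, List.getElem_map, List.getElem_range, List.range_succ,
        List.range_zero, List.nil_append, List.flatMap_append, List.flatMap_cons, List.flatMap_nil,
        List.append_nil]
      rw [Ls_eq ⟨i, hi⟩ 0 (by omega), Ls_eq ⟨i, hi⟩ 1 (by omega), Ls_eq ⟨i, hi⟩ 2 (by omega),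
        Ls_eq ⟨i, hi⟩ 3 (by omega), Ls_eq ⟨i, hi⟩ 4 (by omega), Ls_eq ⟨i, hi⟩ 5 (by omega),
        Ls_eq ⟨i, hi⟩ 6 (by omega), hws]
      simp only [L, encodeList_map, id, Reader.seq, Reader.name, Reader.edge, Reader.elem,
        List.append_assoc]
  have hlen : ∀ k < 7, ∀ g, ∀ c ∈ Ls (7 * g + k), ∀ y, itemLen k (c ++ y) = c.length := by
    intro k hk g c hc y
    by_cases hg : g < m
    · rw [Ls_eq ⟨g, hg⟩ k hk] at hc
      have aux : ∀ {X : Type} (r : Reader X) (l : List X), c ∈ l.map r.enc →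
          r.len (c ++ y) = c.length := by
        rintro X r l hc
        obtain ⟨x, -, rfl⟩ := List.mem_map.1 hc
        exact r.len_enc x y
      interval_cases k <;> exact aux _ _ hc
    · have : ¬ (7 * g + k) / 7 < m := by omega
      simp [Ls, this] at hc
  obtain ⟨pos, sec, n, h1, h2, h3, h4, h5, h6⟩ := GQL.exists_division Ls (7 * m) hw τ hlen
  refine ⟨pos, sec, n, h1, ?_, h2, h3, h4⟩
  have key : ∀ {X : Type} (r : Reader X) (l : List X) (A : Finset X) (g : Fin m) (k : ℕ), k < 7 →
      (∀ a, a ∈ l ↔ a ∈ A) → L g k = l.map r.enc →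
      section' r ((List.ofFn ws).flatten ++ τ) pos sec n (7 * g + k) = A := by
    intro X r l A g k hk hl hL
    ext a
    rw [mem_section', ← hl]
    constructor
    · rintro ⟨i, hi, rfl⟩
      obtain ⟨-, c, hc, y, e⟩ := h5 _ _ hi
      rw [Ls_eq g k hk, hL] at hc
      obtain ⟨x, hx, rfl⟩ := List.mem_map.1 hc
      rwa [e, r.read_enc]
    · intro ha
      obtain ⟨i, hi, y, e⟩ := h6 (7 * g + k) (by omega) (r.enc a)
        (by rw [Ls_eq g k hk, hL]; exact List.mem_map_of_mem ha)
      exact ⟨i, hi, by rw [e, r.read_enc]⟩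
  funext g
  simp only [readDatabase]
  have k0 := key .name _ _ g 0 (by omega) (hns g) rfl
  rw [Nat.add_zero] at k0
  rw [k0, key .name _ _ g 1 (by omega) (hds g) rfl, key .name _ _ g 2 (by omega) (hus g) rfl,
    key (Reader.edge.seq .name) _ _ g 3 (by omega) (hss g) rfl,
    key (Reader.edge.seq .name) _ _ g 4 (by omega) (hts g) rfl,
    key (Reader.elem.seq (.seq .name .name)) _ _ g 5 (by omega) (hps g) rfl,
    key (Reader.elem.seq .name) _ _ g 6 (by omega) (hls g) rfl]

end GQL

namespace Definability

open Complexity (Word delimit)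

variable {α : Type} [Ctx α]

theorem FO.forall_list {ι : Type} (s : List ι) {φ : ι → α → Prop} (h : ∀ i ∈ s, FO (φ i)) :
    FO fun a => ∀ i ∈ s, φ i a := by
  induction s with
  | nil => exact FO.top.congr fun a => by simp
  | cons i s ih =>
    exact ((h i (by simp)).and (ih fun j hj => h j (by simp [hj]))).congr fun a => by simp

theorem Term.ite {φ : α → Prop} [∀ a, Decidable (φ a)] (h : FO φ) {f g : α → ℕ} (hf : Term f) (hg : Term g) :
    Term fun a => if φ a then f a else g a :=
  Term.of (ψ := fun a i => (φ a ∧ f a = i) ∨ (¬ φ a ∧ g a = i))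
    (((FO.ren h Ren.a).and (FO.eq hf.w Num.v0)).or ((FO.ren h Ren.a).not.and (FO.eq hg.w Num.v0)))
    fun a i _ => by by_cases h : φ a <;> simp [h]

theorem Num.ite {φ : α → Prop} [∀ a, Decidable (φ a)] (h : FO φ) {f g : α → ℕ} (hf : Num f) (hg : Num g) :
    Num fun a => if φ a then f a else g a :=
  ⟨Term.ite h hf.term hg.term, fun a => by split_ifs; exacts [hf.le a, hg.le a]⟩

theorem Num.div {f : α → ℕ} (hf : Num f) (k : ℕ) : Num fun a => f a / (k + 1) := by
  refine ⟨Term.of (ψ := fun a q => ∃ r ≤ N a, r ≤ k ∧ (k + 1) * q + r = f a)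
    (FO.exists_le ((FO.le Num.v0 (Term.const k)).and (FO.eq (((Term.const (k + 1)).mul
      Num.v0.w.term).add Num.v0.term) hf.w.w))) fun a q _ => ?_,
    fun a => (Nat.div_le_self _ _).trans (hf.le a)⟩
  constructor
  · rintro ⟨r, _, hr, e⟩
    rw [← e, Nat.mul_add_div (by omega), Nat.div_eq_of_lt (by omega), Nat.add_zero]
  · rintro rfl
    exact ⟨f a % (k + 1), (Nat.mod_le _ _).trans (hf.le a),
      Nat.lt_succ_iff.1 (Nat.mod_lt _ (by omega)), Nat.div_add_mod _ _⟩

theorem word_eq_iff {u v : Word} {n : ℕ} (hn : u.length ≤ n) : u = v ↔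
    u.length = v.length ∧ ∀ j ≤ n, (u.getD j false = true ↔ v.getD j false = true) := by
  refine ⟨fun h => by simp [h], fun ⟨h1, h2⟩ => List.ext_getElem h1 fun j h3 h4 => ?_⟩
  have := h2 j (by omega)
  rw [List.getD_eq_getElem _ _ h3, List.getD_eq_getElem _ _ h4] at this
  exact Bool.eq_iff_iff.2 this

theorem FO.word_eq {u v : α → Word} (hu : WordIn u) (hv : WordIn v) : FO fun a => u a = v a :=
  ((FO.eq hu.len.term hv.len).and (FO.forall_le ((FO.bit hu.w Num.v0.term).iff
    (FO.bit hv.w Num.v0.term)))).congr fun a => word_eq_iff (hu.len.le a)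

theorem FO.word_eq_const {u : α → Word} (hu : WordIn u) (c : Word) : FO fun a => u a = c := by
  refine ((FO.eq (Term.const c.length) hu.len).and (FO.forall_list (List.range (c.length + 1))
    fun j _ => (FO.bit hu (Term.const j)).iff (FO.const (c.getD j false = true)))).congr fun a => ?_
  rw [eq_comm, word_eq_iff le_rfl]
  simp only [List.mem_range, Nat.lt_succ_iff]
  exact and_congr_right fun _ => forall_congr' fun _ => forall_congr' fun _ => iff_comm

theorem WordIn.append_const {u : α → Word} (hu : WordIn u) (c : Word)
    (hN : ∀ a, (u a).length + c.length ≤ N a) : WordIn fun a => u a ++ c := by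
  refine ⟨?_, Num.congr ⟨hu.len.term.add (.const c.length), hN⟩ fun a => List.length_append⟩
  refine ((FO.lt Num.v0.term hu.len.w).and (FO.bit hu.w Num.v0.term) |>.or
    (FO.forall_list (List.range c.length) fun j _ =>
      ((FO.eq (hu.len.w.term.add (.const j)) Num.v0).imp
        (FO.const (¬ c.getD j false = true)))).not).congr fun p => ?_
  rcases lt_or_ge p.i (u p.a).length with h | h
  · rw [List.getD_append _ _ _ _ h]
    refine ⟨fun h' => Or.inl ⟨h, h'⟩, ?_⟩
    rintro (h' | h')
    · exact h'.2
    · exact absurd (fun j _ e => by omega) h'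
  · rw [List.getD_append_right _ _ _ _ h]
    constructor
    · intro h'
      exact Or.inr fun h'' => h'' _ (List.mem_range.2 (getD_true_lt h')) (by omega) h'
    · rintro (h' | h')
      · omega
      · push Not at h'
        obtain ⟨j, -, e, h'⟩ := h'
        rwa [← e, Nat.add_sub_cancel_left]

end Definability

namespace GQL

open Definability
open Complexity (Word delimit)

theorem Reader.defLen_name : Reader.name.DefLen := fun hu =>
  ((Term.const 2).mul hu.readName.len.term).add .one

theorem Reader.defLen_edge : Reader.edge.DefLen := fun hu =>
  Term.add .one (Reader.defLen_name (hu.drop .one))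

theorem Reader.defLen_elem : Reader.elem.DefLen := fun {_ _ _} hu =>
  (Term.ite (FO.bit hu .zero) (Term.add .one (Reader.defLen_name (hu.drop .one)))
    (Term.add .one (Reader.defLen_edge (hu.drop .one)))).congr fun a => by
      simp only [Reader.elem]

theorem Reader.DefLen.seq {X Y : Type} {r : Reader X} {s : Reader Y} (hr : r.DefLen)
    (hs : s.DefLen) : (r.seq s).DefLen := fun hu => (hr hu).add (hs (hu.drop (hr hu)))

theorem term_itemLen (k : ℕ) {β : Type} [Ctx β] {u : β → Word} (hu : WordIn u) :
    Term fun b => itemLen k (u b) := by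
  unfold itemLen
  split_ifs
  · exact Reader.defLen_name hu
  · exact Reader.defLen_edge.seq Reader.defLen_name hu
  · exact Reader.defLen_elem.seq (Reader.defLen_name.seq Reader.defLen_name) hu
  · exact Reader.defLen_elem.seq Reader.defLen_name hu

/-- The value of kind `t` with a given name. -/
def val (t : ℕ) (c : Name) : Value :=
  if t = 0 then .elem (.node c) else if t = 1 then .elem (.edge (.directed c))
  else if t = 2 then .elem (.edge (.undirected c)) else .const c

/-- The value with a given code: the kind of the value and the position of its name in `V`. -/
def decode (V : Word) (i : ℕ) : Value := val (i % 4) (readName (V.drop (i / 4)))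

theorem val_eq_iff {t t' : ℕ} (ht : t < 4) (ht' : t' < 4) {c c' : Name} :
    val t c = val t' c' ↔ t = t' ∧ c = c' := by
  interval_cases t <;> interval_cases t' <;> simp [val]

theorem decode_code (V : Word) (q : ℕ) {t : ℕ} (ht : t < 4) :
    decode V (4 * min q V.length + t) = val t (readName (V.drop q)) := by
  rw [decode, show (4 * min q V.length + t) % 4 = t by omega,
    show (4 * min q V.length + t) / 4 = min q V.length by omega]
  rcases le_total q V.length with h | h
  · rw [min_eq_left h]
  · rw [min_eq_right h, List.drop_eq_nil_of_le h, List.drop_length]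

/-- Bit strings with definable divisions. -/
structure Layout {β : Type} [Ctx β] (V : β → Word) (pos sec : β → ℕ → ℕ) (n : β → ℕ) : Prop where
  word : WordIn V
  pos : FnIn pos
  sec : FnIn sec
  n : Num n
  room : ∀ b, 4 * (V b).length + 3 ≤ N b

/-- Definable values. -/
def DefVal {β : Type} [Ctx β] (V : β → Word) (v : β → Value) : Prop :=
  ∃ i, Num i ∧ ∀ b, v b = decode (V b) (i b)

section
variable {β γ : Type} [Ctx β] [Ctx γ] {V : β → Word} {pos sec : β → ℕ → ℕ} {n : β → ℕ}

theorem Layout.ren (L : Layout V pos sec n) {t : γ → β} (ht : Ren t) :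
    Layout (fun c => V (t c)) (fun c => pos (t c)) (fun c => sec (t c)) (fun c => n (t c)) :=
  ⟨L.word.ren ht, L.pos.ren ht, L.sec.ren ht, L.n.ren ht, fun c => (L.room _).trans_eq (ht.N_eq c)⟩

theorem DefVal.ren {v : β → Value} (h : DefVal V v) {t : γ → β} (ht : Ren t) :
    DefVal (fun c => V (t c)) fun c => v (t c) :=
  let ⟨_, hi, e⟩ := h
  ⟨_, hi.ren ht, fun c => e (t c)⟩

theorem DefVal.w {v : β → Value} (h : DefVal V v) :
    DefVal (fun p : Ext β => V p.a) fun p => v p.a := h.ren Ren.a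

theorem DefVal.decode {f : β → ℕ} (hf : Num f) : DefVal V fun b => GQL.decode (V b) (f b) :=
  ⟨f, hf, fun _ => rfl⟩

theorem DefVal.congr {v w : β → Value} (h : DefVal V v) (e : ∀ b, w b = v b) : DefVal V w := by
  rwa [show w = v from funext e]

theorem DefVal.ite {φ : β → Prop} [∀ b, Decidable (φ b)] (h : FO φ) {v v' : β → Value}
    (hv : DefVal V v) (hv' : DefVal V v') : DefVal V fun b => if φ b then v b else v' b := by
  obtain ⟨i, hi, e⟩ := hv
  obtain ⟨i', hi', e'⟩ := hv'
  classical
  refine ⟨_, Num.ite h hi hi', fun b => ?_⟩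
  by_cases hb : φ b <;> simp [hb, e, e']

theorem fo_decode_eq (hV : WordIn V) :
    FO fun p : Ext (Ext β) => decode (V p.a.a) p.a.i = decode (V p.a.a) p.i := by
  have h1 : Num fun p : Ext (Ext β) => p.a.i := Num.v0.w
  have h2 : Num fun p : Ext (Ext β) => p.i := Num.v0
  refine ((FO.eq (Term.sub h1 ((Term.const 4).mul (h1.div 3).term)).term
    (Term.sub h2 ((Term.const 4).mul (h2.div 3).term))).and
    (FO.word_eq (hV.w.w.drop (h1.div 3).term).readName (hV.w.w.drop (h2.div 3).term).readName)).congr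
    fun p => ?_
  rw [decode, decode, val_eq_iff (Nat.mod_lt _ (by omega)) (Nat.mod_lt _ (by omega))]
  refine and_congr_left fun _ => ?_
  omega

theorem DefVal.eq (hV : WordIn V) {v w : β → Value} (hv : DefVal V v) (hw : DefVal V w) :
    FO fun b => v b = w b := by
  obtain ⟨i, hi, e⟩ := hv
  obtain ⟨j, hj, e'⟩ := hw
  exact (FO.at₂ (fo_decode_eq hV) Ren.id hi hj).congr fun b => by rw [e, e']; rfl

namespace Layout

theorem name (L : Layout V pos sec n) {t : ℕ} (ht : t < 4) {p : β → ℕ} (hp : Term p) :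
    DefVal V fun b => val t (readName ((V b).drop (p b))) := by
  refine ⟨fun b => 4 * min (p b) (V b).length + t, ⟨(((Term.const 4).mul ?_).add (.const t)),
    fun b => ?_⟩, fun b => (decode_code _ _ ht).symm⟩
  · classical
    exact (Term.ite (FO.le L.word.len hp) L.word.len.term hp).congr fun b => by
      split_ifs <;> omega
  · have := L.room b
    omega

theorem edge (L : Layout V pos sec n) {p : β → ℕ} (hp : Term p) :
    DefVal V fun b => .elem (.edge (Reader.edge.read ((V b).drop (p b)))) := by
  refine (DefVal.ite (FO.bit L.word hp)
    (L.name (t := 1) (by omega) (hp.add .one)) (L.name (t := 2) (by omega) (hp.add .one))).congr fun b => ?_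
  simp only [Reader.edge, getD_drop, List.drop_drop, Nat.add_zero]
  split_ifs <;> rfl

theorem elem (L : Layout V pos sec n) {p : β → ℕ} (hp : Term p) :
    DefVal V fun b => .elem (Reader.elem.read ((V b).drop (p b))) := by
  refine (DefVal.ite (FO.bit L.word hp)
    (L.name (t := 0) (by omega) (hp.add .one)) (L.edge (hp.add .one))).congr fun b => ?_
  simp only [Reader.elem, getD_drop, List.drop_drop, Nat.add_zero]
  split_ifs <;> rfl

theorem item (L : Layout V pos sec n) (s : ℕ) : FO fun p : Ext β =>
    IsItem (V p.a) (pos p.a) (sec p.a) (n p.a) s p.i :=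
  ((FO.lt Num.v0.term L.n.w).and ((FO.eq (Term.const s) (Num.app L.sec.w Num.v0)).and
    (FO.bit L.word.w (Num.app L.pos.w Num.v0).term))).congr fun p => by
      rw [IsItem, eq_comm (a := s)]

theorem exists_section (L : Layout V pos sec n) {X : Type} (r : Reader X) (s : ℕ)
    {φ : β → X → Prop} (h : FO fun p : Ext β => φ p.a (r.read ((V p.a).drop (pos p.a p.i + 1)))) :
    FO fun b => ∃ x ∈ section' r (V b) (pos b) (sec b) (n b) s, φ b x :=
  (FO.exists_le (φ := fun b i => IsItem (V b) (pos b) (sec b) (n b) s i ∧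
    φ b (r.read ((V b).drop (pos b i + 1)))) ((L.item s).and h)).congr fun b => by
      simp only [mem_section']
      constructor
      · rintro ⟨_, ⟨i, hi, rfl⟩, hx⟩
        exact ⟨i, hi.1.le.trans (L.n.le b), hi, hx⟩
      · rintro ⟨i, _, hi, hx⟩
        exact ⟨_, ⟨i, hi, rfl⟩, hx⟩

theorem forall_section (L : Layout V pos sec n) {X : Type} (r : Reader X) (s : ℕ)
    {φ : β → X → Prop} (h : FO fun p : Ext β => φ p.a (r.read ((V p.a).drop (pos p.a p.i + 1)))) :
    FO fun b => ∀ x ∈ section' r (V b) (pos b) (sec b) (n b) s, φ b x :=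
  (L.exists_section r s (φ := fun b x => ¬ φ b x) h.not).not.congr fun b => by simp

/-- The position of an item. -/
theorem start (L : Layout V pos sec n) : Term fun p : Ext β => pos p.a p.i + 1 :=
  (Num.app L.pos.w Num.v0).term.add .one

end Layout

end

end GQL

namespace GQL

open Definability
open Complexity (Word delimit)

namespace Layout

variable {β : Type} [Ctx β] {V : β → Word} {pos sec : β → ℕ → ℕ} {n : β → ℕ} {m : ℕ}

theorem w (L : Layout V pos sec n) :
    Layout (fun p : Ext β => V p.a) (fun p => pos p.a) (fun p => sec p.a) (fun p => n p.a) :=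
  L.ren Ren.a

theorem node_mem (L : Layout V pos sec n) (g : Fin m) {v : β → Value} (hv : DefVal V v) :
    FO fun b => ∃ x ∈ (readDatabase m (V b) (pos b) (sec b) (n b) g).nodes, v b = .elem (.node x) :=
  L.exists_section .name _ (φ := fun b x => v b = .elem (.node x))
    (hv.w.eq L.word.w (L.w.name (t := 0) (by omega) L.start))

theorem dir_mem (L : Layout V pos sec n) (g : Fin m) {v : β → Value} (hv : DefVal V v) :
    FO fun b => ∃ x ∈ (readDatabase m (V b) (pos b) (sec b) (n b) g).dirEdges,
      v b = .elem (.edge (.directed x)) :=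
  L.exists_section .name _ (φ := fun b x => v b = .elem (.edge (.directed x)))
    (hv.w.eq L.word.w (L.w.name (t := 1) (by omega) L.start))

theorem undir_mem (L : Layout V pos sec n) (g : Fin m) {v : β → Value} (hv : DefVal V v) :
    FO fun b => ∃ x ∈ (readDatabase m (V b) (pos b) (sec b) (n b) g).undirEdges,
      v b = .elem (.edge (.undirected x)) :=
  L.exists_section .name _ (φ := fun b x => v b = .elem (.edge (.undirected x)))
    (hv.w.eq L.word.w (L.w.name (t := 2) (by omega) L.start))

theorem hasEdge (L : Layout V pos sec n) (g : Fin m) {e : β → Edge}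
    (he : DefVal V fun b => .elem (.edge (e b))) :
    FO fun b => (readDatabase m (V b) (pos b) (sec b) (n b) g).HasEdge (e b) :=
  ((L.dir_mem g he).or (L.undir_mem g he)).congr fun b => by
    cases e b <;> simp [PropertyGraph.HasEdge]

theorem hasNode (L : Layout V pos sec n) (g : Fin m) {x : β → Name}
    (hx : DefVal V fun b => .elem (.node (x b))) :
    FO fun b => x b ∈ (readDatabase m (V b) (pos b) (sec b) (n b) g).nodes :=
  (L.node_mem g hx).congr fun b => by simp

theorem hasElem (L : Layout V pos sec n) (g : Fin m) {a : β → Elem}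
    (ha : DefVal V fun b => .elem (a b)) :
    FO fun b => (readDatabase m (V b) (pos b) (sec b) (n b) g).HasElem (a b) :=
  ((L.node_mem g ha).or ((L.dir_mem g ha).or (L.undir_mem g ha))).congr fun b => by
    rcases a b with x | (x | x) <;> simp [PropertyGraph.HasElem, PropertyGraph.HasEdge]

/-- The position of the second component of an item. -/
theorem second (L : Layout V pos sec n) {X : Type} {r : Reader X} (hr : r.DefLen) {p : β → ℕ}
    (hp : Term p) : Term fun b => p b + r.len ((V b).drop (p b)) :=
  hp.add (hr (L.word.drop hp))

theorem edge_second (L : Layout V pos sec n) {p : β → ℕ} (hp : Term p) :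
    DefVal V fun b => .elem (.node ((Reader.edge.seq .name).read ((V b).drop (p b))).2) :=
  (L.name (t := 0) (by omega) (L.second Reader.defLen_edge hp)).congr fun b => by
    simp [Reader.seq, Reader.name, val]

/-- The typing conditions on sources are definable. -/
theorem ends (L : Layout V pos sec n) (g : Fin m) (s : ℕ) : FO fun b =>
    (∀ e x, (e, x) ∈ section' (Reader.edge.seq .name) (V b) (pos b) (sec b) (n b) s →
      (readDatabase m (V b) (pos b) (sec b) (n b) g).HasEdge e ∧
      x ∈ (readDatabase m (V b) (pos b) (sec b) (n b) g).nodes) ∧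
    ∀ e, (readDatabase m (V b) (pos b) (sec b) (n b) g).HasEdge e →
      ∃! x, (e, x) ∈ section' (Reader.edge.seq .name) (V b) (pos b) (sec b) (n b) s := by
  have h1 := L.forall_section (Reader.edge.seq .name) s (φ := fun b r =>
      (readDatabase m (V b) (pos b) (sec b) (n b) g).HasEdge r.1 ∧
      r.2 ∈ (readDatabase m (V b) (pos b) (sec b) (n b) g).nodes)
    ((L.w.hasEdge g (L.w.edge L.start)).and (L.w.hasNode g (L.w.edge_second L.start)))
  have h2 := L.forall_section .name (7 * g + 1) (φ := fun b x =>
      ∃ r ∈ section' (Reader.edge.seq .name) (V b) (pos b) (sec b) (n b) s, r.1 = .directed x)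
    (L.w.exists_section (Reader.edge.seq .name) s (φ := fun p r =>
      r.1 = .directed (Reader.name.read ((V p.a).drop (pos p.a p.i + 1))))
      (((L.w.w.edge L.w.start).eq L.word.w.w (L.w.name (t := 1) (by omega) L.start).w).congr
        fun p => by simp [Reader.seq, Reader.name, val]))
  have h3 := L.forall_section .name (7 * g + 2) (φ := fun b x =>
      ∃ r ∈ section' (Reader.edge.seq .name) (V b) (pos b) (sec b) (n b) s, r.1 = .undirected x)
    (L.w.exists_section (Reader.edge.seq .name) s (φ := fun p r =>
      r.1 = .undirected (Reader.name.read ((V p.a).drop (pos p.a p.i + 1))))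
      (((L.w.w.edge L.w.start).eq L.word.w.w (L.w.name (t := 2) (by omega) L.start).w).congr
        fun p => by simp [Reader.seq, Reader.name, val]))
  have h4 := L.forall_section (Reader.edge.seq .name) s (φ := fun b r =>
      ∀ r' ∈ section' (Reader.edge.seq .name) (V b) (pos b) (sec b) (n b) s,
        r'.1 = r.1 → r'.2 = r.2)
    (L.w.forall_section (Reader.edge.seq .name) s (φ := fun p r' =>
      r'.1 = ((Reader.edge.seq .name).read ((V p.a).drop (pos p.a p.i + 1))).1 →
      r'.2 = ((Reader.edge.seq .name).read ((V p.a).drop (pos p.a p.i + 1))).2)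
      ((((L.w.w.edge L.w.start).eq L.word.w.w (L.w.edge L.start).w).imp
      ((L.w.w.edge_second L.w.start).eq L.word.w.w (L.w.edge_second L.start).w)).congr
        fun p => by simp [Reader.seq]))
  refine (h1.and ((h2.and h3).and h4)).congr fun b => ?_
  constructor
  · rintro ⟨k1, k2⟩
    refine ⟨fun r hr => k1 _ _ hr, ⟨fun x hx => ?_, fun x hx => ?_⟩, ?_⟩
    · obtain ⟨y, hy, -⟩ := k2 (.directed x) hx
      exact ⟨_, hy, rfl⟩
    · obtain ⟨y, hy, -⟩ := k2 (.undirected x) hx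
      exact ⟨_, hy, rfl⟩
    · rintro ⟨e, x⟩ hx ⟨e', x'⟩ hx' h
      obtain rfl : e' = e := h
      exact (k2 _ (k1 _ _ hx).1).unique hx' hx
  · rintro ⟨k1, ⟨k2, k3⟩, k4⟩
    refine ⟨fun e x hx => k1 _ hx, fun e he => ?_⟩
    have : ∃ r ∈ section' (Reader.edge.seq .name) (V b) (pos b) (sec b) (n b) s, r.1 = e := by
      cases e with
      | directed x => exact k2 x he
      | undirected x => exact k3 x he
    obtain ⟨⟨e', x⟩, hx, rfl⟩ := this
    exact ⟨x, hx, fun y hy => k4 _ hx _ hy rfl⟩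

theorem valid (L : Layout V pos sec n) (g : Fin m) :
    FO fun b => (readDatabase m (V b) (pos b) (sec b) (n b) g).Valid := by
  have h1 := L.forall_section (Reader.elem.seq (.seq .name .name)) (7 * g + 5) (φ := fun b r =>
      (readDatabase m (V b) (pos b) (sec b) (n b) g).HasElem r.1)
    (L.w.hasElem g (L.w.elem L.start))
  have h2 := L.forall_section (Reader.elem.seq .name) (7 * g + 6) (φ := fun b r =>
      (readDatabase m (V b) (pos b) (sec b) (n b) g).HasElem r.1)
    (L.w.hasElem g (L.w.elem L.start))
  refine ((L.ends g (7 * g + 3)).and ((L.ends g (7 * g + 4)).and (h1.and h2))).congr fun b => ?_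
  constructor
  · intro h
    exact ⟨⟨h.src_mem, h.src_unique⟩, ⟨h.tgt_mem, h.tgt_unique⟩,
      fun r hr => h.property_mem _ _ _ hr, fun r hr => h.label_mem _ _ hr⟩
  · rintro ⟨⟨k1, k2⟩, ⟨k3, k4⟩, k5, k6⟩
    exact ⟨k1, k3, k2, k4, fun a k c h => k5 _ h, fun a l h => k6 _ h⟩

theorem division (L : Layout V pos sec n) {e : β → ℕ} (he : Num e) (S : ℕ) :
    FO fun b => Division (V b) (e b) S (pos b) (sec b) (n b) := by
  have hp : Num fun p : Ext β => pos p.a p.i := Num.app L.pos.w .v0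
  have hs : Num fun p : Ext β => sec p.a p.i := Num.app L.sec.w .v0
  have hp' : Num fun p : Ext (Ext β) => pos p.a.a p.i := Num.app L.pos.w.w .v0
  have hs' : Num fun p : Ext (Ext β) => sec p.a.a p.i := Num.app L.sec.w.w .v0
  have hbit : FO fun p : Ext (Ext β) => (V p.a.a).getD (pos p.a.a p.a.i) false = true :=
    FO.bit L.word.w.w hp.w.term
  have hS : FO fun p : Ext (Ext β) => sec p.a.a p.a.i < S :=
    ((FO.le hs.w (.const (S - 1))).and (.const (0 < S))).congr fun p => by omega
  have hlen : FO fun p : Ext (Ext β) => ∀ k ∈ List.range 7, ∀ g ≤ N p,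
      7 * g + k = sec p.a.a p.a.i → pos p.a.a p.a.i + 1 +
        itemLen k ((V p.a.a).drop (pos p.a.a p.a.i + 1)) = pos p.a.a p.i :=
    FO.forall_list _ fun k _ => FO.forall_le ((FO.eq (((Term.const 7).mul Num.v0.term).add
      (.const k)) hs.w.w).imp (FO.eq ((hp.w.w.term.add .one).add
        (term_itemLen k (L.word.w.w.w.drop (hp.w.w.term.add .one)))) hp'.w))
  have hstep : FO fun b => ∀ i ≤ N b, ∀ j ≤ N b, i < n b → i + 1 = j →
      pos b i < e b ∧ pos b j ≤ e b ∧ sec b i < S ∧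
      (((V b).getD (pos b i) false = true ∧ sec b i = sec b j ∧ ∀ k ∈ List.range 7, ∀ g ≤ N b,
        7 * g + k = sec b i → pos b i + 1 + itemLen k ((V b).drop (pos b i + 1)) = pos b j) ∨
      (¬ (V b).getD (pos b i) false = true ∧ sec b i + 1 = sec b j ∧ pos b i + 1 = pos b j)) :=
    FO.forall_le (FO.forall_le ((FO.lt Num.v0.w.term L.n.w.w).imp
      ((FO.eq (Num.v0.w.term.add .one) Num.v0).imp ((FO.lt hp.w.term he.w.w).and
      ((FO.le hp' he.w.w.term).and (hS.and
      ((hbit.and ((FO.eq hs.w.term hs').and hlen)).or (hbit.not.and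
        ((FO.eq (hs.w.term.add .one) hs').and (FO.eq (hp.w.term.add .one) hp'))))))))))
  refine ((FO.eq (Num.app L.pos .zero).term .zero).and
    ((FO.eq (Num.app L.sec .zero).term .zero).and ((FO.eq (Num.app L.pos L.n).term he).and
      ((FO.eq (.const S) (Num.app L.sec L.n)).and hstep)))).congr fun b => ?_
  constructor
  · intro h
    refine ⟨h.pos_zero, h.sec_zero, h.pos_end, h.sec_end.symm, ?_⟩
    rintro i - j - hi rfl
    obtain ⟨k1, k2, k3, k4⟩ := h.step i hi
    refine ⟨k1, k2, k3, k4.imp (fun ⟨k5, k6, k7⟩ => ⟨k5, k6.symm, fun k hk g _ e => ?_⟩)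
      fun ⟨k5, k6, k7⟩ => ⟨k5, k6.symm, k7.symm⟩⟩
    exact (k7 k (List.mem_range.1 hk) g e.symm).symm
  · rintro ⟨k1, k2, k3, k4, k5⟩
    refine ⟨k1, k2, k3, k4.symm, fun i hi => ?_⟩
    have hn := L.n.le b
    obtain ⟨k6, k7, k8, k9⟩ := k5 i (by omega) (i + 1) (by omega) hi rfl
    refine ⟨k6, k7, k8, k9.imp (fun ⟨l1, l2, l3⟩ => ⟨l1, l2.symm, fun k hk g e => ?_⟩)
      fun ⟨l1, l2, l3⟩ => ⟨l1, l2.symm, l3.symm⟩⟩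
    have := L.sec.le b i
    exact (l3 k (List.mem_range.2 hk) g (by omega) e.symm).symm

theorem pres (L : Layout V pos sec n) {K : ℕ} (hK : K ≠ 0)
    (hN : ∀ b, (4 * ((V b).length + 1) + K + 3) ^ K ≤ N b)
    (hc : ∀ b (c : Name), c.length ≤ K → ∃ q, readName ((V b).drop q) = c) :
    Pres K (fun b => readDatabase m (V b) (pos b) (sec b) (n b)) (fun b => decode (V b))
      (fun b => 4 * ((V b).length + 1)) := by
  have v1 : DefVal (fun p : Ext β => V p.a) fun p => decode (V p.a) p.i := .decode Num.v0
  have v2 : DefVal (fun p : Ext (Ext β) => V p.a.a) fun p => decode (V p.a.a) p.i := .decode Num.v0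
  have code : ∀ (b : β) (q : ℕ) {t : ℕ}, t < 4 → ∃ c < 4 * ((V b).length + 1),
      decode (V b) c = val t (readName ((V b).drop q)) := by
    intro b q t ht
    exact ⟨_, by omega, decode_code _ _ ht⟩
  have le_N : ∀ b c, c < 4 * ((V b).length + 1) → c ≤ N b := by
    intro b c h
    have := (Nat.le_self_pow hK _).trans (hN b)
    omega
  have ends : ∀ s, FO fun p : Ext (Ext β) =>
      ∃ r ∈ section' (Reader.edge.seq .name) (V p.a.a) (pos p.a.a) (sec p.a.a) (n p.a.a) s,
        decode (V p.a.a) p.a.i = .elem (.edge r.1) ∧ decode (V p.a.a) p.i = .elem (.node r.2) := by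
    intro s
    exact L.w.w.exists_section (Reader.edge.seq .name) s (φ := fun p r =>
        decode (V p.a.a) p.a.i = .elem (.edge r.1) ∧ decode (V p.a.a) p.i = .elem (.node r.2))
      ((v1.w.w.eq L.word.w.w.w (L.w.w.w.edge L.w.w.start)).and
        (v2.w.eq L.word.w.w.w (L.w.w.w.edge_second L.w.w.start)))
  refine ⟨fo_decode_eq L.word, fun g => L.w.node_mem g v1, fun g => L.w.dir_mem g v1,
    fun g => L.w.undir_mem g v1, fun g => ends _, fun g => ends _, fun g k => ?_, fun g l => ?_,
    fun c => ?_, fun b i => ?_, fun b => ⟨fun g x hx => ?_, fun g x hx => ?_, fun g x hx => ?_,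
      fun g r hr => ?_, fun g r hr => ?_⟩, hN, hK, fun b g a k c h => ?_, fun b c h => ?_⟩
  · have hp := L.w.w.w.second Reader.defLen_elem L.w.w.start
    have hp' := L.w.w.w.second Reader.defLen_name hp
    have hk : FO fun p : Ext (Ext (Ext β)) => ((Reader.elem.seq (.seq .name .name)).read
        ((V p.a.a.a).drop (pos p.a.a.a p.i + 1))).2.1 = k :=
      (FO.word_eq_const (L.word.w.w.w.drop hp).readName k).congr fun p => by
        simp [Reader.seq, Reader.name]
    have hc : DefVal (fun p : Ext (Ext (Ext β)) => V p.a.a.a) fun p => .const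
        ((Reader.elem.seq (.seq .name .name)).read ((V p.a.a.a).drop (pos p.a.a.a p.i + 1))).2.2 :=
      (L.w.w.w.name (t := 3) (by omega) hp').congr fun p => by
        simp [Reader.seq, Reader.name, val, add_assoc]
    refine (L.w.w.exists_section (Reader.elem.seq (.seq .name .name)) (7 * g + 5) (φ := fun p r =>
      r.2.1 = k ∧ decode (V p.a.a) p.a.i = .elem r.1 ∧ decode (V p.a.a) p.i = .const r.2.2)
      (hk.and ((v1.w.w.eq L.word.w.w.w (L.w.w.w.elem L.w.w.start)).and
        (v2.w.eq L.word.w.w.w hc)))).congr fun p => ?_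
    constructor
    · rintro ⟨a, c, h, h'⟩
      exact ⟨_, h, rfl, h'⟩
    · rintro ⟨⟨a, _, c⟩, h, rfl, h'⟩
      exact ⟨a, c, h, h'⟩
  · have hl : FO fun p : Ext (Ext β) => ((Reader.elem.seq .name).read
        ((V p.a.a).drop (pos p.a.a p.i + 1))).2 = l :=
      (FO.word_eq_const (L.word.w.w.drop (L.w.w.second Reader.defLen_elem L.w.start)).readName
        l).congr fun p => by simp [Reader.seq, Reader.name]
    refine (L.w.exists_section (Reader.elem.seq .name) (7 * g + 6) (φ := fun p r =>
      r.2 = l ∧ decode (V p.a) p.i = .elem r.1)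
      (hl.and (v1.w.eq L.word.w.w (L.w.w.elem L.w.start)))).congr fun p => ?_
    constructor
    · rintro ⟨a, h, h'⟩
      exact ⟨_, h, rfl, h'⟩
    · rintro ⟨⟨a, _⟩, h, rfl, h'⟩
      exact ⟨a, h, h'⟩
  · have h1 : Num fun p : Ext β => p.i := .v0
    refine ((FO.eq (Term.sub h1 ((Term.const 4).mul (h1.div 3).term)).term
      ⟨.const 3, fun p => (Nat.le_add_left 3 _).trans (L.room p.a)⟩).and
      (FO.word_eq_const (L.word.w.drop (h1.div 3).term).readName c)).congr fun p => ?_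
    rw [show Value.const c = val 3 c from rfl, decode,
      val_eq_iff (Nat.mod_lt _ (by omega)) (by omega)]
    refine and_congr_left fun _ => ?_
    omega
  · have : i % 4 < 4 := Nat.mod_lt _ (by omega)
    unfold decode
    interval_cases i % 4 <;> simp [val]
  · obtain ⟨i, -, rfl⟩ := mem_section'.1 hx
    exact code b _ (t := 0) (by omega)
  · obtain ⟨i, -, rfl⟩ := mem_section'.1 hx
    exact code b _ (t := 1) (by omega)
  · obtain ⟨i, -, rfl⟩ := mem_section'.1 hx
    exact code b _ (t := 2) (by omega)
  · obtain ⟨i, -, rfl⟩ := mem_section'.1 hr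
    simpa [Reader.seq, Reader.name, val] using code b _ (t := 0) (by omega)
  · obtain ⟨i, -, rfl⟩ := mem_section'.1 hr
    simpa [Reader.seq, Reader.name, val] using code b _ (t := 0) (by omega)
  · obtain ⟨i, -, e⟩ := mem_section'.1 h
    simp only [Reader.seq, Reader.name, Prod.mk.injEq, List.drop_drop] at e
    obtain ⟨j, hj, e'⟩ := code b _ (t := 3) (by omega)
    exact ⟨j, le_N b j hj, e'.trans (congrArg Value.const e.2.2)⟩
  · obtain ⟨q, rfl⟩ := hc b c h
    obtain ⟨j, hj, e⟩ := code b q (t := 3) (by omega)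
    exact ⟨j, le_N b j hj, e⟩

end Layout

end GQL

namespace GQL

open Definability
open Complexity (Word delimit)

/-- There is a bit string in which every bit string of length at most `K` can be read as a name. -/
theorem exists_constants (K : ℕ) : ∃ τ : Word, ∀ (w : Word) (c : Name), c.length ≤ K →
    ∃ q, readName ((w ++ τ).drop q) = c := by
  refine ⟨(List.finite_length_le Bool K).toFinset.toList.flatMap delimit, fun w c hc => ?_⟩
  have hmem : c ∈ (List.finite_length_le Bool K).toFinset.toList := by simpa using hc
  obtain ⟨a, b, e⟩ := List.append_of_mem hmem
  refine ⟨w.length + (a.flatMap delimit).length, ?_⟩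
  rw [e, ← List.drop_drop, List.drop_left, List.flatMap_append, List.drop_left, List.flatMap_cons,
    readName_delimit]

theorem Inp.pow_le_bound {T K C n : ℕ} (h2 : 2 * K ≤ T) (h4 : 4 ≤ T) (hC : C ≤ T) :
    (4 * n + C) ^ K ≤ Inp.bound T n :=
  calc (4 * n + C) ^ K ≤ ((n + T) ^ 2) ^ K := Nat.pow_le_pow_left (by nlinarith) K
    _ = (n + T) ^ (2 * K) := (pow_mul _ _ _).symm
    _ ≤ (n + T) ^ T := Nat.pow_le_pow_right (by omega) h2

/-- The bit string `w`, followed by `τ`, can be divided into the items of a valid database on which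
the output of the query is nonempty. -/
def HasOutput {m : ℕ} (Q : Query m) (g : Fin m) (τ w : Word) (pos sec : ℕ → ℕ) (n : ℕ) : Prop :=
  Division (w ++ τ) w.length (7 * m) pos sec n ∧
  (∀ i ∈ List.finRange m, (readDatabase m (w ++ τ) pos sec n i).Valid) ∧
  (Q.output (readDatabase m (w ++ τ) pos sec n) g).Nonempty

theorem mem_evaluationProblem_iff {m : ℕ} (Q : Query m) (g : Fin m) (τ w : Word) {B : ℕ}
    (hB : w.length ≤ B) (hm : 7 * m ≤ B) : w ∈ Q.evaluationProblem g ↔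
      ∃ pos : ℕ → ℕ, (∀ i, pos i ≤ B) ∧ ∃ sec : ℕ → ℕ, (∀ i, sec i ≤ B) ∧
      ∃ cnt : ℕ → ℕ, (∀ i, cnt i ≤ B) ∧ HasOutput Q g τ w pos sec (cnt 0) := by
  constructor
  · rintro ⟨𝒢, h1, h2, h3⟩
    obtain ⟨pos, sec, n, h4, rfl, h5, h6, h7⟩ := h2.exists_division τ
    exact ⟨pos, fun i => (h5 i).trans hB, sec, fun i => (h6 i).trans hm, fun _ => n,
      fun _ => h7.trans hB, h4, fun i _ => h1 i, h3⟩
  · rintro ⟨pos, -, sec, -, cnt, -, h1, h2, h3⟩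
    refine ⟨_, fun i => h2 i (List.mem_finRange i), ?_, h3⟩
    simpa using h1.isEncoding (by simp)

theorem Query.so_evaluationProblem {m : ℕ} (g : Fin m) (Q : Query m) (hw : Q.WellFormed ∅)
    (hb : Q.Basic) {full : Bool} (hp : full = true ∨ Q.Positive) :
    ∃ (T : ℕ) (_ : NeZero T), SO full fun c : Inp T => c.word ∈ Q.evaluationProblem g := by
  set K := sizeOf Q + 1 with hK
  obtain ⟨τ, hτ⟩ := exists_constants K
  set T := 4 * τ.length + 2 * K + 7 * m + 7 with hT
  have hT0 : NeZero T := ⟨by omega⟩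
  have hpow : ∀ c : Inp T, (4 * ((c.word ++ τ).length + 1) + K + 3) ^ K ≤ N c := fun c => by
    rw [List.length_append, show 4 * (c.word.length + τ.length + 1) + K + 3 =
      4 * c.word.length + (4 * τ.length + K + 7) by omega]
    exact Inp.pow_le_bound (by omega) (by omega) (by omega)
  have hroom : ∀ c : Inp T, 4 * (c.word ++ τ).length + 3 ≤ N c := fun c =>
    le_trans (by omega) ((Nat.le_self_pow (by omega) _).trans (hpow c))
  have hbound : ∀ c : Inp T, c.word.length + T ≤ N c := fun c => Inp.le_bound hT0.ne _
  refine ⟨T, hT0, ?_⟩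
  have hV : WordIn fun c : Inp T => c.word ++ τ := (Inp.wordIn T).append_const τ fun c => by
    have := hbound c
    omega
  have L : Layout (fun p : ((Inp T × Rel) × Rel) × Rel => p.1.1.1.word ++ τ)
      (fun p => fnOf p.1.1.2 (N p.1.1.1)) (fun p => fnOf p.1.2 (N p.1.1)) fun p =>
        fnOf p.2 (N p.1) 0 :=
    ⟨hV.r.r.r, FnIn.of_rel.r.r, FnIn.of_rel.r, Num.app FnIn.of_rel Definability.Num.zero,
      fun p => hroom p.1.1.1⟩
  have hP := L.pres (m := m) (K := K) (by omega) (fun p => hpow p.1.1.1) fun p c => hτ _ c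
  have hbody : SO full fun p : ((Inp T × Rel) × Rel) × Rel => HasOutput Q g τ p.1.1.1.word
      (fnOf p.1.1.2 (N p.1.1.1)) (fnOf p.1.2 (N p.1.1)) (fnOf p.2 (N p.1) 0) :=
    SO.and (.fo (L.division (Inp.wordIn T).len.r.r.r (7 * m)))
      (SO.and (.fo (FO.forall_list _ fun i _ => L.valid i))
        (Query.so_nonempty hP g hb hw hp (by omega)))
  have h1 := SO.exists_fn (α := (Inp T × Rel) × Rel) (φ := fun p cnt => HasOutput Q g τ p.1.1.word
    (fnOf p.1.2 (N p.1.1)) (fnOf p.2 (N p.1)) (cnt 0)) hbody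
  have h2 := SO.exists_fn (α := Inp T × Rel) (φ := fun p sec => ∃ cnt : ℕ → ℕ,
    (∀ i, cnt i ≤ N p) ∧ HasOutput Q g τ p.1.word (fnOf p.2 (N p.1)) sec (cnt 0)) h1
  have h3 := SO.exists_fn (α := Inp T) (φ := fun c pos => ∃ sec : ℕ → ℕ, (∀ i, sec i ≤ N c) ∧
    ∃ cnt : ℕ → ℕ, (∀ i, cnt i ≤ N c) ∧ HasOutput Q g τ c.word pos sec (cnt 0)) h2
  refine h3.congr fun c => ?_
  have := hbound c
  exact mem_evaluationProblem_iff Q g τ c.word (by omega) (by omega)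

end GQL

theorem mainTheorem6 (m : ℕ) (g : Fin m) (Q : GQL.Query m)
    (hwf : Q.WellFormed ∅) (hbasic : Q.Basic) :
    Q.evaluationProblem g ∈ Complexity.PH ∧
      (Q.Positive → Q.ShortestFree → Q.evaluationProblem g ∈ Complexity.NP) := by
  constructor
  · obtain ⟨T, _, h⟩ := Q.so_evaluationProblem g hwf hbasic (full := true) (Or.inl rfl)
    exact Definability.mem_PH_of_so h
  · intro hp _
    obtain ⟨T, _, h⟩ := Q.so_evaluationProblem g hwf hbasic (full := false) (Or.inr hp)
    exact Definability.mem_NP_of_so h
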